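/- Let $\hbar,x\in\mathbb C$, write $q^y:=e^{\hbar y}$ for $y\in\mathbb C$ (so $q=e^{\hbar}$), and assume $q^2\neq1$. Let ${\mathcal U}_q={\mathcal U}_q(su(2,2))$ be the complex algebra with generators $E_i,F_i,K_i^{\pm1}$, $i\in\{\mu,\beta,\nu\}$, and the usual Drinfeld–Jimbo relations of type $A_3$ with Dynkin diagram $\mu-\beta-\nu$ and Cartan matrix $(a_{ij})$: the $K_i$ commute and are invertible with inverses $K_i^{-1}$, $K_iE_j=q^{a_{ij}}E_jK_i$, $K_iF_j=q^{-a_{ij}}F_jK_i$, $[E_i,F_j]=\delta_{ij}(K_i-K_i^{-1})/(q-q^{-1})$, $E_\mu E_\nu=E_\nu E_\mu$, $F_\mu F_\nu=F_\nu F_\mu$, and $X_i^2X_j-(q+q^{-1})X_iX_jX_i+X_jX_i^2=0$ for $X=E,F$ and $a_{ij}=-1$. Its antipode is the anti-homomorphism $S$ with $S(E_i)=-K_i^{-1}E_i$, $S(F_i)=-F_iK_i$, $S(K_i)=K_i^{-1}$. Let ${\mathcal B}^+$ be generated by the $E_i,K_i^{\pm1}$, and let $\chi$ be a one-dimensional representation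 of ${\mathcal B}^+$, given by its values on the $K_i$ (it vanishes on the $E_i$). Let $H^0(\chi)$ be the space of linear functionals $f:{\mathcal U}_q\to\mathbb C$ with $f(ub)=\chi^{-1}(b)f(u)$ for $b\in{\mathcal B}^+$, where $\chi^{-1}$ has the values $\chi(K_i)^{-1}$ on $K_i$ and $0$ on $E_i$, such that the space ${\mathcal U}_q(\mathfrak k)\cdot f$ is finite-dimensional, where ${\mathcal U}_q(\mathfrak k)$ is generated by $E_\mu,F_\mu,E_\nu,F_\nu$ and all $K_i^{\pm1}$. It is a representation of ${\mathcal U}_q$ through $(u'\cdot f)(u)=f(S(u')u)$. For $u_0\in{\mathcal U}_q$ put $f_{u_0}(u)=f(uu_0)$. Let $w_1=F_\beta$, $w_2=F_\mu F_\beta-qF_\beta F_\mu$, $w_3=F_\nu F_\beta-qF_\beta F_\nu$, $w_4=F_\mu w_3-qw_3F_\mu$ and $w^\gamma=w_1^{\gamma_1}w_2^{\gamma_2}w_3^{\gamma_3}w_4^{\gamma_4}$. With $[n]_q=(q^n-q^{-n})/(q-q^{-1})$ and $[\gamma]_q!=\prod_i[\gamma_i]_q!$ let $\Psi_f(z)=\sum_\gamma\frac{f(w^\gamma)}{[\gamma]_q!}z^\gamma$.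 Let ${\mathcal P}=\mathbb C[z_1,z_2,z_3,z_4]$ and define operators on ${\mathcal P}$ by $([\partial/\partial z_i]_q\psi)(z)=\frac{\psi(\ldots,qz_i,\ldots)-\psi(\ldots,q^{-1}z_i,\ldots)}{(q-q^{-1})z_i}$, $K_iz^\alpha=q^{-\alpha_i}z^\alpha$, and $\square_q=K_2K_3[\frac{\partial}{\partial z_1}]_q[\frac{\partial}{\partial z_4}]_q-q[\frac{\partial}{\partial z_2}]_q[\frac{\partial}{\partial z_3}]_q$. Put $u_0^+=w_2-q^{-1}w_1F_\mu$, $u_0^-=w_3-q^{-1}w_1F_\nu$, $$D^+=\begin{pmatrix}K_4[\frac{\partial}{\partial z_2}]_q&[\frac{\partial}{\partial z_4}]_q\\-q^{-1}K_2K_3K_4^2[\frac{\partial}{\partial z_1}]_q&-q^{-1}K_4[\frac{\partial}{\partial z_3}]_q\end{pmatrix}+\begin{pmatrix}0&0\\-q^{-1}z_4(1-q^{-2})K_4\square_q&0\end{pmatrix},$$ and let $D^-$ be the matrix obtained from $D^+$ by interchanging $[\frac{\partial}{\partial z_2}]_q$ and $[\frac{\partial}{\partial z_3}]_q$ in the first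 summand. Let $\chi^+_x$ have the values $\chi^+_x(K_\mu)=q^{-1}$, $\chi^+_x(K_\nu)=1$, $\chi^+_x(K_\beta)=q^x$, and let $\chi^-_x$ have the values $\chi^-_x(K_\mu)=1$, $\chi^-_x(K_\nu)=q^{-1}$, $\chi^-_x(K_\beta)=q^x$. Then: (1) If $q$ is not a root of unity, then for every $x$ the maps $f\mapsto(\Psi_f,\Psi_{f_{F_\mu}})$ and $f\mapsto(\Psi_f,\Psi_{f_{F_\nu}})$ are linear bijections of $H^0(\chi^+_x)$ and of $H^0(\chi^-_x)$, respectively, onto ${\mathcal P}\otimes\mathbb C^2$. (2) Put $(w_4^R)^\dagger=[\frac{\partial}{\partial z_4}]_q$, $(w_2^R)^\dagger=K_4[\frac{\partial}{\partial z_2}]_q$, $(w_3^R)^\dagger=K_4[\frac{\partial}{\partial z_3}]_q$ and $(w_1^R)^\dagger=K_2K_3K_4^2[\frac{\partial}{\partial z_1}]_q+z_4(1-q^{-2})K_4\square_q$. If $q$ is not a root of unity, then $\Psi_{f_{w_i}}=(w_i^R)^\dagger\Psi_f$ for each $i$ and $\Psi_{f_{w_1w_4-qw_2w_3}}=\square_q\Psi_f$,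 for every linear functional $f$ on ${\mathcal U}_q$ such that $\Psi_f$ is a polynomial. Moreover, for every $q$ with $q^2\ne1$, $$D^+=\begin{pmatrix}(w_2^R)^\dagger&(w_4^R)^\dagger\\-q^{-1}(w_1^R)^\dagger&-q^{-1}(w_3^R)^\dagger\end{pmatrix},\qquad D^-=\begin{pmatrix}(w_3^R)^\dagger&(w_4^R)^\dagger\\-q^{-1}(w_1^R)^\dagger&-q^{-1}(w_2^R)^\dagger\end{pmatrix}.$$ (3) If $q^{2x-4}=1$, then $f\mapsto f_{u_0^+}$ maps $H^0(\chi^+_x)$ into $H^0(\chi^-_{x+1})$ and commutes with the actions of ${\mathcal U}_q$. If moreover $q$ is not a root of unity, it is given in the coordinates of (1) by $(\psi_1,\psi_2)\mapsto(\psi_1,\psi_2)D^+$ (row vector times matrix of operators, i.e. the $j$-th component is $\sum_iD^+_{ij}\psi_i$). (4) If $q^{2x-4}=1$, then $f\mapsto f_{u_0^-}$ maps $H^0(\chi^-_x)$ into $H^0(\chi^+_{x+1})$ and commutes with the actions of ${\mathcal U}_q$; if moreover $q$ is not a root of unity, it is given in the coordinates of (1) by $(\psi_1,\psi_2)\mapsto(\psi_1,\psi_2)D^-$.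 -/

import Mathlib

set_option linter.unusedSimpArgs false

noncomputable section

namespace QDirac

/-! ### The quantized enveloping algebra -/

/-- The three simple roots of `sl(4)`: `mu` and `nu` are the compact ones and `beta` is the
non-compact one, the middle node of the Dynkin diagram `mu - beta - nu`. -/
inductive Node
  | mu
  | beta
  | nu
  deriving DecidableEq

/-- The Cartan matrix. -/
def cartan : Node → Node → ℤ
  | .mu, .mu => 2
  | .beta, .beta => 2
  | .nu, .nu => 2
  | .mu, .beta => -1
  | .beta, .mu => -1
  | .nu, .beta => -1
  | .beta, .nu => -1
  | .mu, .nu => 0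
  | .nu, .mu => 0

theorem cartan_comm (i j : Node) : cartan i j = cartan j i := by
  cases i <;> cases j <;> rfl

theorem cartan_self (i : Node) : cartan i i = 2 := by
  cases i <;> rfl

/-- The generators `E_i, F_i, K_i, K_i⁻¹`. -/
inductive Gen
  | E (i : Node)
  | F (i : Node)
  | K (i : Node)
  | Kinv (i : Node)

/-- A generator as an element of the free algebra. -/
abbrev gen (g : Gen) : FreeAlgebra ℂ Gen := FreeAlgebra.ι ℂ g

/-- The defining relations of the quantized enveloping algebra of `sl(4, ℂ)`, the
complexification of `su(2,2)`. -/
inductive Rel (q : ℂˣ) : FreeAlgebra ℂ Gen → FreeAlgebra ℂ Gen → Prop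
  | K_Kinv (i : Node) : Rel q (gen (.K i) * gen (.Kinv i)) 1
  | Kinv_K (i : Node) : Rel q (gen (.Kinv i) * gen (.K i)) 1
  | K_K (i j : Node) : Rel q (gen (.K i) * gen (.K j)) (gen (.K j) * gen (.K i))
  | K_E (i j : Node) : Rel q (gen (.K i) * gen (.E j))
      (((q ^ cartan i j : ℂˣ) : ℂ) • (gen (.E j) * gen (.K i)))
  | K_F (i j : Node) : Rel q (gen (.K i) * gen (.F j))
      (((q ^ (-cartan i j) : ℂˣ) : ℂ) • (gen (.F j) * gen (.K i)))
  | E_F_same (i : Node) : Rel q (gen (.E i) * gen (.F i) - gen (.F i) * gen (.E i))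
      (((q : ℂ) - (q : ℂ)⁻¹)⁻¹ • (gen (.K i) - gen (.Kinv i)))
  | E_F_ne (i j : Node) (h : i ≠ j) : Rel q (gen (.E i) * gen (.F j)) (gen (.F j) * gen (.E i))
  | E_E (i j : Node) (h : cartan i j = 0) :
      Rel q (gen (.E i) * gen (.E j)) (gen (.E j) * gen (.E i))
  | F_F (i j : Node) (h : cartan i j = 0) :
      Rel q (gen (.F i) * gen (.F j)) (gen (.F j) * gen (.F i))
  | serre_E (i j : Node) (h : cartan i j = -1) :
      Rel q (gen (.E i) * gen (.E i) * gen (.E j)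
        - ((q : ℂ) + (q : ℂ)⁻¹) • (gen (.E i) * gen (.E j) * gen (.E i))
        + gen (.E j) * gen (.E i) * gen (.E i)) 0
  | serre_F (i j : Node) (h : cartan i j = -1) :
      Rel q (gen (.F i) * gen (.F i) * gen (.F j)
        - ((q : ℂ) + (q : ℂ)⁻¹) • (gen (.F i) * gen (.F j) * gen (.F i))
        + gen (.F j) * gen (.F i) * gen (.F i)) 0

/-- The quantized enveloping algebra `U_q = U_q(su(2,2))`, as a complex algebra. -/
def Uq (q : ℂˣ) : Type := RingQuot (Rel q)

instance (q : ℂˣ) : Ring (Uq q) := inferInstanceAs (Ring (RingQuot (Rel q)))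

instance (q : ℂˣ) : Algebra ℂ (Uq q) :=
  inferInstanceAs (Algebra ℂ (RingQuot (Rel q)))

section Algebra

variable (q : ℂˣ)

/-- The quotient map from the free algebra. -/
def toUq : FreeAlgebra ℂ Gen →ₐ[ℂ] Uq q := RingQuot.mkAlgHom ℂ (Rel q)

/-- The generator `E_i` of `U_q`. -/
def E (i : Node) : Uq q := toUq q (gen (.E i))
/-- The generator `F_i` of `U_q`. -/
def F (i : Node) : Uq q := toUq q (gen (.F i))
/-- The generator `K_i` of `U_q`. -/
def K (i : Node) : Uq q := toUq q (gen (.K i))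
/-- The generator `K_i⁻¹` of `U_q`. -/
def Kinv (i : Node) : Uq q := toUq q (gen (.Kinv i))

variable {q}

theorem toUq_rel {a b : FreeAlgebra ℂ Gen} (h : Rel q a b) : toUq q a = toUq q b :=
  RingQuot.mkAlgHom_rel ℂ h

theorem K_mul_Kinv (i : Node) : K q i * Kinv q i = 1 := by
  simpa [K, Kinv] using toUq_rel (Rel.K_Kinv (q := q) i)

theorem Kinv_mul_K (i : Node) : Kinv q i * K q i = 1 := by
  simpa [K, Kinv] using toUq_rel (Rel.Kinv_K (q := q) i)

theorem K_mul_K (i j : Node) : K q i * K q j = K q j * K q i := by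
  simpa [K] using toUq_rel (Rel.K_K (q := q) i j)

theorem K_mul_E (i j : Node) :
    K q i * E q j = ((q ^ cartan i j : ℂˣ) : ℂ) • (E q j * K q i) := by
  simpa only [E, F, K, map_mul, map_smul] using toUq_rel (Rel.K_E (q := q) i j)

theorem K_mul_F (i j : Node) :
    K q i * F q j = ((q ^ (-cartan i j) : ℂˣ) : ℂ) • (F q j * K q i) := by
  simpa only [E, F, K, map_mul, map_smul] using toUq_rel (Rel.K_F (q := q) i j)

theorem E_mul_F_same (i : Node) :
    E q i * F q i = F q i * E q i + ((q : ℂ) - (q : ℂ)⁻¹)⁻¹ • (K q i - Kinv q i) := by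
  have h := toUq_rel (Rel.E_F_same (q := q) i)
  simp only [map_sub, map_mul, map_smul] at h
  exact eq_add_of_sub_eq' h

theorem E_mul_F_ne {i j : Node} (h : i ≠ j) : E q i * F q j = F q j * E q i := by
  simpa only [E, F, map_mul] using toUq_rel (Rel.E_F_ne (q := q) i j h)

theorem E_mul_E {i j : Node} (h : cartan i j = 0) : E q i * E q j = E q j * E q i := by
  simpa only [E, F, map_mul] using toUq_rel (Rel.E_E (q := q) i j h)

theorem F_mul_F {i j : Node} (h : cartan i j = 0) : F q i * F q j = F q j * F q i := by
  simpa only [E, F, map_mul] using toUq_rel (Rel.F_F (q := q) i j h)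

theorem serre_E {i j : Node} (h : cartan i j = -1) :
    E q i * E q i * E q j - ((q : ℂ) + (q : ℂ)⁻¹) • (E q i * E q j * E q i)
      + E q j * E q i * E q i = 0 := by
  simpa only [E, F, map_add, map_sub, map_mul, map_smul, map_zero] using
    toUq_rel (Rel.serre_E (q := q) i j h)

theorem serre_F {i j : Node} (h : cartan i j = -1) :
    F q i * F q i * F q j - ((q : ℂ) + (q : ℂ)⁻¹) • (F q i * F q j * F q i)
      + F q j * F q i * F q i = 0 := by
  simpa only [E, F, map_add, map_sub, map_mul, map_smul, map_zero] using
    toUq_rel (Rel.serre_F (q := q) i j h)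

/-- A subalgebra of `U_q` that contains the generators is everything. -/
theorem Uq_induction {P : Uq q → Prop}
    (hE : ∀ i, P (E q i)) (hF : ∀ i, P (F q i)) (hK : ∀ i, P (K q i))
    (hKinv : ∀ i, P (Kinv q i)) (hc : ∀ c : ℂ, P (algebraMap ℂ (Uq q) c))
    (hadd : ∀ a b, P a → P b → P (a + b)) (hmul : ∀ a b, P a → P b → P (a * b)) (u : Uq q) :
    P u := by
  obtain ⟨a, rfl⟩ := RingQuot.mkAlgHom_surjective ℂ (Rel q) u
  change P (toUq q a)
  induction a using FreeAlgebra.induction with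
  | grade0 r => simpa using hc r
  | grade1 x => cases x with
    | E i => exact hE i
    | F i => exact hF i
    | K i => exact hK i
    | Kinv i => exact hKinv i
  | mul a b ha hb => simpa using hmul _ _ ha hb
  | add a b ha hb => simpa using hadd _ _ ha hb

/-! ### The antipode -/

theorem E_mul_Kinv (i j : Node) :
    E q j * Kinv q i = ((q ^ cartan i j : ℂˣ) : ℂ) • (Kinv q i * E q j) := by
  have h := congrArg (fun t => Kinv q i * t * Kinv q i) (K_mul_E (q := q) i j)
  simp only [mul_smul_comm, smul_mul_assoc] at h
  rw [← mul_assoc, Kinv_mul_K, one_mul, mul_assoc, mul_assoc, K_mul_Kinv, mul_one] at h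
  exact h

theorem Kinv_mul_E (i j : Node) :
    Kinv q i * E q j = ((q ^ (-cartan i j) : ℂˣ) : ℂ) • (E q j * Kinv q i) := by
  rw [E_mul_Kinv, smul_smul, ← Units.val_mul, ← zpow_add]; simp

theorem Kinv_mul_F (i j : Node) :
    Kinv q i * F q j = ((q ^ cartan i j : ℂˣ) : ℂ) • (F q j * Kinv q i) := by
  have h := congrArg (fun t => Kinv q i * t * Kinv q i) (K_mul_F (q := q) i j)
  simp only [mul_smul_comm, smul_mul_assoc] at h
  rw [← mul_assoc, Kinv_mul_K, one_mul, mul_assoc, mul_assoc, K_mul_Kinv, mul_one] at h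
  rw [h, smul_smul, ← Units.val_mul, ← zpow_add]; simp

theorem Kinv_mul_K_comm (i j : Node) : Kinv q i * K q j = K q j * Kinv q i := by
  have h := congrArg (fun t => Kinv q i * t * Kinv q i) (K_mul_K (q := q) i j)
  simp only [mul_assoc, K_mul_Kinv, mul_one] at h
  rw [← mul_assoc, ← mul_assoc, Kinv_mul_K, one_mul] at h
  exact h.symm

theorem Kinv_mul_Kinv (i j : Node) : Kinv q i * Kinv q j = Kinv q j * Kinv q i := by
  have h := congrArg (fun t => Kinv q j * t * Kinv q j) (Kinv_mul_K_comm (q := q) i j)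
  simp only [mul_assoc, K_mul_Kinv, mul_one] at h
  rw [← mul_assoc (Kinv q j) (K q j), Kinv_mul_K, one_mul] at h
  exact h.symm

/-- The values of the antipode on the generators:
`S(E_i) = -K_i⁻¹ E_i`, `S(F_i) = -F_i K_i`, `S(K_i) = K_i⁻¹`. -/
def antipodeGen (q : ℂˣ) : Gen → (Uq q)ᵐᵒᵖ
  | .E i => MulOpposite.op (-(Kinv q i * E q i))
  | .F i => MulOpposite.op (-(F q i * K q i))
  | .K i => MulOpposite.op (Kinv q i)
  | .Kinv i => MulOpposite.op (K q i)

theorem antipode_rel (q : ℂˣ) ⦃a b : FreeAlgebra ℂ Gen⦄ (h : Rel q a b) :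
    FreeAlgebra.lift ℂ (antipodeGen q) a = FreeAlgebra.lift ℂ (antipodeGen q) b := by
  have hz : ∀ m n : ℤ, ((q ^ m : ℂˣ) : ℂ) * ((q ^ n : ℂˣ) : ℂ) = ((q ^ (m + n) : ℂˣ) : ℂ) := by
    intro m n
    rw [← Units.val_mul, ← zpow_add]
  have hc := cartan_comm
  have EKi := fun i j => E_mul_Kinv (q := q) i j
  have KF := fun i j => K_mul_F (q := q) i j
  have EKi' : ∀ (i j : Node) (t : Uq q), E q j * (Kinv q i * t)
      = ((q ^ cartan i j : ℂˣ) : ℂ) • (Kinv q i * (E q j * t)) := by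
    intro i j t
    rw [← mul_assoc, EKi, smul_mul_assoc, mul_assoc]
  have KF' : ∀ (i j : Node) (t : Uq q), K q i * (F q j * t)
      = ((q ^ (-cartan i j) : ℂˣ) : ℂ) • (F q j * (K q i * t)) := by
    intro i j t
    rw [← mul_assoc, KF, smul_mul_assoc, mul_assoc]
  cases h <;> apply MulOpposite.unop_injective <;>
    simp only [map_mul, map_sub, map_add, map_smul, map_one, map_zero, FreeAlgebra.lift_ι_apply,
      antipodeGen, MulOpposite.unop_mul, MulOpposite.unop_op, MulOpposite.unop_sub,
      MulOpposite.unop_add, MulOpposite.unop_smul, MulOpposite.unop_one, MulOpposite.unop_zero,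
      mul_neg, neg_mul, neg_neg]
  case K_Kinv i => exact K_mul_Kinv i
  case Kinv_K i => exact Kinv_mul_K i
  case K_K i j => exact Kinv_mul_Kinv j i
  case K_E i j =>
    rw [mul_assoc, EKi, mul_smul_comm, ← mul_assoc, ← mul_assoc, Kinv_mul_Kinv, smul_neg]
  case K_F i j =>
    rw [mul_assoc, ← Kinv_mul_K_comm, ← mul_assoc, ← mul_assoc, Kinv_mul_F, smul_neg,
      smul_mul_assoc, smul_smul, hz]
    simp
  case E_F_same i =>
    have h1 : F q i * K q i * (Kinv q i * E q i) = F q i * E q i := by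
      rw [mul_assoc, ← mul_assoc (K q i), K_mul_Kinv, one_mul]
    have h2 : Kinv q i * E q i * (F q i * K q i) = E q i * F q i := by
      rw [Kinv_mul_E, smul_mul_assoc, mul_assoc, ← mul_assoc (Kinv q i), Kinv_mul_F,
        smul_mul_assoc, mul_assoc, Kinv_mul_K, mul_one, mul_smul_comm, smul_smul, hz]
      simp
    rw [h1, h2, E_mul_F_same, ← neg_sub (K q i), smul_neg]
    abel
  case E_F_ne i j hij =>
    have h1 : F q j * K q j * (Kinv q i * E q i)
        = ((q ^ (-cartan i i + cartan j i) : ℂˣ) : ℂ) • (F q j * E q i * (K q j * Kinv q i)) := by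
      rw [Kinv_mul_E, mul_smul_comm, mul_assoc, ← mul_assoc (K q j), K_mul_E, smul_mul_assoc,
        mul_smul_comm, smul_smul, hz]
      simp only [mul_assoc]
    have h2 : Kinv q i * E q i * (F q j * K q j)
        = ((q ^ (-cartan i i + cartan i j) : ℂˣ) : ℂ) • (E q i * F q j * (Kinv q i * K q j)) := by
      rw [Kinv_mul_E, smul_mul_assoc, mul_assoc, ← mul_assoc (Kinv q i), Kinv_mul_F,
        smul_mul_assoc, mul_smul_comm, smul_smul, hz]
      simp only [mul_assoc]
    rw [h1, h2, hc j i, E_mul_F_ne hij, Kinv_mul_K_comm]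
  case E_E i j hij =>
    rw [mul_assoc, ← mul_assoc (E q j), EKi, mul_assoc (Kinv q i), ← mul_assoc (E q i), EKi,
      hc j i, hij]
    simp only [zpow_zero, Units.val_one, one_smul, mul_assoc]
    rw [E_mul_E hij, ← mul_assoc, ← mul_assoc (Kinv q i), Kinv_mul_Kinv]
  case F_F i j hij =>
    rw [mul_assoc, ← mul_assoc (K q j), KF, mul_assoc (F q i), ← mul_assoc (K q i), KF,
      hc j i, hij]
    simp only [neg_zero, zpow_zero, Units.val_one, one_smul, mul_assoc]
    rw [← mul_assoc, ← mul_assoc (F q i), F_mul_F hij, K_mul_K]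
  case serre_E i j hij =>
    have hji := (hc j i).trans hij
    have hs := serre_E (q := q) hij
    have k1 : ∀ t : Uq q, Kinv q j * (Kinv q i * t) = Kinv q i * (Kinv q j * t) := by
      intro t
      rw [← mul_assoc, Kinv_mul_Kinv, mul_assoc]
    simp only [mul_assoc] at hs
    simp only [mul_assoc, EKi, EKi', mul_smul_comm, smul_smul, hij, hji, hz, k1, cartan_self,
      mul_neg, neg_mul, neg_neg, smul_neg]
    norm_num
    have h := congrArg (fun t => -(Kinv q i * (Kinv q i * (Kinv q j * t)))) hs
    simp only [mul_add, mul_sub, mul_smul_comm, mul_zero, neg_zero] at h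
    rw [← h]
    abel
  case serre_F i j hij =>
    have hji := (hc j i).trans hij
    have hs := serre_F (q := q) hij
    have k1 : ∀ t : Uq q, K q j * (K q i * t) = K q i * (K q j * t) := by
      intro t
      rw [← mul_assoc, K_mul_K, mul_assoc]
    simp only [mul_assoc, KF, KF', mul_smul_comm, smul_smul, hij, hji, hz, k1, cartan_self,
      K_mul_K j i]
    norm_num
    have h := congrArg (fun t => -(t * (K q i * (K q i * K q j)))) hs
    simp only [add_mul, sub_mul, smul_mul_assoc, zero_mul, neg_zero, mul_assoc] at h
    rw [← h]
    abel

/-- The antipode, an anti-homomorphism of `U_q`. -/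
def antipode (q : ℂˣ) : Uq q →ₐ[ℂ] (Uq q)ᵐᵒᵖ :=
  RingQuot.liftAlgHom ℂ ⟨FreeAlgebra.lift ℂ (antipodeGen q), antipode_rel q⟩

/-- `S(x)` as an element of `U_q`. -/
def S (x : Uq q) : Uq q := (antipode q x).unop

@[simp] theorem S_add (x y : Uq q) : S (x + y) = S x + S y := by simp [S]
@[simp] theorem S_mul (x y : Uq q) : S (x * y) = S y * S x := by simp [S]
@[simp] theorem S_smul (c : ℂ) (x : Uq q) : S (c • x) = c • S x := by simp [S]
@[simp] theorem S_algebraMap (c : ℂ) : S (algebraMap ℂ (Uq q) c) = algebraMap ℂ (Uq q) c := by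
  simp [S]

theorem S_E (i : Node) : S (E q i) = -(Kinv q i * E q i) := by
  have h : antipode q (E q i) = antipodeGen q (.E i) :=
    (RingQuot.liftAlgHom_mkAlgHom_apply ℂ _ _ _).trans (FreeAlgebra.lift_ι_apply _ _)
  rw [S, h]; rfl

theorem S_F (i : Node) : S (F q i) = -(F q i * K q i) := by
  have h : antipode q (F q i) = antipodeGen q (.F i) :=
    (RingQuot.liftAlgHom_mkAlgHom_apply ℂ _ _ _).trans (FreeAlgebra.lift_ι_apply _ _)
  rw [S, h]; rfl

theorem S_K (i : Node) : S (K q i) = Kinv q i := by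
  have h : antipode q (K q i) = antipodeGen q (.K i) :=
    (RingQuot.liftAlgHom_mkAlgHom_apply ℂ _ _ _).trans (FreeAlgebra.lift_ι_apply _ _)
  rw [S, h]; rfl

/-! ### The induced representation -/

variable (q) in
/-- Linear functionals on `U_q`. -/
abbrev Functional : Type := Module.Dual ℂ (Uq q)

variable (q) in
/-- The left action `(x · f)(u) = f(S(x) u)` of `U_q` on functionals. -/
def action : Uq q →ₐ[ℂ] Module.End ℂ (Functional q) where
  toFun x :=
    { toFun := fun f => f ∘ₗ LinearMap.mulLeft ℂ (S x)
      map_add' := fun _ _ => rfl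
      map_smul' := fun _ _ => rfl }
  map_one' := by
    ext f u
    have : S (1 : Uq q) = 1 := by simpa using S_algebraMap (q := q) 1
    simp [this]
  map_mul' x y := by ext f u; simp [mul_assoc]
  map_zero' := by
    ext f u
    have : S (0 : Uq q) = 0 := by simpa using S_algebraMap (q := q) 0
    simp [this]
  map_add' x y := by ext f u; simp [add_mul]
  commutes' c := by ext f u; simp [← Algebra.smul_def]

theorem action_apply (x : Uq q) (f : Functional q) (u : Uq q) :
    action q x f u = f (S x * u) := rfl

/-- The right translate `f_a`, `f_a(u) = f(u a)`. -/
def rightTranslate (a : Uq q) (f : Functional q) : Functional q :=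
  f ∘ₗ LinearMap.mulRight ℂ a

variable (q) in
/-- The quantized enveloping algebra of the maximal compact subalgebra
`su(2) × su(2)` together with its one-dimensional centre, i.e. of `s(u(2) × u(2))`: the subalgebra
generated by `E_i, F_i` for the compact roots `i = mu, nu`, and by all `K_i` and `K_i⁻¹`. -/
def Uk : Subalgebra ℂ (Uq q) :=
  Algebra.adjoin ℂ ({E q .mu, F q .mu, E q .nu, F q .nu} ∪ Set.range (K q) ∪ Set.range (Kinv q))

/-- The subspace `U_q(k) · f`. -/
def compactOrbit (f : Functional q) : Submodule ℂ (Functional q) :=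
  (Subalgebra.toSubmodule (Uk q)).map ((action q).toLinearMap.flip f)

/-- The finiteness condition: `U_q(k) · f` is finite-dimensional. -/
def FIN (f : Functional q) : Prop := FiniteDimensional ℂ (compactOrbit f)

theorem mem_compactOrbit {f g : Functional q} :
    g ∈ compactOrbit f ↔ ∃ k ∈ Uk q, action q k f = g := by
  simp [compactOrbit]

theorem FIN_zero : FIN (0 : Functional q) := by
  have h : compactOrbit (0 : Functional q) = ⊥ := by
    rw [eq_bot_iff]
    intro g hg
    obtain ⟨k, -, rfl⟩ := mem_compactOrbit.1 hg
    simp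
  unfold FIN
  rw [h]
  infer_instance

theorem FIN_add {f g : Functional q} (hf : FIN f) (hg : FIN g) : FIN (f + g) := by
  unfold FIN at *
  refine Submodule.finiteDimensional_of_le (S₂ := compactOrbit f ⊔ compactOrbit g) ?_
  intro h hh
  obtain ⟨k, hk, rfl⟩ := mem_compactOrbit.1 hh
  rw [map_add]
  exact Submodule.add_mem_sup (mem_compactOrbit.2 ⟨k, hk, rfl⟩) (mem_compactOrbit.2 ⟨k, hk, rfl⟩)

theorem FIN_smul {f : Functional q} (c : ℂ) (hf : FIN f) : FIN (c • f) := by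
  unfold FIN at *
  refine Submodule.finiteDimensional_of_le (S₂ := compactOrbit f) ?_
  intro h hh
  obtain ⟨k, hk, rfl⟩ := mem_compactOrbit.1 hh
  rw [map_smul]
  exact Submodule.smul_mem _ _ (mem_compactOrbit.2 ⟨k, hk, rfl⟩)

theorem FIN_action_compact {f : Functional q} {x : Uq q} (hx : x ∈ Uk q) (hf : FIN f) :
    FIN (action q x f) := by
  unfold FIN at *
  refine Submodule.finiteDimensional_of_le (S₂ := compactOrbit f) ?_
  intro h hh
  obtain ⟨k, hk, rfl⟩ := mem_compactOrbit.1 hh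
  refine mem_compactOrbit.2 ⟨k * x, mul_mem hk hx, ?_⟩
  rw [map_mul]; rfl

/-- If `U_q(k) x ⊆ V U_q(k)` with `V` finite-dimensional, then `x` preserves finiteness. -/
theorem FIN_action_of_le {f : Functional q} {x : Uq q} (V : Submodule ℂ (Uq q)) (hV : V.FG)
    (h : ∀ k ∈ Uk q, k * x ∈ V * Subalgebra.toSubmodule (Uk q)) (hf : FIN f) :
    FIN (action q x f) := by
  unfold FIN at *
  have hfg : (Submodule.map₂ (action q).toLinearMap V (compactOrbit f)).FG :=
    hV.map₂ _ (Submodule.fg_iff_finiteDimensional _ |>.2 hf)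
  have := Submodule.fg_iff_finiteDimensional _ |>.1 hfg
  refine Submodule.finiteDimensional_of_le
    (S₂ := Submodule.map₂ (action q).toLinearMap V (compactOrbit f)) ?_
  intro g hg
  obtain ⟨k, hk, rfl⟩ := mem_compactOrbit.1 hg
  have h1 : action q k (action q x f) = action q (k * x) f := by rw [map_mul]; rfl
  rw [h1]
  have h2 : ∀ y ∈ V * Subalgebra.toSubmodule (Uk q),
      action q y f ∈ Submodule.map₂ (action q).toLinearMap V (compactOrbit f) := by
    intro y hy
    induction hy using Submodule.mul_induction_on' with
    | mem_mul_mem v hv u hu =>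
      rw [map_mul]
      exact Submodule.apply_mem_map₂ (action q).toLinearMap hv (mem_compactOrbit.2 ⟨u, hu, rfl⟩)
    | add a _ b _ ha hb =>
      rw [map_add]
      exact Submodule.add_mem _ ha hb
  exact h2 _ (h k hk)

theorem E_mem_Uk {i : Node} (h : i ≠ .beta) : E q i ∈ Uk q := by
  cases i
  · exact Algebra.subset_adjoin (by simp)
  · exact absurd rfl h
  · exact Algebra.subset_adjoin (by simp)

theorem F_mem_Uk {i : Node} (h : i ≠ .beta) : F q i ∈ Uk q := by
  cases i
  · exact Algebra.subset_adjoin (by simp)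
  · exact absurd rfl h
  · exact Algebra.subset_adjoin (by simp)

theorem K_mem_Uk (i : Node) : K q i ∈ Uk q := Algebra.subset_adjoin (by simp)

theorem Kinv_mem_Uk (i : Node) : Kinv q i ∈ Uk q := Algebra.subset_adjoin (by simp)

/-- The finite-dimensional space spanned by `X, AX, BX, ABX`. -/
def fourSpan (A B X : Uq q) : Submodule ℂ (Uq q) :=
  Submodule.span ℂ {X, A * X, B * X, A * (B * X)}

theorem fourSpan_closed {A B X : Uq q} (hA : A ∈ Uk q) (hB : B ∈ Uk q) (hAB : A * B = B * A)
    (sA : A * A * X - ((q : ℂ) + (q : ℂ)⁻¹) • (A * X * A) + X * A * A = 0)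
    (sB : B * B * X - ((q : ℂ) + (q : ℂ)⁻¹) • (B * X * B) + X * B * B = 0) (w : Uq q)
    (hw : w ∈ fourSpan A B X * Subalgebra.toSubmodule (Uk q)) :
    A * w ∈ fourSpan A B X * Subalgebra.toSubmodule (Uk q) ∧
    B * w ∈ fourSpan A B X * Subalgebra.toSubmodule (Uk q) := by
  set W := fourSpan A B X * Subalgebra.toSubmodule (Uk q) with hW
  have m1 : ∀ u ∈ Uk q, X * u ∈ W := fun u hu =>
    Submodule.mul_mem_mul (Submodule.subset_span (by simp)) hu
  have m2 : ∀ u ∈ Uk q, A * X * u ∈ W := fun u hu =>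
    Submodule.mul_mem_mul (Submodule.subset_span (by simp)) hu
  have m3 : ∀ u ∈ Uk q, B * X * u ∈ W := fun u hu =>
    Submodule.mul_mem_mul (Submodule.subset_span (by simp)) hu
  have m4 : ∀ u ∈ Uk q, A * (B * X) * u ∈ W := fun u hu =>
    Submodule.mul_mem_mul (Submodule.subset_span (by simp)) hu
  have eA : A * (A * X) = ((q : ℂ) + (q : ℂ)⁻¹) • (A * X * A) - X * (A * A) := by
    rw [← mul_assoc, ← mul_assoc, ← sub_eq_zero, ← sA]; abel
  have eB : B * (B * X) = ((q : ℂ) + (q : ℂ)⁻¹) • (B * X * B) - X * (B * B) := by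
    rw [← mul_assoc, ← mul_assoc, ← sub_eq_zero, ← sB]; abel
  have cAB : ∀ t, B * (A * t) = A * (B * t) := by
    intro t; rw [← mul_assoc, ← hAB, mul_assoc]
  induction hw using Submodule.mul_induction_on' with
  | add a _ b _ ha hb =>
    rw [mul_add, mul_add]
    exact ⟨Submodule.add_mem _ ha.1 hb.1, Submodule.add_mem _ ha.2 hb.2⟩
  | mem_mul_mem v hv u hu =>
    have hu' : u ∈ Uk q := hu
    clear hu
    induction hv using Submodule.span_induction with
    | zero => simp
    | add a b _ _ ha hb =>
      rw [add_mul, mul_add, mul_add]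
      exact ⟨Submodule.add_mem _ ha.1 hb.1, Submodule.add_mem _ ha.2 hb.2⟩
    | smul c a _ ha =>
      rw [smul_mul_assoc, mul_smul_comm, mul_smul_comm]
      exact ⟨Submodule.smul_mem _ _ ha.1, Submodule.smul_mem _ _ ha.2⟩
    | mem v hv =>
      have hAu := mul_mem hA hu'
      have hBu := mul_mem hB hu'
      have hAAu := mul_mem hA hAu
      have hBBu := mul_mem hB hBu
      rcases hv with rfl | rfl | rfl | rfl
      · rw [← mul_assoc, ← mul_assoc]
        exact ⟨m2 u hu', m3 u hu'⟩
      · constructor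
        · rw [← mul_assoc, eA, sub_mul, smul_mul_assoc]
          refine Submodule.sub_mem _ (Submodule.smul_mem _ _ ?_) ?_
          · rw [mul_assoc (A * X)]; exact m2 _ hAu
          · rw [mul_assoc, mul_assoc]; exact m1 _ hAAu
        · rw [← mul_assoc, cAB]; exact m4 u hu'
      · constructor
        · rw [← mul_assoc]; exact m4 u hu'
        · rw [← mul_assoc, eB, sub_mul, smul_mul_assoc]
          refine Submodule.sub_mem _ (Submodule.smul_mem _ _ ?_) ?_
          · rw [mul_assoc (B * X)]; exact m3 _ hBu
          · rw [mul_assoc, mul_assoc]; exact m1 _ hBBu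
      · constructor
        · have e : A * (A * (B * X)) = ((q : ℂ) + (q : ℂ)⁻¹) • (A * (B * X) * A)
              - B * X * (A * A) := by
            rw [← cAB, ← cAB, eA, mul_sub, mul_smul_comm]
            simp only [mul_assoc]
          rw [← mul_assoc, e, sub_mul, smul_mul_assoc]
          refine Submodule.sub_mem _ (Submodule.smul_mem _ _ ?_) ?_
          · rw [mul_assoc _ A u]; exact m4 _ hAu
          · rw [mul_assoc, mul_assoc A]; exact m3 _ hAAu
        · have e : B * (A * (B * X)) = ((q : ℂ) + (q : ℂ)⁻¹) • (A * (B * X) * B)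
              - A * X * (B * B) := by
            rw [cAB, eB, mul_sub, mul_smul_comm]
            simp only [mul_assoc]
          rw [← mul_assoc, e, sub_mul, smul_mul_assoc]
          refine Submodule.sub_mem _ (Submodule.smul_mem _ _ ?_) ?_
          · rw [mul_assoc _ B u]; exact m4 _ hBu
          · rw [mul_assoc, mul_assoc B]; exact m2 _ hBBu

/-- Left multiplication by `t` preserves `V U_q(k)` once it maps `V` into it. -/
theorem mul_mem_of_forall {A B X t : Uq q}
    (h1 : t * X ∈ fourSpan A B X * Subalgebra.toSubmodule (Uk q))
    (h2 : t * (A * X) ∈ fourSpan A B X * Subalgebra.toSubmodule (Uk q))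
    (h3 : t * (B * X) ∈ fourSpan A B X * Subalgebra.toSubmodule (Uk q))
    (h4 : t * (A * (B * X)) ∈ fourSpan A B X * Subalgebra.toSubmodule (Uk q)) (w : Uq q)
    (hw : w ∈ fourSpan A B X * Subalgebra.toSubmodule (Uk q)) :
    t * w ∈ fourSpan A B X * Subalgebra.toSubmodule (Uk q) := by
  have hr : ∀ y ∈ fourSpan A B X * Subalgebra.toSubmodule (Uk q), ∀ u ∈ Uk q,
      y * u ∈ fourSpan A B X * Subalgebra.toSubmodule (Uk q) := by
    intro y hy u hu
    induction hy using Submodule.mul_induction_on' with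
    | mem_mul_mem v hv k hk =>
      rw [mul_assoc]
      exact Submodule.mul_mem_mul hv (mul_mem (S := Subalgebra ℂ (Uq q)) hk hu)
    | add a _ b _ ha hb =>
      rw [add_mul]
      exact Submodule.add_mem _ ha hb
  induction hw using Submodule.mul_induction_on' with
  | add a _ b _ ha hb =>
    rw [mul_add]
    exact Submodule.add_mem _ ha hb
  | mem_mul_mem v hv u hu =>
    rw [← mul_assoc]
    refine hr _ ?_ u hu
    clear hu
    induction hv using Submodule.span_induction with
    | zero => simp
    | add a b _ _ ha hb =>
      rw [mul_add]
      exact Submodule.add_mem _ ha hb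
    | smul c a _ ha =>
      rw [mul_smul_comm]
      exact Submodule.smul_mem _ _ ha
    | mem v hv =>
      rcases hv with rfl | rfl | rfl | rfl
      · exact h1
      · exact h2
      · exact h3
      · exact h4

/-- `U_q(k) X ⊆ V U_q(k)` once `V U_q(k)` is stable under the generators of `U_q(k)`. -/
theorem compact_mul_mem {A B X : Uq q}
    (h : ∀ t ∈ ({E q .mu, F q .mu, E q .nu, F q .nu} ∪ Set.range (K q) ∪ Set.range (Kinv q)
      : Set (Uq q)), ∀ w ∈ fourSpan A B X * Subalgebra.toSubmodule (Uk q),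
      t * w ∈ fourSpan A B X * Subalgebra.toSubmodule (Uk q)) (k : Uq q) (hk : k ∈ Uk q) :
    k * X ∈ fourSpan A B X * Subalgebra.toSubmodule (Uk q) := by
  have hX : X ∈ fourSpan A B X * Subalgebra.toSubmodule (Uk q) := by
    have := Submodule.mul_mem_mul (M := fourSpan A B X) (N := Subalgebra.toSubmodule (Uk q))
      (m := X) (n := 1) (Submodule.subset_span (by simp)) (one_mem (Uk q))
    simpa using this
  have : ∀ w ∈ fourSpan A B X * Subalgebra.toSubmodule (Uk q),
      k * w ∈ fourSpan A B X * Subalgebra.toSubmodule (Uk q) := by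
    induction hk using Algebra.adjoin_induction with
    | mem t ht => exact h t ht
    | algebraMap r =>
      intro w hw
      rw [← Algebra.smul_def]
      exact Submodule.smul_mem _ _ hw
    | add a b _ _ ha hb =>
      intro w hw
      rw [add_mul]
      exact Submodule.add_mem _ (ha w hw) (hb w hw)
    | mul a b _ _ ha hb =>
      intro w hw
      rw [mul_assoc]
      exact ha _ (hb w hw)
  exact this X hX

theorem FIN_action_E_beta {f : Functional q} (hf : FIN f) : FIN (action q (E q .beta) f) := by
  refine FIN_action_of_le (fourSpan (E q .mu) (E q .nu) (E q .beta))
    (Submodule.fg_span (Set.toFinite _)) (compact_mul_mem ?_) hf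
  have hE := fourSpan_closed (q := q) (A := E q .mu) (B := E q .nu) (X := E q .beta)
    (E_mem_Uk (by decide)) (E_mem_Uk (by decide)) (E_mul_E (by decide))
    (serre_E (by decide)) (serre_E (by decide))
  set W := fourSpan (E q .mu) (E q .nu) (E q .beta) * Subalgebra.toSubmodule (Uk q)
  have hXu : ∀ u ∈ Uk q, E q .beta * u ∈ W := fun u hu =>
    Submodule.mul_mem_mul (Submodule.subset_span (by simp)) hu
  have hX : E q .beta ∈ W := by simpa using hXu 1 (one_mem _)
  have hKX : ∀ i, K q i * E q .beta ∈ W := by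
    intro i
    rw [K_mul_E]
    exact Submodule.smul_mem _ _ (hXu _ (K_mem_Uk i))
  have hKE : ∀ i j w, K q i * w ∈ W → (∀ w ∈ W, E q j * w ∈ W) → K q i * (E q j * w) ∈ W := by
    intro i j w h1 h2
    rw [← mul_assoc, K_mul_E, smul_mul_assoc, mul_assoc]
    exact Submodule.smul_mem _ _ (h2 _ h1)
  have hKiX : ∀ i, Kinv q i * E q .beta ∈ W := by
    intro i
    rw [Kinv_mul_E]
    exact Submodule.smul_mem _ _ (hXu _ (Kinv_mem_Uk i))
  have hKiE : ∀ i j w, Kinv q i * w ∈ W → (∀ w ∈ W, E q j * w ∈ W) →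
      Kinv q i * (E q j * w) ∈ W := by
    intro i j w h1 h2
    rw [← mul_assoc, Kinv_mul_E, smul_mul_assoc, mul_assoc]
    exact Submodule.smul_mem _ _ (h2 _ h1)
  have hm := fun w hw => (hE w hw).1
  have hn := fun w hw => (hE w hw).2
  have hK : ∀ i, ∀ w ∈ W, K q i * w ∈ W := fun i => mul_mem_of_forall (hKX i)
    (hKE _ _ _ (hKX i) hm) (hKE _ _ _ (hKX i) hn) (hKE _ _ _ (hKE _ _ _ (hKX i) hn) hm)
  have hKi : ∀ i, ∀ w ∈ W, Kinv q i * w ∈ W := fun i => mul_mem_of_forall (hKiX i)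
    (hKiE _ _ _ (hKiX i) hm) (hKiE _ _ _ (hKiX i) hn) (hKiE _ _ _ (hKiE _ _ _ (hKiX i) hn) hm)
  have hFX : ∀ i, i ≠ .beta → F q i * E q .beta ∈ W := by
    intro i hi
    rw [← E_mul_F_ne hi.symm]
    exact hXu _ (F_mem_Uk hi)
  have hFE : ∀ i j w, w ∈ W → F q i * w ∈ W → (∀ w ∈ W, E q j * w ∈ W) →
      F q i * (E q j * w) ∈ W := by
    intro i j w hw h1 h2
    by_cases hij : j = i
    · subst hij
      have e : F q j * E q j = E q j * F q j - ((q : ℂ) - (q : ℂ)⁻¹)⁻¹ • (K q j - Kinv q j) := by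
        rw [E_mul_F_same]; abel
      rw [← mul_assoc, e, sub_mul, smul_mul_assoc, sub_mul, mul_assoc]
      exact Submodule.sub_mem _ (h2 _ h1)
        (Submodule.smul_mem _ _ (Submodule.sub_mem _ (hK _ _ hw) (hKi _ _ hw)))
    · rw [← mul_assoc, ← E_mul_F_ne hij, mul_assoc]
      exact h2 _ h1
  have hF : ∀ i, i ≠ .beta → ∀ w ∈ W, F q i * w ∈ W := fun i hi => mul_mem_of_forall (hFX i hi)
    (hFE _ _ _ hX (hFX i hi) hm) (hFE _ _ _ hX (hFX i hi) hn)
    (hFE _ _ _ (hn _ hX) (hFE _ _ _ hX (hFX i hi) hn) hm)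
  rintro t ((ht | ⟨i, rfl⟩) | ⟨i, rfl⟩)
  · rcases ht with rfl | rfl | rfl | rfl
    · exact hm
    · exact hF _ (by decide)
    · exact hn
    · exact hF _ (by decide)
  · exact hK i
  · exact hKi i

theorem FIN_action_F_beta {f : Functional q} (hf : FIN f) : FIN (action q (F q .beta) f) := by
  refine FIN_action_of_le (fourSpan (F q .mu) (F q .nu) (F q .beta))
    (Submodule.fg_span (Set.toFinite _)) (compact_mul_mem ?_) hf
  have hE := fourSpan_closed (q := q) (A := F q .mu) (B := F q .nu) (X := F q .beta)
    (F_mem_Uk (by decide)) (F_mem_Uk (by decide)) (F_mul_F (by decide))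
    (serre_F (by decide)) (serre_F (by decide))
  set W := fourSpan (F q .mu) (F q .nu) (F q .beta) * Subalgebra.toSubmodule (Uk q)
  have hXu : ∀ u ∈ Uk q, F q .beta * u ∈ W := fun u hu =>
    Submodule.mul_mem_mul (Submodule.subset_span (by simp)) hu
  have hX : F q .beta ∈ W := by simpa using hXu 1 (one_mem _)
  have hKX : ∀ i, K q i * F q .beta ∈ W := by
    intro i
    rw [K_mul_F]
    exact Submodule.smul_mem _ _ (hXu _ (K_mem_Uk i))
  have hKF : ∀ i j w, K q i * w ∈ W → (∀ w ∈ W, F q j * w ∈ W) → K q i * (F q j * w) ∈ W := by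
    intro i j w h1 h2
    rw [← mul_assoc, K_mul_F, smul_mul_assoc, mul_assoc]
    exact Submodule.smul_mem _ _ (h2 _ h1)
  have hKiX : ∀ i, Kinv q i * F q .beta ∈ W := by
    intro i
    rw [Kinv_mul_F]
    exact Submodule.smul_mem _ _ (hXu _ (Kinv_mem_Uk i))
  have hKiF : ∀ i j w, Kinv q i * w ∈ W → (∀ w ∈ W, F q j * w ∈ W) →
      Kinv q i * (F q j * w) ∈ W := by
    intro i j w h1 h2
    rw [← mul_assoc, Kinv_mul_F, smul_mul_assoc, mul_assoc]
    exact Submodule.smul_mem _ _ (h2 _ h1)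
  have hm := fun w hw => (hE w hw).1
  have hn := fun w hw => (hE w hw).2
  have hK : ∀ i, ∀ w ∈ W, K q i * w ∈ W := fun i => mul_mem_of_forall (hKX i)
    (hKF _ _ _ (hKX i) hm) (hKF _ _ _ (hKX i) hn) (hKF _ _ _ (hKF _ _ _ (hKX i) hn) hm)
  have hKi : ∀ i, ∀ w ∈ W, Kinv q i * w ∈ W := fun i => mul_mem_of_forall (hKiX i)
    (hKiF _ _ _ (hKiX i) hm) (hKiF _ _ _ (hKiX i) hn) (hKiF _ _ _ (hKiF _ _ _ (hKiX i) hn) hm)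
  have hEX : ∀ i, i ≠ .beta → E q i * F q .beta ∈ W := by
    intro i hi
    rw [E_mul_F_ne hi]
    exact hXu _ (E_mem_Uk hi)
  have hEF : ∀ i j w, w ∈ W → E q i * w ∈ W → (∀ w ∈ W, F q j * w ∈ W) →
      E q i * (F q j * w) ∈ W := by
    intro i j w hw h1 h2
    by_cases hij : i = j
    · subst hij
      rw [← mul_assoc, E_mul_F_same, add_mul, smul_mul_assoc, sub_mul, mul_assoc]
      exact Submodule.add_mem _ (h2 _ h1)
        (Submodule.smul_mem _ _ (Submodule.sub_mem _ (hK _ _ hw) (hKi _ _ hw)))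
    · rw [← mul_assoc, E_mul_F_ne hij, mul_assoc]
      exact h2 _ h1
  have hE' : ∀ i, i ≠ .beta → ∀ w ∈ W, E q i * w ∈ W := fun i hi => mul_mem_of_forall (hEX i hi)
    (hEF _ _ _ hX (hEX i hi) hm) (hEF _ _ _ hX (hEX i hi) hn)
    (hEF _ _ _ (hn _ hX) (hEF _ _ _ hX (hEX i hi) hn) hm)
  rintro t ((ht | ⟨i, rfl⟩) | ⟨i, rfl⟩)
  · rcases ht with rfl | rfl | rfl | rfl
    · exact hE' _ (by decide)
    · exact hm
    · exact hE' _ (by decide)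
    · exact hn
  · exact hK i
  · exact hKi i

/-- The finite functionals form a `U_q`-stable space. -/
theorem FIN_action (x : Uq q) : ∀ f : Functional q, FIN f → FIN (action q x f) := by
  induction x using Uq_induction with
  | hE i =>
    intro f hf
    by_cases hi : i = .beta
    · subst hi; exact FIN_action_E_beta hf
    · exact FIN_action_compact (E_mem_Uk hi) hf
  | hF i =>
    intro f hf
    by_cases hi : i = .beta
    · subst hi; exact FIN_action_F_beta hf
    · exact FIN_action_compact (F_mem_Uk hi) hf
  | hK i => exact fun f hf => FIN_action_compact (K_mem_Uk i) hf
  | hKinv i => exact fun f hf => FIN_action_compact (Kinv_mem_Uk i) hf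
  | hc c => exact fun f hf => FIN_action_compact (algebraMap_mem _ c) hf
  | hadd a b ha hb =>
    intro f hf
    rw [map_add]
    exact FIN_add (ha f hf) (hb f hf)
  | hmul a b ha hb =>
    intro f hf
    rw [map_mul]
    exact ha _ (hb f hf)

variable (q) in
/-- The space `H⁰(χ)` for the one-dimensional representation `χ` of the Borel subalgebra `B⁺`
(generated by the `E_i` and `K_i^{±1}`) with the values `χ i` on `K_i` and `0` on `E_i`: the
functionals `f` on `U_q` with `f(u b) = χ⁻¹(b) f(u)` for `b ∈ B⁺`, where `χ⁻¹` is the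
representation with `χ⁻¹(K_i) = χ(K_i)⁻¹` (by multiplicativity it is enough to require this
for the generators `b = K_i` and `b = E_i`), that satisfy the finiteness condition. -/
def H0 (χ : Node → ℂˣ) : Submodule ℂ (Functional q) where
  carrier := {f | (∀ u i, f (u * K q i) = (((χ i)⁻¹ : ℂˣ) : ℂ) * f u) ∧
    (∀ u i, f (u * E q i) = 0) ∧ FIN f}
  add_mem' := by
    rintro f g ⟨h1, h2, h3⟩ ⟨k1, k2, k3⟩
    refine ⟨fun u i => ?_, fun u i => ?_, FIN_add h3 k3⟩
    · simp [h1, k1, mul_add]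
    · simp [h2, k2]
  zero_mem' := ⟨by simp, by simp, FIN_zero⟩
  smul_mem' := by
    rintro c f ⟨h1, h2, h3⟩
    refine ⟨fun u i => ?_, fun u i => ?_, FIN_smul c h3⟩
    · simp [h1]; ring
    · simp [h2]

theorem action_mem_H0 {χ : Node → ℂˣ} (x : Uq q) (f : Functional q) (hf : f ∈ H0 q χ) :
    action q x f ∈ H0 q χ := by
  obtain ⟨h1, h2, h3⟩ := hf
  refine ⟨fun u i => ?_, fun u i => ?_, FIN_action x f h3⟩
  · rw [action_apply, ← mul_assoc, h1, action_apply]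
  · rw [action_apply, ← mul_assoc, h2]

variable (q) in
/-- The induced representation of `U_q` on `H⁰(χ)`. -/
def inducedRep (χ : Node → ℂˣ) : Uq q →ₐ[ℂ] Module.End ℂ (H0 q χ) where
  toFun x := (action q x).restrict (action_mem_H0 x)
  map_one' := by ext f : 2; simp
  map_mul' x y := by ext f : 2; simp
  map_zero' := by ext f : 2; simp
  map_add' x y := by ext f : 2; simp
  commutes' c := by ext f : 2; simp

/-! ### The quadratic algebra and the passage to functions on `ℂ⁴` -/

variable (q) in
/-- The generators `w_1, w_2, w_3, w_4` of the quadratic algebra, indexed from `0`. -/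
def w : Fin 4 → Uq q :=
  let w₁ := F q .beta
  let w₂ := F q .mu * F q .beta - (q : ℂ) • (F q .beta * F q .mu)
  let w₃ := F q .nu * F q .beta - (q : ℂ) • (F q .beta * F q .nu)
  ![w₁, w₂, w₃, F q .mu * w₃ - (q : ℂ) • (w₃ * F q .mu)]

variable (q) in
/-- The ordered monomial `w^γ = w_1^γ_1 w_2^γ_2 w_3^γ_3 w_4^γ_4`. -/
def wMon (γ : Fin 4 →₀ ℕ) : Uq q :=
  w q 0 ^ γ 0 * w q 1 ^ γ 1 * w q 2 ^ γ 2 * w q 3 ^ γ 3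

variable (q) in
/-- The `q`-integer `[n]_q = (qⁿ - q⁻ⁿ) / (q - q⁻¹)`. -/
def qInt (n : ℕ) : ℂ := ((q : ℂ) ^ n - ((q : ℂ)⁻¹) ^ n) / ((q : ℂ) - (q : ℂ)⁻¹)

variable (q) in
/-- The `q`-factorial `[n]_q! = [1]_q [2]_q ⋯ [n]_q`. -/
def qFact (n : ℕ) : ℂ := ∏ k ∈ Finset.range n, qInt q (k + 1)

/-- The function `Ψ_f(z) = f(∑_γ z^γ / [γ]_q! w^γ)`, as a formal power series in `z_1, …, z_4`: its
coefficient at `z^γ` is `f(w^γ) / [γ]_q!`. -/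
def Psi (f : Functional q) : MvPowerSeries (Fin 4) ℂ :=
  fun γ => f (wMon q γ) / ∏ i, qFact q (γ i)

/-- The space `𝒫` of polynomials on `ℂ⁴`, with variables `z_1, …, z_4` indexed from `0`. -/
abbrev Poly : Type := MvPolynomial (Fin 4) ℂ

/-- `Φ` identifies `H⁰(χ)` with `𝒫 ⊗ ℂ²` through the values of `f` on the elements
`p_1(w) + p_2(w) a`: it is a linear bijection, and the two components of `Φ f` are the polynomials
`Ψ` of the functionals `p ↦ f(p)` and `p ↦ f(p a)`. -/
def IsCoordinates (χ : Node → ℂˣ) (a : Uq q) (Φ : H0 q χ ≃ₗ[ℂ] (Fin 2 → Poly)) : Prop :=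
  ∀ f : H0 q χ, (Φ f 0 : MvPowerSeries (Fin 4) ℂ) = Psi (f : Functional q) ∧
    (Φ f 1 : MvPowerSeries (Fin 4) ℂ) = Psi (rightTranslate a (f : Functional q))

/-- The operator `T` on polynomials is the transform under `f ↦ Ψ_f` of the operator
`(w₀^R)† : f ↦ (p ↦ f(p w₀))`. -/
def IsTransform (w₀ : Uq q) (T : Module.End ℂ Poly) : Prop :=
  ∀ (f : Functional q) (p : Poly), (p : MvPowerSeries (Fin 4) ℂ) = Psi f →
    (T p : MvPowerSeries (Fin 4) ℂ) = Psi (rightTranslate w₀ f)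

/-! ### The `q`-difference operators -/

variable (q) in
/-- The `q`-derivative `[∂/∂z_i]_q`, `ψ ↦ (ψ(q z_i) - ψ(q⁻¹ z_i)) / ((q - q⁻¹) z_i)`; on monomials
`z_i^n ↦ [n]_q z_i^(n-1)`. -/
def dq (i : Fin 4) : Module.End ℂ Poly :=
  (MvPolynomial.basisMonomials (Fin 4) ℂ).constr ℂ
    fun γ => MvPolynomial.monomial (γ - Finsupp.single i 1) (qInt q (γ i))

variable (q) in
/-- The scaling operator `K_i z^α = q^(-α_i) z^α`. -/
def scale (i : Fin 4) : Module.End ℂ Poly :=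
  (MvPolynomial.basisMonomials (Fin 4) ℂ).constr ℂ
    fun γ => MvPolynomial.monomial γ (((q : ℂ)⁻¹) ^ γ i)

/-- Multiplication by the coordinate `z_i`. -/
def zmul (i : Fin 4) : Module.End ℂ Poly := LinearMap.mulLeft ℂ (MvPolynomial.X i)

variable (q) in
/-- The quantized wave operator
`□_q = K_2 K_3 [∂/∂z_1]_q [∂/∂z_4]_q - q [∂/∂z_2]_q [∂/∂z_3]_q`. -/
def box : Module.End ℂ Poly :=
  scale q 1 * scale q 2 * dq q 0 * dq q 3 - (q : ℂ) • (dq q 1 * dq q 2)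

variable (q) in
/-- The explicit `q`-difference operators that correspond to `(w_i^R)†`. -/
def wDag : Fin 4 → Module.End ℂ Poly :=
  ![scale q 1 * scale q 2 * scale q 3 ^ 2 * dq q 0
      + (1 - ((q : ℂ)⁻¹) ^ 2) • (zmul 3 * scale q 3 * box q),
    scale q 3 * dq q 1,
    scale q 3 * dq q 2,
    dq q 3]

variable (q) in
/-- The operator `D⁺`. -/
def Dplus : Matrix (Fin 2) (Fin 2) (Module.End ℂ Poly) :=
  !![scale q 3 * dq q 1, dq q 3;
     (-(q : ℂ)⁻¹) • (scale q 1 * scale q 2 * scale q 3 ^ 2 * dq q 0),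
     (-(q : ℂ)⁻¹) • (scale q 3 * dq q 2)]
  + !![0, 0;
     (-(q : ℂ)⁻¹ * (1 - ((q : ℂ)⁻¹) ^ 2)) • (zmul 3 * scale q 3 * box q), 0]

variable (q) in
/-- The operator `D⁻`. -/
def Dminus : Matrix (Fin 2) (Fin 2) (Module.End ℂ Poly) :=
  !![scale q 3 * dq q 2, dq q 3;
     (-(q : ℂ)⁻¹) • (scale q 1 * scale q 2 * scale q 3 ^ 2 * dq q 0),
     (-(q : ℂ)⁻¹) • (scale q 3 * dq q 1)]
  + !![0, 0;
     (-(q : ℂ)⁻¹ * (1 - ((q : ℂ)⁻¹) ^ 2)) • (zmul 3 * scale q 3 * box q), 0]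

/-- A matrix of operators acts on row vectors `(ψ_1, ψ_2)`:
`(ψ D)_j = ∑_i D_ij ψ_i`. -/
def rowMul (ψ : Fin 2 → Poly) (D : Matrix (Fin 2) (Fin 2) (Module.End ℂ Poly)) : Fin 2 → Poly :=
  fun j => ∑ i, D i j (ψ i)

/-! ### The characters and the intertwining elements -/

/-- `q^y = e^(ħ y)`, where `q = e^ħ`. -/
def qpow (ħ y : ℂ) : ℂˣ := Units.mk0 (Complex.exp (ħ * y)) (Complex.exp_ne_zero _)

/-- The character with the values `a, b, c` on `K_μ, K_β, K_ν`. -/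
def char (a b c : ℂˣ) : Node → ℂˣ
  | .mu => a
  | .beta => b
  | .nu => c

variable (q) in
/-- `u_0^+ = w_2 - q⁻¹ w_1 F_μ`. -/
def uPlus : Uq q := w q 1 - (q : ℂ)⁻¹ • (w q 0 * F q .mu)

variable (q) in
/-- `u_0^- = w_3 - q⁻¹ w_1 F_ν`. -/
def uMinus : Uq q := w q 2 - (q : ℂ)⁻¹ • (w q 0 * F q .nu)

/-- `f ↦ f_{u₀}` is an intertwiner from `H⁰(χ)` into `H⁰(δ)`: it maps `H⁰(χ)` into `H⁰(δ)` through
the map `T`, which commutes with the actions of `U_q`. -/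
def IsIntertwiner (u₀ : Uq q) (χ δ : Node → ℂˣ) (T : H0 q χ →ₗ[ℂ] H0 q δ) : Prop :=
  (∀ f : H0 q χ, (T f : Functional q) = rightTranslate u₀ (f : Functional q)) ∧
    ∀ (y : Uq q) (f : H0 q χ), T (inducedRep q χ y f) = inducedRep q δ y (T f)

end Algebra

end QDirac

end

namespace QDirac

variable {q : ℂˣ}

/-! ### Relations of the quadratic algebra -/

/-! Write v for a highest weight vector on which `K q i` acts by χ(K_i)⁻¹. The equivariance in `H0`
says that f is a linear form on the Verma module generated by v, through f(u) = f(u v). Finiteness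
under `Uk` adds two things. It makes f vanish on the singular vectors F_i^(N+1) v for compact i
(`H0_mul_F_pow_eq_zero`), so that f lives on the generalized Verma module spanned by the w^γ v and
w^γ F_m v, where m is the compact node with χ(K_m) = q⁻¹. It also bounds the degree of the γ with
f(w^γ) ≠ 0 or f(w^γ F_m) ≠ 0, because a grading element of `Uk` has different eigenvalues in
different degrees (`finite_support_of_FIN`). So f yields two polynomials.

These polynomials determine f because the vectors above span (`eq_zero_of_coordinates`). That every
pair occurs amounts to their linear independence. It is obtained from an explicit model: the
transposed action of U_q on functions of the exponents of w_1^a w_2^b w_3^c w_4^d F_mu^e, where all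
exponents are allowed to be arbitrary integers (`dualRep_rel`). Matrix coefficients of the model
have any prescribed coordinates (`exists_mem_H0_mu`), and the diagram automorphism carries this from
mu to nu.

The operators (w_i^R)† come from straightening w^γ w_i. The quadratic relations of the w_i follow
from the Serre relations by pushing F_mu and F_nu through them (`push_comm`). The one relation that
is not a q-commutation, between w_4 and w_1, is controlled by `qDet`, which commutes with w_4.

Finally, f ↦ f_{u₀} is an intertwiner because u₀ v is annihilated by the E_i up to elements killed
by f; for E_beta this is the condition q^(2x) = q⁴. Its matrix is read off from u₀ and from F_nu
u₀^+ or F_mu u₀^- modulo a left multiple of the lowering operator that f kills (`F_nu_mul_uPlus`,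
`F_mu_mul_uMinus`).

In the code the index of `w` starts at 0, so `w q 3` is w_4; the comments count from 1. -/

theorem q_ne_zero : (q : ℂ) ≠ 0 := q.ne_zero

theorem w_zero : w q 0 = F q .beta := rfl
theorem w_one : w q 1 = F q .mu * F q .beta - (q : ℂ) • (F q .beta * F q .mu) := rfl
theorem w_two : w q 2 = F q .nu * F q .beta - (q : ℂ) • (F q .beta * F q .nu) := rfl
theorem w_three : w q 3 = F q .mu * w q 2 - (q : ℂ) • (w q 2 * F q .mu) := rfl

theorem F_nu_mul_F_mu : F q .nu * F q .mu = F q .mu * F q .nu := F_mul_F (by decide)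

theorem F_nu_mul_F_mu_mul (t : Uq q) : F q .nu * (F q .mu * t) = F q .mu * (F q .nu * t) := by
  rw [← mul_assoc, F_nu_mul_F_mu, mul_assoc]

/-- F_mu and F_nu commute, so their q-commutators with w_1 can be taken in either order. This
restores the symmetry between mu and nu that the definition of w_4 hides. -/
theorem w_three_eq : w q 3 = F q .nu * w q 1 - (q : ℂ) • (w q 1 * F q .nu) := by
  simp only [w_three, w_two, w_one, sub_mul, mul_sub, smul_mul_assoc, mul_smul_comm, mul_assoc,
    F_nu_mul_F_mu, F_nu_mul_F_mu_mul]
  module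

theorem F_mu_mul_w_zero : F q .mu * w q 0 = (q : ℂ) • (w q 0 * F q .mu) + w q 1 := by
  rw [w_one, w_zero]; abel

theorem F_nu_mul_w_zero : F q .nu * w q 0 = (q : ℂ) • (w q 0 * F q .nu) + w q 2 := by
  rw [w_two, w_zero]; abel

theorem F_mu_mul_w_two : F q .mu * w q 2 = (q : ℂ) • (w q 2 * F q .mu) + w q 3 := by
  rw [w_three]; abel

theorem F_nu_mul_w_one : F q .nu * w q 1 = (q : ℂ) • (w q 1 * F q .nu) + w q 3 := by
  rw [w_three_eq]; abel

/-- The two `q`-commutation relations contained in a `q`-Serre relation. -/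
theorem serre_q_comm {A : Type*} [Ring A] [Algebra ℂ A] {X Y : A}
    (h : X * X * Y - ((q : ℂ) + (q : ℂ)⁻¹) • (X * Y * X) + Y * X * X = 0) :
    X * (X * Y - (q : ℂ) • (Y * X)) = (q : ℂ)⁻¹ • ((X * Y - (q : ℂ) • (Y * X)) * X) ∧
    (Y * X - (q : ℂ) • (X * Y)) * X = (q : ℂ)⁻¹ • (X * (Y * X - (q : ℂ) • (X * Y))) := by
  have hq := q_ne_zero (q := q)
  simp only [mul_assoc] at h
  constructor
  · rw [← sub_eq_zero, ← h]
    simp only [sub_mul, mul_sub, smul_mul_assoc, mul_smul_comm, mul_assoc]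
    match_scalars <;> field_simp
    ring
  · rw [← sub_eq_zero, ← h]
    simp only [sub_mul, mul_sub, smul_mul_assoc, mul_smul_comm, mul_assoc]
    match_scalars <;> field_simp
    ring

theorem F_mu_mul_w_one : F q .mu * w q 1 = (q : ℂ)⁻¹ • (w q 1 * F q .mu) :=
  (serre_q_comm (serre_F (i := .mu) (j := .beta) (by decide))).1

theorem F_nu_mul_w_two : F q .nu * w q 2 = (q : ℂ)⁻¹ • (w q 2 * F q .nu) :=
  (serre_q_comm (serre_F (i := .nu) (j := .beta) (by decide))).1

theorem w_one_mul_w_zero : w q 1 * w q 0 = (q : ℂ)⁻¹ • (w q 0 * w q 1) :=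
  (serre_q_comm (serre_F (i := .beta) (j := .mu) (by decide))).2

theorem w_two_mul_w_zero : w q 2 * w q 0 = (q : ℂ)⁻¹ • (w q 0 * w q 2) :=
  (serre_q_comm (serre_F (i := .beta) (j := .nu) (by decide))).2

/-- By `w_three_eq`, w_4 is a q-commutator of F_nu, which commutes with F_mu, and of w_2, past which
F_mu moves with the factor q⁻¹; the factor is inherited. -/
theorem F_mu_mul_w_three : F q .mu * w q 3 = (q : ℂ)⁻¹ • (w q 3 * F q .mu) := by
  simp only [w_three_eq, sub_mul, mul_sub, smul_mul_assoc, mul_smul_comm, mul_assoc,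
    F_nu_mul_F_mu, F_mu_mul_w_one, ← F_nu_mul_F_mu_mul]
  rw [← mul_assoc (F q .mu), F_mu_mul_w_one, smul_mul_assoc, mul_assoc]
  module

theorem F_nu_mul_w_three : F q .nu * w q 3 = (q : ℂ)⁻¹ • (w q 3 * F q .nu) := by
  simp only [w_three, sub_mul, mul_sub, smul_mul_assoc, mul_smul_comm, mul_assoc,
    F_nu_mul_F_mu_mul, F_nu_mul_w_two]
  rw [← mul_assoc (F q .nu), F_nu_mul_w_two, smul_mul_assoc, mul_assoc, F_nu_mul_F_mu]
  module

section

variable {A : Type*} [Ring A] [Algebra ℂ A]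

/-- Pushing `X` through both sides of `c b = r b c`. -/
theorem push_comm {X b c b' c' : A} {r s t : ℂ} (h : c * b = r • (b * c))
    (hb : X * b = s • (b * X) + b') (hc : X * c = t • (c * X) + c') :
    t • (c * b') + c' * b = r • (s • (b * c') + b' * c) := by
  have h1 : X * (c * b) = (t * s * r) • (b * (c * X)) + t • (c * b') + c' * b := by
    rw [← mul_assoc, hc, add_mul, smul_mul_assoc, mul_assoc, hb, mul_add, mul_smul_comm,
      ← mul_assoc c b X, h]
    simp only [smul_mul_assoc, mul_assoc]
    module
  have h2 : X * (c * b) = (t * s * r) • (b * (c * X)) + r • (s • (b * c') + b' * c) := by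
    rw [h, mul_smul_comm, ← mul_assoc, hb, add_mul, smul_mul_assoc, mul_assoc, hc, mul_add,
      mul_smul_comm]
    module
  rw [h1, add_assoc] at h2
  exact add_left_cancel h2

end

theorem q_pow_ne_one (hq : ∀ n : ℕ, 0 < n → q ^ n ≠ 1) {n : ℕ} (hn : 0 < n) : (q : ℂ) ^ n ≠ 1 := by
  intro h
  exact hq n hn (Units.ext (by simpa using h))

/-- Pushing F_mu through w_3 w_1 = q⁻¹ w_1 w_3 and F_nu through w_2 w_1 = q⁻¹ w_1 w_2 gives two
expressions that both contain w_4 w_1 - w_1 w_4. Their difference is (q + q⁻¹)[w_3, w_2] = 0, and q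
+ q⁻¹ = 0 would force q⁴ = 1. -/
theorem w_two_mul_w_one (hq : ∀ n : ℕ, 0 < n → q ^ n ≠ 1) : w q 2 * w q 1 = w q 1 * w q 2 := by
  have h0 := q_ne_zero (q := q)
  have h1 := push_comm (w_two_mul_w_zero (q := q)) F_mu_mul_w_zero F_mu_mul_w_two
  have h2 := push_comm (w_one_mul_w_zero (q := q)) F_nu_mul_w_zero F_nu_mul_w_one
  have h3 : ((q : ℂ) + (q : ℂ)⁻¹) • (w q 2 * w q 1 - w q 1 * w q 2) = 0 := by
    linear_combination (norm := module) h1 - h2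
  have h4 : (q : ℂ) + (q : ℂ)⁻¹ ≠ 0 := by
    intro h
    apply q_pow_ne_one hq (n := 4) (by norm_num)
    field_simp at h
    linear_combination ((q : ℂ) ^ 2 - 1) * h
  exact sub_eq_zero.1 ((smul_eq_zero.1 h3).resolve_left h4)

theorem w_three_mul_w_zero (hq : ∀ n : ℕ, 0 < n → q ^ n ≠ 1) :
    w q 3 * w q 0 = w q 0 * w q 3 - ((q : ℂ) - (q : ℂ)⁻¹) • (w q 1 * w q 2) := by
  have h0 := q_ne_zero (q := q)
  have h1 := push_comm (w_two_mul_w_zero (q := q)) F_mu_mul_w_zero F_mu_mul_w_two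
  rw [w_two_mul_w_one hq, smul_add, smul_smul, inv_mul_cancel₀ h0] at h1
  linear_combination (norm := module) h1

/-- F_mu is pushed through the commutation of w_3 and w_2. It passes w_2 without remainder and turns
w_3 into w_4, so only the relation between w_4 and w_2 survives. -/
theorem w_three_mul_w_one (hq : ∀ n : ℕ, 0 < n → q ^ n ≠ 1) :
    w q 3 * w q 1 = (q : ℂ)⁻¹ • (w q 1 * w q 3) := by
  have h1 := push_comm (r := 1) (b' := 0) ((w_two_mul_w_one hq).trans (one_smul ℂ _).symm)
    (F_mu_mul_w_one.trans (add_zero _).symm) F_mu_mul_w_two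
  simpa using h1

theorem w_three_mul_w_two (hq : ∀ n : ℕ, 0 < n → q ^ n ≠ 1) :
    w q 3 * w q 2 = (q : ℂ)⁻¹ • (w q 2 * w q 3) := by
  have h1 := push_comm (r := 1) (b' := 0) ((w_two_mul_w_one hq).symm.trans (one_smul ℂ _).symm)
    (F_nu_mul_w_two.trans (add_zero _).symm) F_nu_mul_w_one
  simpa using h1

/-! ### Moving powers of w_4 past w_1: the quantum determinant -/

theorem pow_mul_of_q_comm {A : Type*} [Ring A] [Algebra ℂ A] {X Y : A} {r : ℂ}
    (h : Y * X = r • (X * Y)) (n : ℕ) : Y ^ n * X = r ^ n • (X * Y ^ n) := by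
  induction n with
  | zero => simp
  | succ n ih =>
    rw [pow_succ', mul_assoc, ih, mul_smul_comm, ← mul_assoc, h, smul_mul_assoc, smul_smul,
      mul_assoc, pow_succ]

/-- The quantum determinant `w_1 w_4 - q w_2 w_3`. -/
noncomputable def qDet (q : ℂˣ) : Uq q := w q 0 * w q 3 - (q : ℂ) • (w q 1 * w q 2)

theorem w_three_mul_w_zero_eq (hq : ∀ n : ℕ, 0 < n → q ^ n ≠ 1) :
    w q 3 * w q 0 = ((q : ℂ)⁻¹ ^ 2) • (w q 0 * w q 3) + (1 - (q : ℂ)⁻¹ ^ 2) • qDet q := by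
  have h0 := q_ne_zero (q := q)
  rw [w_three_mul_w_zero hq, qDet]
  match_scalars <;> field_simp
  ring

/-- The correction term in w_4 w_1 exactly compensates the factor q⁻² with which w_4 passes w_2 w_3.
-/
theorem w_three_mul_qDet (hq : ∀ n : ℕ, 0 < n → q ^ n ≠ 1) :
    w q 3 * qDet q = qDet q * w q 3 := by
  have h0 := q_ne_zero (q := q)
  rw [qDet, mul_sub, mul_smul_comm, ← mul_assoc, ← mul_assoc, w_three_mul_w_zero hq,
    w_three_mul_w_one hq]
  simp only [sub_mul, smul_mul_assoc, mul_assoc, w_three_mul_w_two hq, mul_smul_comm]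
  match_scalars <;> field_simp
  ring

/-- Each passage of w_4 over w_1 leaves a multiple of `qDet q`. As this commutes with w_4, the
remainders collect into one term with a geometric sum as coefficient. -/
theorem w_three_pow_mul_w_zero (hq : ∀ n : ℕ, 0 < n → q ^ n ≠ 1) (n : ℕ) :
    w q 3 ^ (n + 1) * w q 0 = ((q : ℂ)⁻¹ ^ (2 * (n + 1))) • (w q 0 * w q 3 ^ (n + 1))
      + (1 - (q : ℂ)⁻¹ ^ (2 * (n + 1))) • (qDet q * w q 3 ^ n) := by
  induction n with
  | zero => simpa using w_three_mul_w_zero_eq hq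
  | succ n ih =>
    have h0 := q_ne_zero (q := q)
    rw [pow_succ', mul_assoc, ih, mul_add, mul_smul_comm, mul_smul_comm, ← mul_assoc,
      w_three_mul_w_zero_eq hq, ← mul_assoc, w_three_mul_qDet hq, mul_assoc (qDet q), ← pow_succ',
      add_mul, smul_mul_assoc, smul_mul_assoc, mul_assoc (w q 0), ← pow_succ']
    module

theorem w_three_pow_mul_qDet (hq : ∀ n : ℕ, 0 < n → q ^ n ≠ 1) (n : ℕ) :
    w q 3 ^ n * qDet q = qDet q * w q 3 ^ n := by
  simpa using pow_mul_of_q_comm (r := 1) ((w_three_mul_qDet hq).trans (one_smul ℂ _).symm) n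

/-! ### Coefficients of the `q`-difference operators -/

theorem coeff_dq (i : Fin 4) (p : Poly) (γ : Fin 4 →₀ ℕ) :
    MvPolynomial.coeff γ (dq q i p)
      = qInt q (γ i + 1) * MvPolynomial.coeff (γ + Finsupp.single i 1) p := by
  suffices h : MvPolynomial.lcoeff ℂ γ ∘ₗ dq q i
      = qInt q (γ i + 1) • MvPolynomial.lcoeff ℂ (γ + Finsupp.single i 1) from
    LinearMap.congr_fun h p
  refine (MvPolynomial.basisMonomials (Fin 4) ℂ).ext fun δ => ?_
  rw [LinearMap.comp_apply, dq, Module.Basis.constr_basis]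
  simp only [LinearMap.smul_apply,
    MvPolynomial.lcoeff_apply, MvPolynomial.coe_basisMonomials, MvPolynomial.coeff_monomial,
    smul_eq_mul]
  by_cases h : δ = γ + Finsupp.single i 1
  · subst h
    simp
  · rw [if_neg h, mul_zero]
    split_ifs with h'
    -- Only truncated subtraction can give δ - e_i = γ without δ = γ + e_i. Then δ i = 0, and the
    -- coefficient [0]_q vanishes.
    · have h0 : δ i = 0 := by
        by_contra h0
        apply h
        rw [← h', tsub_add_cancel_of_le]
        simpa [Nat.one_le_iff_ne_zero] using h0
      simp [h0, qInt]
    · rfl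

theorem coeff_scale (i : Fin 4) (p : Poly) (γ : Fin 4 →₀ ℕ) :
    MvPolynomial.coeff γ (scale q i p) = (q : ℂ)⁻¹ ^ γ i * MvPolynomial.coeff γ p := by
  suffices h : MvPolynomial.lcoeff ℂ γ ∘ₗ scale q i
      = (q : ℂ)⁻¹ ^ γ i • MvPolynomial.lcoeff ℂ γ from
    LinearMap.congr_fun h p
  refine (MvPolynomial.basisMonomials (Fin 4) ℂ).ext fun δ => ?_
  rw [LinearMap.comp_apply, scale, Module.Basis.constr_basis]
  simp only [LinearMap.smul_apply,
    MvPolynomial.lcoeff_apply, MvPolynomial.coe_basisMonomials, MvPolynomial.coeff_monomial,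
    smul_eq_mul]
  by_cases h : δ = γ
  · subst h; simp
  · simp [h]

theorem coeff_zmul (i : Fin 4) (p : Poly) (γ : Fin 4 →₀ ℕ) :
    MvPolynomial.coeff γ (zmul i p)
      = if γ i = 0 then 0 else MvPolynomial.coeff (γ - Finsupp.single i 1) p := by
  rw [zmul, LinearMap.mulLeft_apply, MvPolynomial.coeff_X_mul']
  by_cases h : γ i = 0 <;> simp [h]

/-! ### Right multiplication of ordered monomials -/

theorem wMon_mul_w_three (γ : Fin 4 →₀ ℕ) :
    wMon q γ * w q 3 = wMon q (γ + Finsupp.single 3 1) := by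
  simp [wMon, pow_succ, mul_assoc]

theorem wMon_mul_w_two (hq : ∀ n : ℕ, 0 < n → q ^ n ≠ 1) (γ : Fin 4 →₀ ℕ) :
    wMon q γ * w q 2 = (q : ℂ)⁻¹ ^ γ 3 • wMon q (γ + Finsupp.single 2 1) := by
  simp only [wMon, Finsupp.add_apply, Finsupp.single_apply]
  rw [mul_assoc, pow_mul_of_q_comm (w_three_mul_w_two hq)]
  simp [pow_succ, mul_assoc]

theorem wMon_mul_w_one (hq : ∀ n : ℕ, 0 < n → q ^ n ≠ 1) (γ : Fin 4 →₀ ℕ) :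
    wMon q γ * w q 1 = (q : ℂ)⁻¹ ^ γ 3 • wMon q (γ + Finsupp.single 1 1) := by
  simp only [wMon, Finsupp.add_apply, Finsupp.single_apply]
  rw [mul_assoc, pow_mul_of_q_comm (w_three_mul_w_one hq), mul_smul_comm, ← mul_assoc,
    mul_assoc _ (w q 2 ^ _) (w q 1),
    pow_mul_of_q_comm (r := 1) ((w_two_mul_w_one hq).trans (one_smul ℂ _).symm)]
  simp [pow_succ, mul_assoc]

theorem wMon_mid_mul_w_zero (a b c : ℕ) : w q 0 ^ a * w q 1 ^ b * w q 2 ^ c * w q 0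
    = (q : ℂ)⁻¹ ^ (b + c) • (w q 0 ^ (a + 1) * w q 1 ^ b * w q 2 ^ c) := by
  rw [mul_assoc, pow_mul_of_q_comm w_two_mul_w_zero, mul_smul_comm, ← mul_assoc,
    mul_assoc (w q 0 ^ a), pow_mul_of_q_comm w_one_mul_w_zero, mul_smul_comm, smul_mul_assoc,
    smul_smul]
  simp only [pow_succ, mul_assoc, pow_add]
  ring_nf

theorem wMon_mul_qDet (hq : ∀ n : ℕ, 0 < n → q ^ n ≠ 1) (γ : Fin 4 →₀ ℕ) :
    wMon q γ * qDet q
      = (q : ℂ)⁻¹ ^ (γ 1 + γ 2) • wMon q (γ + Finsupp.single 0 1 + Finsupp.single 3 1)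
        - (q : ℂ) • wMon q (γ + Finsupp.single 1 1 + Finsupp.single 2 1) := by
  have h21 := pow_mul_of_q_comm (r := 1) ((w_two_mul_w_one hq).trans (one_smul ℂ _).symm) (γ 2)
  rw [wMon, mul_assoc, w_three_pow_mul_qDet hq, ← mul_assoc, qDet, mul_sub, sub_mul, ← mul_assoc,
    wMon_mid_mul_w_zero, mul_smul_comm, ← mul_assoc, mul_assoc _ (w q 2 ^ _) (w q 1), h21]
  simp [wMon, pow_succ, mul_assoc]
  simp only [← mul_assoc, ← pow_succ, ← pow_succ']

/-- The truncated exponent `γ - Finsupp.single 3 1` is harmless: for γ 3 = 0 the factor in front of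
it is 0. -/
theorem wMon_mul_w_zero (hq : ∀ n : ℕ, 0 < n → q ^ n ≠ 1) (γ : Fin 4 →₀ ℕ) :
    wMon q γ * w q 0 = (q : ℂ)⁻¹ ^ (γ 1 + γ 2 + 2 * γ 3) • wMon q (γ + Finsupp.single 0 1)
      + (1 - (q : ℂ)⁻¹ ^ (2 * γ 3)) • (wMon q (γ - Finsupp.single 3 1) * qDet q) := by
  rcases h : γ 3 with _ | n
  · simp only [wMon, h, pow_zero, mul_one, Finsupp.add_apply, Finsupp.single_apply]
    rw [wMon_mid_mul_w_zero]
    simp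
  · simp only [wMon, h, Finsupp.add_apply, Finsupp.single_apply, Finsupp.tsub_apply]
    rw [mul_assoc, w_three_pow_mul_w_zero hq, mul_add, mul_smul_comm, mul_smul_comm, ← mul_assoc,
      wMon_mid_mul_w_zero, smul_mul_assoc, smul_smul]
    simp [mul_assoc, w_three_pow_mul_qDet hq, pow_add, mul_comm]

/-! ### The operators `(w_i^R)†` in coordinates -/

theorem qInt_ne_zero (hq : ∀ n : ℕ, 0 < n → q ^ n ≠ 1) {n : ℕ} (hn : 0 < n) : qInt q n ≠ 0 := by
  have h0 := q_ne_zero (q := q)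
  have h : ∀ n : ℕ, 0 < n → (q : ℂ) ^ n - (q : ℂ)⁻¹ ^ n ≠ 0 := by
    intro n hn h
    apply q_pow_ne_one hq (n := n + n) (by omega)
    rw [inv_pow] at h
    field_simp at h
    rw [pow_add]
    linear_combination h
  exact div_ne_zero (h n hn) (by simpa using h 1 one_pos)

theorem qFact_succ (n : ℕ) : qFact q (n + 1) = qFact q n * qInt q (n + 1) := by
  simp [qFact, Finset.prod_range_succ]

theorem qFact_ne_zero (hq : ∀ n : ℕ, 0 < n → q ^ n ≠ 1) (n : ℕ) : qFact q n ≠ 0 :=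
  Finset.prod_ne_zero_iff.2 fun _ _ => qInt_ne_zero hq (Nat.succ_pos _)

/-- Off the roots of unity the q-factorials are nonzero, so the denominators in `Psi` can be
cleared. All later comparisons of coefficients use this form. -/
theorem coe_eq_Psi_iff (hq : ∀ n : ℕ, 0 < n → q ^ n ≠ 1) {p : Poly} {f : Functional q} :
    (p : MvPowerSeries (Fin 4) ℂ) = Psi f ↔
      ∀ γ : Fin 4 →₀ ℕ, f (wMon q γ) = MvPolynomial.coeff γ p * ∏ i : Fin 4, qFact q (γ i) := by
  have key : ∀ γ : Fin 4 →₀ ℕ, ∏ i : Fin 4, qFact q (γ i) ≠ 0 := fun γ =>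
    Finset.prod_ne_zero_iff.2 fun _ _ => qFact_ne_zero hq _
  constructor
  · intro h γ
    have h1 := congrArg (MvPowerSeries.coeff γ) h
    rw [MvPolynomial.coeff_coe] at h1
    rw [h1]
    exact (div_mul_cancel₀ _ (key γ)).symm
  · intro h
    ext γ
    rw [MvPolynomial.coeff_coe]
    exact ((div_eq_iff (key γ)).2 (h γ)).symm

theorem prod_qFact_add_single (γ : Fin 4 →₀ ℕ) (i : Fin 4) :
    ∏ j : Fin 4, qFact q ((γ + Finsupp.single i 1 : Fin 4 →₀ ℕ) j)
      = (∏ j : Fin 4, qFact q (γ j)) * qInt q (γ i + 1) := by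
  rw [← Finset.mul_prod_erase _ _ (Finset.mem_univ i),
    ← Finset.mul_prod_erase _ (fun j => qFact q (γ j)) (Finset.mem_univ i)]
  have : ∀ j ∈ Finset.univ.erase i,
      qFact q ((γ + Finsupp.single i 1 : Fin 4 →₀ ℕ) j) = qFact q (γ j) := by
    intro j hj
    rw [Finsupp.add_apply, Finsupp.single_eq_of_ne (Finset.ne_of_mem_erase hj), add_zero]
  rw [Finset.prod_congr rfl this]
  simp only [Finsupp.add_apply, Finsupp.single_eq_same, qFact_succ]
  ring

theorem isTransform_box (hq : ∀ n : ℕ, 0 < n → q ^ n ≠ 1) : IsTransform (qDet q) (box q) := by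
  intro f p hp
  rw [coe_eq_Psi_iff hq] at hp ⊢
  intro γ
  change f (wMon q γ * qDet q) = _
  rw [wMon_mul_qDet hq, map_sub, map_smul, map_smul, hp, hp]
  simp only [box, LinearMap.sub_apply, Module.End.mul_apply, LinearMap.smul_apply,
    MvPolynomial.coeff_sub, MvPolynomial.coeff_smul, coeff_scale, coeff_dq, prod_qFact_add_single,
    smul_eq_mul]
  simp [pow_add]
  ring

theorem isTransform_w (hq : ∀ n : ℕ, 0 < n → q ^ n ≠ 1) (i : Fin 4) :
    IsTransform (w q i) (wDag q i) := by
  intro f p hp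
  have hb := (coe_eq_Psi_iff hq).1 (isTransform_box hq f p hp)
  rw [coe_eq_Psi_iff hq] at hp ⊢
  intro γ
  change f (wMon q γ * w q i) = _
  fin_cases i
  · change f (wMon q γ * w q 0) = MvPolynomial.coeff γ (wDag q 0 p) * _
    have hb' : ∀ γ, f (wMon q γ * qDet q) = _ := hb
    rw [wMon_mul_w_zero hq, map_add, map_smul, map_smul, hp, hb']
    simp only [wDag, Matrix.cons_val_zero, LinearMap.add_apply, LinearMap.smul_apply, pow_two,
      Module.End.mul_apply, MvPolynomial.coeff_add, MvPolynomial.coeff_smul, coeff_scale, coeff_dq,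
      coeff_zmul, smul_eq_mul, prod_qFact_add_single]
    by_cases h : γ 3 = 0
    · simp [h, pow_add]
      ring
    · have e : γ = (γ - Finsupp.single 3 1) + Finsupp.single 3 1 := by
        rw [tsub_add_cancel_of_le]
        simpa [Nat.one_le_iff_ne_zero] using h
      obtain ⟨δ, rfl⟩ : ∃ δ : Fin 4 →₀ ℕ, γ = δ + Finsupp.single 3 1 := ⟨_, e⟩
      have h1 : (q : ℂ) - (q : ℂ)⁻¹ ≠ 0 := by
        have := qInt_ne_zero hq one_pos
        intro h
        simp [qInt, h] at this
      -- The coefficient from straightening splits into the factor 1 - q⁻² of the operator, the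
      -- eigenvalue of K_4 on z^δ, and [δ 3 + 1]_q, which turns the q-factorial at δ into the one at
      -- γ = δ + e_4.
      have h2 : (1 - (q : ℂ)⁻¹ ^ (2 * (δ 3 + 1)))
          = (1 - (q : ℂ)⁻¹ * (q : ℂ)⁻¹) * (q : ℂ)⁻¹ ^ δ 3 * qInt q (δ 3 + 1) := by
        have h0 := q_ne_zero (q := q)
        rw [qInt, mul_div_assoc', eq_div_iff h1]
        simp only [inv_pow]
        field_simp
        ring
      rw [add_tsub_cancel_right, if_neg h]
      simp only [prod_qFact_add_single]
      simp only [Finsupp.add_apply, Finsupp.single_eq_same, h2]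
      simp [pow_add, pow_mul, pow_two]
      ring
  · change f (wMon q γ * w q 1) = MvPolynomial.coeff γ (wDag q 1 p) * _
    rw [wMon_mul_w_one hq, map_smul, hp, prod_qFact_add_single]
    simp [wDag, coeff_scale, coeff_dq]
    ring
  · change f (wMon q γ * w q 2) = MvPolynomial.coeff γ (wDag q 2 p) * _
    rw [wMon_mul_w_two hq, map_smul, hp, prod_qFact_add_single]
    simp [wDag, coeff_scale, coeff_dq]
    ring
  · change f (wMon q γ * w q 3) = MvPolynomial.coeff γ (wDag q 3 p) * _
    rw [wMon_mul_w_three, hp, prod_qFact_add_single]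
    simp [wDag, coeff_dq]
    ring

/-! ### The intertwining maps -/

theorem rightTranslate_apply (a : Uq q) (f : Functional q) (u : Uq q) :
    rightTranslate a f u = f (u * a) := rfl

theorem rightTranslate_action (a x : Uq q) (f : Functional q) :
    rightTranslate a (action q x f) = action q x (rightTranslate a f) := by
  ext u
  simp [rightTranslate_apply, action_apply, mul_assoc]

/-- Right translation as a linear map. -/
noncomputable def rightTranslateₗ (a : Uq q) : Functional q →ₗ[ℂ] Functional q where
  toFun := rightTranslate a
  map_add' _ _ := rfl
  map_smul' _ _ := rfl

/-- Right translation commutes with the left action, so the orbit of the translate is a linear image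
of the orbit of f. -/
theorem FIN_rightTranslate (a : Uq q) {f : Functional q} (hf : FIN f) :
    FIN (rightTranslate a f) := by
  unfold FIN at *
  refine Submodule.finiteDimensional_of_le (S₂ := (compactOrbit f).map (rightTranslateₗ a)) ?_
  intro g hg
  obtain ⟨k, hk, rfl⟩ := mem_compactOrbit.1 hg
  exact ⟨action q k f, mem_compactOrbit.2 ⟨k, hk, rfl⟩, rightTranslate_action a k f⟩

/-- The condition `f(u b) = χ⁻¹(b) f(u)` for `b ∈ B⁺`. -/
structure IsEquivariant (χ : Node → ℂˣ) (f : Functional q) : Prop where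
  mul_K : ∀ u i, f (u * K q i) = (χ i : ℂ)⁻¹ * f u
  mul_E : ∀ u i, f (u * E q i) = 0

theorem IsEquivariant.mul_Kinv {χ : Node → ℂˣ} {f : Functional q} (hf : IsEquivariant χ f)
    (u : Uq q) (i : Node) : f (u * Kinv q i) = (χ i : ℂ) * f u := by
  have h := hf.mul_K (u * Kinv q i) i
  rw [mul_assoc, Kinv_mul_K, mul_one] at h
  rw [h, mul_inv_cancel_left₀ (χ i).ne_zero]

theorem mem_H0_iff {χ : Node → ℂˣ} {f : Functional q} :
    f ∈ H0 q χ ↔ IsEquivariant χ f ∧ FIN f := by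
  constructor
  · intro h
    exact ⟨⟨fun u i => by rw [h.1 u i, Units.val_inv_eq_inv_val], h.2.1⟩, h.2.2⟩
  · rintro ⟨h, h'⟩
    exact ⟨fun u i => by rw [h.mul_K u i, Units.val_inv_eq_inv_val], h.mul_E, h'⟩

theorem H0_mul_K {χ : Node → ℂˣ} {f : Functional q} (hf : f ∈ H0 q χ) (u : Uq q) (i : Node) :
    f (u * K q i) = (χ i : ℂ)⁻¹ * f u := (mem_H0_iff.1 hf).1.mul_K u i

theorem H0_mul_E {χ : Node → ℂˣ} {f : Functional q} (hf : f ∈ H0 q χ) (u : Uq q) (i : Node) :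
    f (u * E q i) = 0 := (mem_H0_iff.1 hf).1.mul_E u i

theorem H0_mul_Kinv {χ : Node → ℂˣ} {f : Functional q} (hf : f ∈ H0 q χ) (u : Uq q) (i : Node) :
    f (u * Kinv q i) = (χ i : ℂ) * f u := (mem_H0_iff.1 hf).1.mul_Kinv u i

theorem H0_mul_K_mul_F {χ : Node → ℂˣ} {f : Functional q} (hf : f ∈ H0 q χ) (u : Uq q)
    (i j : Node) :
    f (u * K q i * F q j) = (q : ℂ) ^ (-cartan i j) * (χ i : ℂ)⁻¹ * f (u * F q j) := by
  rw [mul_assoc, K_mul_F, mul_smul_comm, map_smul, ← mul_assoc, H0_mul_K hf]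
  simp [mul_assoc]

theorem H0_mul_Kinv_mul_F {χ : Node → ℂˣ} {f : Functional q} (hf : f ∈ H0 q χ) (u : Uq q)
    (i j : Node) :
    f (u * Kinv q i * F q j) = (q : ℂ) ^ cartan i j * (χ i : ℂ) * f (u * F q j) := by
  rw [mul_assoc, Kinv_mul_F, mul_smul_comm, map_smul, ← mul_assoc, H0_mul_Kinv hf]
  simp [mul_assoc]

theorem H0_mul_K_mul_F_mul_F {χ : Node → ℂˣ} {f : Functional q} (hf : f ∈ H0 q χ) (u : Uq q)
    (i j k : Node) : f (u * K q i * (F q j * F q k))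
      = (q : ℂ) ^ (-cartan i j) * (q : ℂ) ^ (-cartan i k) * (χ i : ℂ)⁻¹
        * f (u * (F q j * F q k)) := by
  rw [mul_assoc, ← mul_assoc (K q i), K_mul_F, smul_mul_assoc, mul_smul_comm, map_smul, mul_assoc,
    K_mul_F, mul_smul_comm, mul_smul_comm, map_smul, ← mul_assoc, ← mul_assoc, H0_mul_K hf]
  simp [mul_assoc]

theorem H0_mul_E_mul_F {χ : Node → ℂˣ} {f : Functional q} (hf : f ∈ H0 q χ) (u : Uq q)
    (i k : Node) : f (u * E q i * F q k)
      = if i = k then ((q : ℂ) - (q : ℂ)⁻¹)⁻¹ * ((χ i : ℂ)⁻¹ - χ i) * f u else 0 := by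
  split_ifs with h
  · subst h
    rw [mul_assoc, E_mul_F_same, mul_add, map_add, ← mul_assoc, H0_mul_E hf, mul_smul_comm,
      map_smul, mul_sub, map_sub, H0_mul_K hf, H0_mul_Kinv hf, smul_eq_mul]
    ring
  · rw [mul_assoc, E_mul_F_ne h, ← mul_assoc, H0_mul_E hf]

/-- E_i is moved to the right, where f kills it. Each lowering operator of index i leaves a
commutator; the one from F_j still has to pass F_k, whence the powers of q in the second term. -/
theorem H0_mul_E_mul_F_mul_F {χ : Node → ℂˣ} {f : Functional q} (hf : f ∈ H0 q χ) (u : Uq q)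
    (i j k : Node) : f (u * E q i * (F q j * F q k))
      = (if i = k then ((q : ℂ) - (q : ℂ)⁻¹)⁻¹ * ((χ i : ℂ)⁻¹ - χ i) * f (u * F q j) else 0)
        + if i = j then ((q : ℂ) - (q : ℂ)⁻¹)⁻¹ * ((q : ℂ) ^ (-cartan i k) * (χ i : ℂ)⁻¹
          - (q : ℂ) ^ cartan i k * χ i) * f (u * F q k) else 0 := by
  split_ifs with h1 h2 h2
  · subst h1 h2
    rw [mul_assoc, ← mul_assoc (E q i), E_mul_F_same, add_mul, mul_add, map_add, smul_mul_assoc,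
      mul_smul_comm, map_smul, sub_mul, mul_sub, map_sub, mul_assoc (F q i), ← mul_assoc u,
      ← mul_assoc, ← mul_assoc u, ← mul_assoc u, H0_mul_E_mul_F hf, H0_mul_K_mul_F hf,
      H0_mul_Kinv_mul_F hf, smul_eq_mul, if_pos rfl]
    ring
  · subst h1
    rw [← mul_assoc, mul_assoc u, E_mul_F_ne h2, ← mul_assoc, H0_mul_E_mul_F hf, if_pos rfl,
      add_zero]
  · subst h2
    rw [mul_assoc, ← mul_assoc (E q i), E_mul_F_same, add_mul, mul_add, map_add, smul_mul_assoc,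
      mul_smul_comm, map_smul, sub_mul, mul_sub, map_sub, mul_assoc (F q i), ← mul_assoc u,
      ← mul_assoc, ← mul_assoc u, ← mul_assoc u, H0_mul_E_mul_F hf, H0_mul_K_mul_F hf,
      H0_mul_Kinv_mul_F hf, smul_eq_mul, if_neg h1]
    ring
  · rw [← mul_assoc, mul_assoc u, E_mul_F_ne h2, ← mul_assoc, H0_mul_E_mul_F hf, if_neg h1,
      add_zero]

theorem uPlus_eq : uPlus q = F q .mu * F q .beta
    - ((q : ℂ) + (q : ℂ)⁻¹) • (F q .beta * F q .mu) := by
  rw [uPlus, w_one, w_zero]; module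

theorem uMinus_eq : uMinus q = F q .nu * F q .beta
    - ((q : ℂ) + (q : ℂ)⁻¹) • (F q .beta * F q .nu) := by
  rw [uMinus, w_two, w_zero]; module

theorem H0_mul_K_mul_intertwining {χ : Node → ℂˣ} {f : Functional q} (hf : f ∈ H0 q χ) (u : Uq q)
    (i j k : Node) (c : ℂ) : f (u * K q i * (F q j * F q k - c • (F q k * F q j)))
      = (q : ℂ) ^ (-cartan i j) * (q : ℂ) ^ (-cartan i k) * (χ i : ℂ)⁻¹
        * f (u * (F q j * F q k - c • (F q k * F q j))) := by
  simp only [mul_sub, mul_smul_comm, map_sub, map_smul, H0_mul_K_mul_F_mul_F hf, smul_eq_mul]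
  ring

/-- The condition for f_{u₀} is that f kills u E_i u₀. For E_mu the two terms of u₀ contribute [2]_q
and q + q⁻¹, which cancel. For E_nu both vanish. For E_beta the sum is proportional to q⁻² t - q²
t⁻¹, which is zero exactly because t² = q⁴. The new character records the weight shift by mu + beta.
-/
theorem rightTranslate_uPlus_mem {t t' : ℂˣ} (hq2 : (q : ℂ) ^ 2 ≠ 1)
    (ht : (t : ℂ) ^ 2 = (q : ℂ) ^ 4) (ht' : t' = t * q) {f : Functional q}
    (hf : f ∈ H0 q (char q⁻¹ t 1)) :
    rightTranslate (uPlus q) f ∈ H0 q (char 1 t' q⁻¹) := by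
  have h0 := q_ne_zero (q := q)
  have t0 := t.ne_zero
  have h1 : (q : ℂ) ^ 2 - 1 ≠ 0 := sub_ne_zero.2 hq2
  refine ⟨fun u i => ?_, fun u i => ?_, FIN_rightTranslate _ hf.2.2⟩
  · rw [rightTranslate_apply, rightTranslate_apply, uPlus_eq, H0_mul_K_mul_intertwining hf]
    congr 1
    cases i <;> simp [cartan, char, ht'] <;> field_simp
  · rw [rightTranslate_apply, uPlus_eq, mul_sub, mul_smul_comm, map_sub, map_smul,
      H0_mul_E_mul_F_mul_F hf, H0_mul_E_mul_F_mul_F hf]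
    cases i <;> simp [cartan, char]
    · field_simp
      ring
    · field_simp
      linear_combination (f (u * F q .mu)) * ht

theorem rightTranslate_uMinus_mem {t t' : ℂˣ} (hq2 : (q : ℂ) ^ 2 ≠ 1)
    (ht : (t : ℂ) ^ 2 = (q : ℂ) ^ 4) (ht' : t' = t * q) {f : Functional q}
    (hf : f ∈ H0 q (char 1 t q⁻¹)) :
    rightTranslate (uMinus q) f ∈ H0 q (char q⁻¹ t' 1) := by
  have h0 := q_ne_zero (q := q)
  have t0 := t.ne_zero
  have h1 : (q : ℂ) ^ 2 - 1 ≠ 0 := sub_ne_zero.2 hq2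
  refine ⟨fun u i => ?_, fun u i => ?_, FIN_rightTranslate _ hf.2.2⟩
  · rw [rightTranslate_apply, rightTranslate_apply, uMinus_eq, H0_mul_K_mul_intertwining hf]
    congr 1
    cases i <;> simp [cartan, char, ht'] <;> field_simp
  · rw [rightTranslate_apply, uMinus_eq, mul_sub, mul_smul_comm, map_sub, map_smul,
      H0_mul_E_mul_F_mul_F hf, H0_mul_E_mul_F_mul_F hf]
    cases i <;> simp [cartan, char]
    · field_simp
      linear_combination (f (u * F q .nu)) * ht
    · field_simp
      ring

theorem exists_isIntertwiner {u₀ : Uq q} {χ δ : Node → ℂˣ}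
    (h : ∀ f ∈ H0 q χ, rightTranslate u₀ f ∈ H0 q δ) : ∃ T, IsIntertwiner u₀ χ δ T :=
  ⟨(rightTranslateₗ u₀).restrict h, fun _ => rfl, fun y f => Subtype.ext
    (rightTranslate_action u₀ y f)⟩

/-! ### Consequences of the finiteness condition -/

/-- The space ℂ[X] is infinite-dimensional and p ↦ p(y)·f takes values in the finite-dimensional
orbit of f, so this map has a kernel. This is the only form in which finiteness is used against f.
-/
theorem exists_action_aeval_eq_zero {f : Functional q} (hf : FIN f) {y : Uq q} (hy : y ∈ Uk q) :
    ∃ p : Polynomial ℂ, p ≠ 0 ∧ action q (Polynomial.aeval y p) f = 0 := by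
  have : FiniteDimensional ℂ (compactOrbit f) := hf
  have hmem : ∀ p : Polynomial ℂ, Polynomial.aeval y p ∈ Uk q := fun p =>
    Algebra.adjoin_le (S := Uk q) (Set.singleton_subset_iff.2 hy)
      (Polynomial.aeval_mem_adjoin_singleton ℂ y)
  let L : Polynomial ℂ →ₗ[ℂ] compactOrbit f :=
    (((action q).toLinearMap.flip f) ∘ₗ (Polynomial.aeval y).toLinearMap).codRestrict _
      fun p => mem_compactOrbit.2 ⟨_, hmem p, rfl⟩
  by_contra! h
  have hL : Function.Injective L := by
    rw [← LinearMap.ker_eq_bot, LinearMap.ker_eq_bot']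
    intro p hp
    by_contra hp0
    exact h p hp0 (congrArg Subtype.val hp)
  have := FiniteDimensional.of_injective L hL
  exact Polynomial.not_finite (R := ℂ) this

/-! ### The antipode on polynomials in one element, and finiteness of the support -/

theorem S_one : S (1 : Uq q) = 1 := by simpa using S_algebraMap (q := q) 1

theorem S_Kinv (i : Node) : S (Kinv q i) = K q i := by
  have h : S (K q i * Kinv q i) = S (1 : Uq q) := by rw [K_mul_Kinv]
  rw [S_mul, S_K, S_one] at h
  calc S (Kinv q i) = S (Kinv q i) * (Kinv q i * K q i) := by rw [Kinv_mul_K, mul_one]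
    _ = K q i := by rw [← mul_assoc, h, one_mul]

/-- This reduces a vanishing statement about f(u a) for all u to f(a) alone: with u = S(x) one has
f(u a) = (x·f)(a), and x·f lies again in `H0`. -/
theorem S_surjective : Function.Surjective (S : Uq q → Uq q) := by
  intro u
  induction u using Uq_induction with
  | hE i =>
    refine ⟨(-1 : ℂ) • (E q i * Kinv q i), ?_⟩
    rw [S_smul, S_mul, S_E, S_Kinv, mul_neg, ← mul_assoc, K_mul_Kinv, one_mul]
    module
  | hF i =>
    refine ⟨(-1 : ℂ) • (K q i * F q i), ?_⟩
    rw [S_smul, S_mul, S_F, S_K, neg_mul, mul_assoc, K_mul_Kinv, mul_one]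
    module
  | hK i => exact ⟨Kinv q i, S_Kinv i⟩
  | hKinv i => exact ⟨K q i, S_K i⟩
  | hc c => exact ⟨_, S_algebraMap c⟩
  | hadd a b ha hb =>
    obtain ⟨x, rfl⟩ := ha
    obtain ⟨y, rfl⟩ := hb
    exact ⟨x + y, S_add x y⟩
  | hmul a b ha hb =>
    obtain ⟨x, rfl⟩ := ha
    obtain ⟨y, rfl⟩ := hb
    exact ⟨y * x, S_mul y x⟩

theorem action_mul_apply (x y : Uq q) (f : Functional q) :
    action q (x * y) f = action q x (action q y f) := by
  rw [map_mul, Module.End.mul_apply]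

theorem action_aeval_apply (y : Uq q) (p : Polynomial ℂ) (f : Functional q) (u : Uq q) :
    action q (Polynomial.aeval y p) f u
      = ∑ n ∈ Finset.range (p.natDegree + 1), p.coeff n * action q (y ^ n) f u := by
  rw [Polynomial.aeval_eq_sum_range, map_sum, LinearMap.sum_apply, LinearMap.sum_apply]
  simp [-map_pow]

/-- Moving S(y) past u costs r and absorbing it into g costs s, so y acts by r s on the value at u,
and a polynomial in y acts by its value there. -/
theorem action_aeval_apply_of_q_comm {y u : Uq q} {g : Functional q} {r s : ℂ}
    (hr : S y * u = r • (u * S y)) (hs : ∀ u, g (u * S y) = s * g u) (p : Polynomial ℂ) :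
    action q (Polynomial.aeval y p) g u = p.eval (r * s) * g u := by
  rw [action_aeval_apply, Polynomial.eval_eq_sum_range, Finset.sum_mul]
  have h1 : ∀ n, S (y ^ n) = S y ^ n := by
    intro n
    induction n with
    | zero => simp [S_one]
    | succ n ih => rw [pow_succ, S_mul, ih, pow_succ']
  have h2 : ∀ n t, g (t * S y ^ n) = s ^ n * g t := by
    intro n
    induction n with
    | zero => simp
    | succ n ih =>
      intro t
      rw [pow_succ, ← mul_assoc, hs, ih]
      ring
  refine Finset.sum_congr rfl fun n _ => ?_
  rw [mul_assoc]
  congr 1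
  rw [action_apply, h1, pow_mul_of_q_comm hr, map_smul, h2, smul_eq_mul, mul_pow]
  ring

theorem q_comm_mul {A : Type*} [Ring A] [Algebra ℂ A] {Z X Y : A} {r s : ℂ}
    (hX : Z * X = r • (X * Z)) (hY : Z * Y = s • (Y * Z)) :
    Z * (X * Y) = (r * s) • (X * Y * Z) := by
  rw [← mul_assoc, hX, smul_mul_assoc, mul_assoc, hY, mul_smul_comm, smul_smul, mul_assoc]

theorem q_comm_mul_left {A : Type*} [Ring A] [Algebra ℂ A] {Z Z' X : A} {r s : ℂ}
    (hZ : Z * X = r • (X * Z)) (hZ' : Z' * X = s • (X * Z')) :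
    Z * Z' * X = (r * s) • (X * (Z * Z')) := by
  rw [mul_assoc, hZ', mul_smul_comm, ← mul_assoc, hZ, smul_mul_assoc, smul_smul, mul_assoc,
    mul_comm r]

theorem q_comm_sub_smul {A : Type*} [Ring A] [Algebra ℂ A] {Z X Y : A} {r c : ℂ}
    (hX : Z * X = r • (X * Z)) (hY : Z * Y = r • (Y * Z)) :
    Z * (X - c • Y) = r • ((X - c • Y) * Z) := by
  rw [mul_sub, hX, mul_smul_comm, hY, sub_mul, smul_mul_assoc]
  module

theorem q_comm_pow {A : Type*} [Ring A] [Algebra ℂ A] {Z X : A} {r : ℂ}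
    (hX : Z * X = r • (X * Z)) (n : ℕ) : Z * X ^ n = r ^ n • (X ^ n * Z) := by
  induction n with
  | zero => simp
  | succ n ih => rw [pow_succ, q_comm_mul ih hX, pow_succ]

/-- The element `K_mu K_beta² K_nu`, which is central in `U_q(k)`. -/
noncomputable def centralK (q : ℂˣ) : Uq q := K q .mu * K q .beta * K q .beta * K q .nu

theorem S_centralK :
    S (centralK q) = Kinv q .nu * (Kinv q .beta * (Kinv q .beta * Kinv q .mu)) := by
  simp [centralK, S_K]

theorem S_centralK_mul_F (j : Node) : S (centralK q) * F q j
    = (q : ℂ) ^ (cartan .nu j + (cartan .beta j + (cartan .beta j + cartan .mu j)))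
      • (F q j * S (centralK q)) := by
  have h : ∀ i, Kinv q i * F q j = (q : ℂ) ^ cartan i j • (F q j * Kinv q i) := fun i => by
    rw [Kinv_mul_F, Units.val_zpow_eq_zpow_val]
  rw [S_centralK, q_comm_mul_left (h _) (q_comm_mul_left (h _) (q_comm_mul_left (h _) (h _)))]
  simp only [zpow_add₀ (q_ne_zero (q := q))]

/-- The weight mu + 2 beta + nu pairs to zero with mu and nu and to 2 with beta. As each w_i
contains F_beta once, conjugation by `centralK` counts the total degree in the w_i. -/
theorem S_centralK_mul_w (i : Fin 4) :
    S (centralK q) * w q i = (q : ℂ) ^ 2 • (w q i * S (centralK q)) := by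
  have hb : S (centralK q) * F q .beta = (q : ℂ) ^ 2 • (F q .beta * S (centralK q)) := by
    rw [S_centralK_mul_F]; norm_num [cartan]
  have hm : S (centralK q) * F q .mu = (1 : ℂ) • (F q .mu * S (centralK q)) := by
    rw [S_centralK_mul_F]; norm_num [cartan]
  have hn : S (centralK q) * F q .nu = (1 : ℂ) • (F q .nu * S (centralK q)) := by
    rw [S_centralK_mul_F]; norm_num [cartan]
  have key : ∀ {X Y : Uq q}, S (centralK q) * X = (1 : ℂ) • (X * S (centralK q)) →
      S (centralK q) * Y = (q : ℂ) ^ 2 • (Y * S (centralK q)) →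
      S (centralK q) * (X * Y - (q : ℂ) • (Y * X))
        = (q : ℂ) ^ 2 • ((X * Y - (q : ℂ) • (Y * X)) * S (centralK q)) := fun hX hY =>
    q_comm_sub_smul (by simpa using q_comm_mul hX hY) (by simpa using q_comm_mul hY hX)
  fin_cases i
  · exact hb
  · exact key hm hb
  · exact key hn hb
  · exact key hm (key hn hb)

theorem S_centralK_mul_wMon (γ : Fin 4 →₀ ℕ) : S (centralK q) * wMon q γ
    = ((q : ℂ) ^ 2) ^ (γ 0 + γ 1 + γ 2 + γ 3) • (wMon q γ * S (centralK q)) := by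
  have h := fun i => q_comm_pow (S_centralK_mul_w (q := q) i) (γ i)
  rw [wMon, q_comm_mul (q_comm_mul (q_comm_mul (h 0) (h 1)) (h 2)) (h 3)]
  simp only [pow_add]

/-- A `K`-finite weight functional is nonzero on finitely many ordered monomials. -/
theorem finite_support_of_FIN (hq : ∀ n : ℕ, 0 < n → q ^ n ≠ 1) {g : Functional q} (hg : FIN g)
    {c : ℂ} (hc : c ≠ 0) (hK : ∀ u, g (u * S (centralK q)) = c * g u) :
    {γ : Fin 4 →₀ ℕ | g (wMon q γ) ≠ 0}.Finite := by
  have hy : centralK q ∈ Uk q :=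
    mul_mem (mul_mem (mul_mem (K_mem_Uk _) (K_mem_Uk _)) (K_mem_Uk _)) (K_mem_Uk _)
  obtain ⟨p, hp, hpg⟩ := exists_action_aeval_eq_zero hg hy
  have hroot : ∀ γ, g (wMon q γ) ≠ 0 →
      p.IsRoot (((q : ℂ) ^ 2) ^ (γ 0 + γ 1 + γ 2 + γ 3) * c) := by
    intro γ hγ
    have h := action_aeval_apply_of_q_comm (S_centralK_mul_wMon γ) hK p
    rw [hpg, LinearMap.zero_apply] at h
    exact (mul_eq_zero.1 h.symm).resolve_right hγ
  -- Different degrees give different candidates for roots of p since q² has infinite order. As p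
  -- has finitely many roots, the degree is bounded.
  have hinj : Function.Injective fun n : ℕ => ((q : ℂ) ^ 2) ^ n * c := by
    intro m n hmn
    have h1 : (q ^ 2) ^ m = (q ^ 2) ^ n := Units.ext (by simpa using mul_right_cancel₀ hc hmn)
    refine injective_pow_iff_not_isOfFinOrder.2 (fun h => ?_) h1
    obtain ⟨k, hk, h2⟩ := isOfFinOrder_iff_pow_eq_one.1 h
    exact hq (2 * k) (by omega) (by rw [pow_mul, h2])
  have hfin : {n : ℕ | p.IsRoot (((q : ℂ) ^ 2) ^ n * c)}.Finite :=
    (Polynomial.finite_setOfPred_isRoot hp).preimage hinj.injOn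
  obtain ⟨N, hN⟩ := hfin.bddAbove
  refine (Set.finite_Iic (Finsupp.equivFunOnFinite.symm fun _ => N)).subset fun γ hγ => ?_
  have h := hN (hroot γ hγ)
  intro i
  have : γ i ≤ γ 0 + γ 1 + γ 2 + γ 3 := by fin_cases i <;> simp <;> omega
  simpa using this.trans h

theorem H0_mul_S_centralK {χ : Node → ℂˣ} {f : Functional q} (hf : f ∈ H0 q χ) (u : Uq q) :
    f (u * S (centralK q)) = ((χ .mu * χ .beta * χ .beta * χ .nu : ℂˣ) : ℂ) * f u := by
  simp only [S_centralK, ← mul_assoc, H0_mul_Kinv hf, Units.val_mul]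

theorem finite_support_H0 (hq : ∀ n : ℕ, 0 < n → q ^ n ≠ 1) {χ : Node → ℂˣ} {f : Functional q}
    (hf : f ∈ H0 q χ) : {γ : Fin 4 →₀ ℕ | f (wMon q γ) ≠ 0}.Finite :=
  finite_support_of_FIN hq hf.2.2 (Units.ne_zero _) (H0_mul_S_centralK hf)

theorem finite_support_H0_mul_F (hq : ∀ n : ℕ, 0 < n → q ^ n ≠ 1) {χ : Node → ℂˣ}
    {f : Functional q} (hf : f ∈ H0 q χ) (i : Node) :
    {γ : Fin 4 →₀ ℕ | f (wMon q γ * F q i) ≠ 0}.Finite := by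
  have hc := mul_ne_zero (zpow_ne_zero
      (cartan .nu i + (cartan .beta i + (cartan .beta i + cartan .mu i))) (q_ne_zero (q := q)))
    (Units.ne_zero (χ .mu * χ .beta * χ .beta * χ .nu))
  refine finite_support_of_FIN (g := rightTranslate (F q i) f) hq
    (FIN_rightTranslate (F q i) hf.2.2) hc fun u => ?_
  rw [rightTranslate_apply, mul_assoc, S_centralK_mul_F, mul_smul_comm, map_smul, ← mul_assoc,
    H0_mul_S_centralK hf, smul_eq_mul, ← mul_assoc]
  rfl

/-! ### Vanishing on powers of the compact lowering operators -/

theorem H0_mul_K_mul_F_pow {χ : Node → ℂˣ} {f : Functional q} (hf : f ∈ H0 q χ) (u : Uq q)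
    (i : Node) (n : ℕ) :
    f (u * K q i * F q i ^ n) = ((q : ℂ)⁻¹ ^ 2) ^ n * (χ i : ℂ)⁻¹ * f (u * F q i ^ n) := by
  have h : K q i * F q i = (q : ℂ)⁻¹ ^ 2 • (F q i * K q i) := by
    rw [K_mul_F, cartan_self]; norm_cast
  rw [mul_assoc, q_comm_pow h, mul_smul_comm, map_smul, ← mul_assoc, H0_mul_K hf, smul_eq_mul,
    mul_assoc]

theorem H0_mul_Kinv_mul_F_pow {χ : Node → ℂˣ} {f : Functional q} (hf : f ∈ H0 q χ) (u : Uq q)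
    (i : Node) (n : ℕ) :
    f (u * Kinv q i * F q i ^ n) = ((q : ℂ) ^ 2) ^ n * χ i * f (u * F q i ^ n) := by
  have h : Kinv q i * F q i = (q : ℂ) ^ 2 • (F q i * Kinv q i) := by
    rw [Kinv_mul_F, cartan_self]; norm_cast
  rw [mul_assoc, q_comm_pow h, mul_smul_comm, map_smul, ← mul_assoc, H0_mul_Kinv hf, smul_eq_mul,
    mul_assoc]

/-- This is the sl(2) formula E F^(n+1) v = [n+1]_q [N-n]_q F^n v for a highest weight vector of
weight q^N. -/
theorem H0_mul_E_mul_F_pow (hq2 : (q : ℂ) ^ 2 ≠ 1) {χ : Node → ℂˣ} {f : Functional q}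
    (hf : f ∈ H0 q χ) {i : Node} {N : ℕ} (hχ : (χ i)⁻¹ = q ^ N) (n : ℕ) (u : Uq q) :
    f (u * E q i * F q i ^ (n + 1))
      = ((q : ℂ) ^ (n + 1) - (q : ℂ)⁻¹ ^ (n + 1)) * ((q : ℂ) ^ N * (q : ℂ)⁻¹ ^ n
        - (q : ℂ) ^ n * (q : ℂ)⁻¹ ^ N) / ((q : ℂ) - (q : ℂ)⁻¹) ^ 2 * f (u * F q i ^ n) := by
  have h0 := q_ne_zero (q := q)
  have h1 : (q : ℂ) ^ 2 - 1 ≠ 0 := sub_ne_zero.2 hq2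
  have h2 : (q : ℂ) - (q : ℂ)⁻¹ ≠ 0 := by
    intro h
    apply h1
    field_simp at h
    linear_combination h
  have hc : (χ i : ℂ) = (q : ℂ)⁻¹ ^ N := by
    rw [inv_pow, ← Units.val_pow_eq_pow_val, ← hχ]; simp
  have hH : ∀ (n : ℕ) (u : Uq q), f (u * E q i * F q i ^ (n + 1))
      = f (u * F q i * E q i * F q i ^ n) + ((q : ℂ) - (q : ℂ)⁻¹)⁻¹
        * (((q : ℂ)⁻¹ ^ 2) ^ n * q ^ N - ((q : ℂ) ^ 2) ^ n * (q : ℂ)⁻¹ ^ N)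
        * f (u * F q i ^ n) := by
    intro n u
    have e : u * E q i * F q i ^ (n + 1) = u * F q i * E q i * F q i ^ n
        + ((q : ℂ) - (q : ℂ)⁻¹)⁻¹ • (u * K q i * F q i ^ n - u * Kinv q i * F q i ^ n) := by
      rw [pow_succ', mul_assoc, ← mul_assoc (E q i), E_mul_F_same]
      simp only [add_mul, mul_add, smul_mul_assoc, mul_smul_comm, sub_mul, mul_sub, mul_assoc]
    rw [e, map_add, map_smul, map_sub, H0_mul_K_mul_F_pow hf, H0_mul_Kinv_mul_F_pow hf, hc,
      smul_eq_mul]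
    simp only [inv_pow, inv_inv]
    ring
  induction n generalizing u with
  | zero =>
    rw [hH, pow_zero, mul_one, H0_mul_E hf]
    simp only [inv_pow]
    field_simp
    ring
  | succ n ih =>
    rw [hH, ih, mul_assoc u (F q i), ← pow_succ', ← add_mul]
    congr 1
    rw [eq_div_iff (pow_ne_zero 2 h2)]
    simp only [inv_pow]
    field_simp
    ring

theorem H0_action_E_apply (hq2 : (q : ℂ) ^ 2 ≠ 1) {χ : Node → ℂˣ} {f : Functional q}
    (hf : f ∈ H0 q χ) {i : Node} {N : ℕ} (hχ : (χ i)⁻¹ = q ^ N) (n : ℕ) :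
    action q (E q i) f (F q i ^ (n + 1))
      = -(((q : ℂ) ^ (n + 1) - (q : ℂ)⁻¹ ^ (n + 1)) * ((q : ℂ) ^ N * (q : ℂ)⁻¹ ^ n
        - (q : ℂ) ^ n * (q : ℂ)⁻¹ ^ N) / ((q : ℂ) - (q : ℂ)⁻¹) ^ 2 * (((q : ℂ) ^ 2) ^ n * χ i))
        * f (F q i ^ n) := by
  rw [action_apply, S_E, neg_mul, map_neg, H0_mul_E_mul_F_pow hq2 hf hχ, ← one_mul (Kinv q i),
    H0_mul_Kinv_mul_F_pow hf, one_mul]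
  ring

/-- The vector F_i^(N+1) v is singular. A nonzero value of f there would make the functionals
E_i^m·f linearly independent: E_i^m·f vanishes on F_i^(N+1+k) for k < m and is a nonzero multiple of
f(F_i^(N+1)) for k = m. This triangularity contradicts finiteness. -/
theorem H0_mul_F_pow_eq_zero (hq : ∀ n : ℕ, 0 < n → q ^ n ≠ 1) {χ : Node → ℂˣ} {f : Functional q}
    (hf : f ∈ H0 q χ) {i : Node} (hi : i ≠ .beta) {N : ℕ} (hχ : (χ i)⁻¹ = q ^ N) (u : Uq q) :
    f (u * F q i ^ (N + 1)) = 0 := by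
  have h0 := q_ne_zero (q := q)
  have hq2 := q_pow_ne_one hq two_pos
  suffices h : ∀ f ∈ H0 q χ, f (F q i ^ (N + 1)) = 0 by
    obtain ⟨x, rfl⟩ := S_surjective u
    exact h _ (action_mem_H0 x f hf)
  clear hf f u
  intro f hf
  -- Each E_i lowers the exponent by one, and the step from N + 1 to N carries the factor [N-N]_q =
  -- 0.
  have low : ∀ m k, k < m → action q (E q i ^ m) f (F q i ^ (N + 1 + k)) = 0 := by
    intro m
    induction m with
    | zero => intro k hk; omega
    | succ m ih =>
      intro k hk
      rw [pow_succ', action_mul_apply, add_right_comm N 1 k,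
        H0_action_E_apply hq2 (action_mem_H0 _ _ hf) hχ]
      rcases k with _ | k
      · simp [mul_comm]
      · rw [← add_assoc, add_right_comm N k 1, ih k (by omega), mul_zero]
  -- The descent stops at N + 1, so the factor [N-n]_q is met only for n > N, where it is nonzero.
  have diag : ∀ m, ∃ c : ℂ, c ≠ 0 ∧
      action q (E q i ^ m) f (F q i ^ (N + 1 + m)) = c * f (F q i ^ (N + 1)) := by
    intro m
    induction m with
    | zero => exact ⟨1, one_ne_zero, by simp⟩
    | succ m ih =>
      obtain ⟨c, hc, h⟩ := ih
      rw [pow_succ', action_mul_apply, ← add_assoc,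
        H0_action_E_apply hq2 (action_mem_H0 _ _ hf) hχ, h, ← mul_assoc]
      refine ⟨_, mul_ne_zero (neg_ne_zero.2 (mul_ne_zero (div_ne_zero (mul_ne_zero ?_ ?_) ?_) ?_))
        hc, rfl⟩
      · intro h
        apply q_pow_ne_one hq (n := 2 * (N + 1 + m + 1)) (by omega)
        simp only [inv_pow] at h
        field_simp at h
        rw [two_mul, pow_add]
        linear_combination h
      · intro h
        apply q_pow_ne_one hq (n := 2 * (1 + m)) (by omega)
        simp only [inv_pow, pow_add] at h
        field_simp at h
        rw [two_mul, pow_add, pow_add]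
        linear_combination -h
      · refine pow_ne_zero 2 fun h => hq2 ?_
        field_simp at h
        linear_combination h
      · exact mul_ne_zero (pow_ne_zero _ (pow_ne_zero _ h0)) (Units.ne_zero _)
  obtain ⟨p, hp, hpf⟩ := exists_action_aeval_eq_zero hf.2.2 (E_mem_Uk hi)
  -- At the trailing degree of p only one term survives: lower coefficients of p are zero, and
  -- higher powers of E_i vanish by `low`.
  have h := congrArg (fun g : Functional q => g (F q i ^ (N + 1 + p.natTrailingDegree))) hpf
  simp only [action_aeval_apply, LinearMap.zero_apply] at h
  rw [Finset.sum_eq_single p.natTrailingDegree] at h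
  · obtain ⟨c, hc, h'⟩ := diag p.natTrailingDegree
    rw [h'] at h
    have := Polynomial.trailingCoeff_nonzero_iff_nonzero.2 hp
    exact (mul_eq_zero.1 ((mul_eq_zero.1 h).resolve_left this)).resolve_left hc
  · intro m _ hm
    rcases lt_or_gt_of_ne hm with h1 | h1
    · rw [Polynomial.coeff_eq_zero_of_lt_natTrailingDegree h1, zero_mul]
    · rw [low _ _ h1, mul_zero]
  · intro h1
    exact absurd (Finset.mem_range.2 (Nat.lt_succ_of_le p.natTrailingDegree_le_natDegree)) h1

/-! ### Equivariant functionals are determined by their coordinates -/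

/-- The largest left ideal on which `f` vanishes. -/
def leftKer (f : Functional q) : Submodule ℂ (Uq q) where
  carrier := {u | ∀ t, f (t * u) = 0}
  add_mem' := fun ha hb t => by rw [mul_add, map_add, ha, hb, add_zero]
  zero_mem' := fun t => by rw [mul_zero, map_zero]
  smul_mem' := fun c u hu t => by rw [mul_smul_comm, map_smul, hu, smul_zero]

theorem mul_mem_leftKer {f : Functional q} (t : Uq q) {u : Uq q} (hu : u ∈ leftKer f) :
    t * u ∈ leftKer f := fun s => by rw [← mul_assoc]; exact hu _

/-- A subspace that contains `1` and the left kernel of an equivariant functional and is stable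
under left multiplication by the `F_i` is everything. -/
theorem mem_of_F_stable {χ : Node → ℂˣ} {f : Functional q} (hf : IsEquivariant χ f)
    {N : Submodule ℂ (Uq q)} (h1 : 1 ∈ N) (hL : leftKer f ≤ N)
    (hF : ∀ i, ∀ n ∈ N, F q i * n ∈ N) (u : Uq q) : u ∈ N := by
  let U := Submonoid.closure (Set.range (F q))
  -- Words in the F_i together with the left kernel form a left ideal: modulo the left kernel K_i is
  -- a scalar and E_i is zero once they have been moved to the right end. This replaces the
  -- triangular decomposition of U_q.
  let M : Submodule ℂ (Uq q) := Submodule.span ℂ (U : Set (Uq q)) ⊔ leftKer f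
  have hUN : ∀ m ∈ U, m ∈ N := by
    intro m hm
    induction hm using Submonoid.closure_induction_left with
    | one => exact h1
    | mul_left x hx y hy ih =>
      obtain ⟨i, rfl⟩ := hx
      exact hF i _ ih
  have hUM : ∀ m ∈ U, m ∈ M := fun m hm => Submodule.mem_sup_left (Submodule.subset_span hm)
  have hLM : ∀ m ∈ leftKer f, m ∈ M := fun m hm => Submodule.mem_sup_right hm
  have ext : ∀ x : Uq q, (∀ m ∈ U, x * m ∈ M) → ∀ m ∈ M, x * m ∈ M := by
    intro x hx m hm
    obtain ⟨a, ha, b, hb, rfl⟩ := Submodule.mem_sup.1 hm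
    rw [mul_add]
    refine add_mem ?_ (hLM _ (mul_mem_leftKer x hb))
    clear hm
    induction ha using Submodule.span_induction with
    | mem m hm => exact hx m hm
    | zero => simp
    | add a b _ _ ha hb => rw [mul_add]; exact add_mem ha hb
    | smul c a _ ha => rw [mul_smul_comm]; exact Submodule.smul_mem _ c ha
  have hFM : ∀ i, ∀ m ∈ M, F q i * m ∈ M := fun i => ext _ fun m hm =>
    hUM _ (mul_mem (Submonoid.subset_closure ⟨i, rfl⟩) hm)
  have hKM : ∀ i, ∀ m ∈ M, K q i * m ∈ M := by
    refine fun i => ext _ fun m hm => ?_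
    induction hm using Submonoid.closure_induction_left with
    | one =>
      have h : K q i - (χ i : ℂ)⁻¹ • (1 : Uq q) ∈ leftKer f := fun t => by
        rw [mul_sub, map_sub, hf.mul_K, mul_smul_comm, map_smul, mul_one, smul_eq_mul, sub_self]
      rw [mul_one, ← sub_add_cancel (K q i) ((χ i : ℂ)⁻¹ • (1 : Uq q))]
      exact add_mem (hLM _ h) (Submodule.smul_mem _ _ (hUM _ (one_mem _)))
    | mul_left x hx y hy ih =>
      obtain ⟨j, rfl⟩ := hx
      rw [← mul_assoc, K_mul_F, smul_mul_assoc, mul_assoc]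
      exact Submodule.smul_mem _ _ (hFM j _ ih)
  have hKiM : ∀ i, ∀ m ∈ M, Kinv q i * m ∈ M := by
    refine fun i => ext _ fun m hm => ?_
    induction hm using Submonoid.closure_induction_left with
    | one =>
      have h : Kinv q i - (χ i : ℂ) • (1 : Uq q) ∈ leftKer f := fun t => by
        rw [mul_sub, map_sub, hf.mul_Kinv, mul_smul_comm, map_smul, mul_one, smul_eq_mul,
          sub_self]
      rw [mul_one, ← sub_add_cancel (Kinv q i) ((χ i : ℂ) • (1 : Uq q))]
      exact add_mem (hLM _ h) (Submodule.smul_mem _ _ (hUM _ (one_mem _)))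
    | mul_left x hx y hy ih =>
      obtain ⟨j, rfl⟩ := hx
      rw [← mul_assoc, Kinv_mul_F, smul_mul_assoc, mul_assoc]
      exact Submodule.smul_mem _ _ (hFM j _ ih)
  have hEM : ∀ i, ∀ m ∈ M, E q i * m ∈ M := by
    refine fun i => ext _ fun m hm => ?_
    induction hm using Submonoid.closure_induction_left with
    | one => exact hLM _ fun t => by rw [mul_one, hf.mul_E]
    | mul_left x hx y hy ih =>
      obtain ⟨j, rfl⟩ := hx
      by_cases hij : i = j
      · subst hij
        rw [← mul_assoc, E_mul_F_same, add_mul, smul_mul_assoc, sub_mul, mul_assoc]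
        exact add_mem (hFM i _ ih) (Submodule.smul_mem _ _
          (sub_mem (hKM i _ (hUM _ hy)) (hKiM i _ (hUM _ hy))))
      · rw [← mul_assoc, E_mul_F_ne hij, mul_assoc]
        exact hFM j _ ih
  have hM : ∀ x : Uq q, ∀ m ∈ M, x * m ∈ M := by
    intro x
    induction x using Uq_induction with
    | hE i => exact hEM i
    | hF i => exact hFM i
    | hK i => exact hKM i
    | hKinv i => exact hKiM i
    | hc c => exact fun m hm => by rw [← Algebra.smul_def]; exact Submodule.smul_mem _ _ hm
    | hadd a b ha hb => exact fun m hm => by rw [add_mul]; exact add_mem (ha m hm) (hb m hm)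
    | hmul a b ha hb => exact fun m hm => by rw [mul_assoc]; exact ha _ (hb m hm)
  have hMN : M ≤ N := sup_le (Submodule.span_le.2 hUN) hL
  simpa using hMN (hM u 1 (hUM _ (one_mem _)))

variable (q) in
/-- The quadratic algebra generated by the `w_i`. -/
def quadAlg : Subalgebra ℂ (Uq q) := Algebra.adjoin ℂ (Set.range (w q))

theorem w_mem_quadAlg (i : Fin 4) : w q i ∈ quadAlg q := Algebra.subset_adjoin ⟨i, rfl⟩

theorem F_mul_w {j : Node} (hj : j ≠ .beta) (i : Fin 4) :
    ∃ c : ℂ, ∃ b ∈ quadAlg q, F q j * w q i = c • (w q i * F q j) + b := by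
  cases j
  · fin_cases i
    · exact ⟨_, _, w_mem_quadAlg 1, F_mu_mul_w_zero⟩
    · exact ⟨_, 0, zero_mem _, F_mu_mul_w_one.trans (add_zero _).symm⟩
    · exact ⟨_, _, w_mem_quadAlg 3, F_mu_mul_w_two⟩
    · exact ⟨_, 0, zero_mem _, F_mu_mul_w_three.trans (add_zero _).symm⟩
  · exact absurd rfl hj
  · fin_cases i
    · exact ⟨_, _, w_mem_quadAlg 2, F_nu_mul_w_zero⟩
    · exact ⟨_, _, w_mem_quadAlg 3, F_nu_mul_w_one⟩
    · exact ⟨_, 0, zero_mem _, F_nu_mul_w_two.trans (add_zero _).symm⟩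
    · exact ⟨_, 0, zero_mem _, F_nu_mul_w_three.trans (add_zero _).symm⟩

/-- Compact lowering operators act on the quadratic algebra as skew derivations, so they can be
moved to the right of it. The product rule needs only the values on the w_i. -/
theorem F_mul_quadAlg {j : Node} (hj : j ≠ .beta) {x : Uq q} (hx : x ∈ quadAlg q) :
    ∃ a ∈ quadAlg q, ∃ b ∈ quadAlg q, F q j * x = a * F q j + b := by
  induction hx using Algebra.adjoin_induction with
  | mem x hx =>
    obtain ⟨i, rfl⟩ := hx
    obtain ⟨c, b, hb, h⟩ := F_mul_w hj i
    exact ⟨c • w q i, Subalgebra.smul_mem _ (w_mem_quadAlg i) c, b, hb, by rw [h, smul_mul_assoc]⟩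
  | algebraMap r =>
    exact ⟨_, algebraMap_mem _ r, 0, zero_mem _, by rw [add_zero, Algebra.commutes]⟩
  | add x y _ _ hx hy =>
    obtain ⟨a, ha, b, hb, h⟩ := hx
    obtain ⟨a', ha', b', hb', h'⟩ := hy
    exact ⟨a + a', add_mem ha ha', b + b', add_mem hb hb', by rw [mul_add, h, h', add_mul]; abel⟩
  | mul x y _ hy' hx hy =>
    obtain ⟨a, ha, b, hb, h⟩ := hx
    obtain ⟨a', ha', b', hb', h'⟩ := hy
    refine ⟨a * a', mul_mem ha ha', a * b' + b * y, add_mem (mul_mem ha hb') (mul_mem hb hy'), ?_⟩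
    rw [← mul_assoc, h, add_mul, mul_assoc, h', mul_add, mul_assoc, add_assoc]

/-- Ordered monomials are closed under right multiplication by each w_i. For w_1 the straightening
produces `qDet`, whose product with an ordered monomial is again a combination of two ordered
monomials. -/
theorem quadAlg_le_span (hq : ∀ n : ℕ, 0 < n → q ^ n ≠ 1) :
    Subalgebra.toSubmodule (quadAlg q) ≤ Submodule.span ℂ (Set.range (wMon q)) := by
  have hmem : ∀ γ, wMon q γ ∈ Submodule.span ℂ (Set.range (wMon q)) := fun γ =>
    Submodule.subset_span ⟨γ, rfl⟩
  have hdet : ∀ γ, wMon q γ * qDet q ∈ Submodule.span ℂ (Set.range (wMon q)) := fun γ => by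
    rw [wMon_mul_qDet hq]
    exact sub_mem (Submodule.smul_mem _ _ (hmem _)) (Submodule.smul_mem _ _ (hmem _))
  have hmon : ∀ (i : Fin 4) γ, wMon q γ * w q i ∈ Submodule.span ℂ (Set.range (wMon q)) := by
    intro i γ
    fin_cases i
    · exact (wMon_mul_w_zero hq γ) ▸ add_mem (Submodule.smul_mem _ _ (hmem _))
        (Submodule.smul_mem _ _ (hdet _))
    · exact (wMon_mul_w_one hq γ) ▸ Submodule.smul_mem _ _ (hmem _)
    · exact (wMon_mul_w_two hq γ) ▸ Submodule.smul_mem _ _ (hmem _)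
    · exact (wMon_mul_w_three (q := q) γ) ▸ hmem _
  have hw : ∀ (i : Fin 4), ∀ u ∈ Submodule.span ℂ (Set.range (wMon q)),
      u * w q i ∈ Submodule.span ℂ (Set.range (wMon q)) := by
    intro i u hu
    induction hu using Submodule.span_induction with
    | mem u hu => obtain ⟨γ, rfl⟩ := hu; exact hmon i γ
    | zero => simp
    | add a b _ _ ha hb => rw [add_mul]; exact add_mem ha hb
    | smul c a _ ha => rw [smul_mul_assoc]; exact Submodule.smul_mem _ _ ha
  rw [quadAlg, Algebra.adjoin_eq_span, Submodule.span_le]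
  intro u hu
  induction hu using Submonoid.closure_induction_right with
  | one => simpa [wMon] using hmem 0
  | mul_right x hx y hy ih =>
    obtain ⟨i, rfl⟩ := hy
    exact hw i _ ih

/-- Let W be the quadratic algebra. The space W + W F_m plus the left kernel of f is stable under
all F_i: F_beta is w_1, and a compact F_i moves through W and leaves at the right end either F_m or
one of F_m², F_n and F_m F_n, the last three of which lie in the left kernel. So it is all of U_q,
and f is determined by its values on W and W F_m. -/
theorem eq_zero_of_coordinates (hq : ∀ n : ℕ, 0 < n → q ^ n ≠ 1) {χ : Node → ℂˣ}
    {f : Functional q} (hf : IsEquivariant χ f) {m n : Node} (hm : m ≠ .beta) (hn : n ≠ .beta)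
    (hmn : ∀ i, i = .beta ∨ i = m ∨ i = n) (hc : F q n * F q m = F q m * F q n)
    (hfm : ∀ u, f (u * (F q m * F q m)) = 0) (hfn : ∀ u, f (u * F q n) = 0)
    (h0 : ∀ γ, f (wMon q γ) = 0) (h1 : ∀ γ, f (wMon q γ * F q m) = 0) : f = 0 := by
  let W := Subalgebra.toSubmodule (quadAlg q)
  let N : Submodule ℂ (Uq q) := W ⊔ W.map (LinearMap.mulRight ℂ (F q m)) ⊔ leftKer f
  have mem_N : ∀ {x y l : Uq q}, x ∈ quadAlg q → y ∈ quadAlg q → l ∈ leftKer f →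
      x + y * F q m + l ∈ N := fun hx hy hl =>
    Submodule.add_mem_sup (Submodule.add_mem_sup hx ⟨_, hy, rfl⟩) hl
  have of_mem_N : ∀ {u : Uq q}, u ∈ N → ∃ x ∈ quadAlg q, ∃ y ∈ quadAlg q, ∃ l ∈ leftKer f,
      u = x + y * F q m + l := by
    intro u hu
    obtain ⟨a, ha, l, hl, rfl⟩ := Submodule.mem_sup.1 hu
    obtain ⟨x, hx, b, ⟨y, hy, rfl⟩, rfl⟩ := Submodule.mem_sup.1 ha
    exact ⟨x, hx, y, hy, l, hl, rfl⟩
  have hN : ∀ u, u ∈ N := by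
    refine mem_of_F_stable hf ?_ le_sup_right fun i u hu => ?_
    · simpa using mem_N (one_mem _) (zero_mem _) (zero_mem _)
    · obtain ⟨x, hx, y, hy, l, hl, rfl⟩ := of_mem_N hu
      have hl' := mul_mem_leftKer (F q i) hl
      rcases hmn i with rfl | rfl | rfl
      · rw [mul_add, mul_add, ← mul_assoc]
        exact mem_N (mul_mem (w_mem_quadAlg 0) hx) (mul_mem (w_mem_quadAlg 0) hy) hl'
      · obtain ⟨a, ha, b, hb, h⟩ := F_mul_quadAlg hm hx
        obtain ⟨a', ha', b', hb', h'⟩ := F_mul_quadAlg hm hy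
        have e : F q i * (x + y * F q i + l)
            = b + (a + b') * F q i + (a' * (F q i * F q i) + F q i * l) := by
          rw [mul_add, mul_add, h, ← mul_assoc, h', add_mul, add_mul, mul_assoc]
          abel
        rw [e]
        exact mem_N hb (add_mem ha hb') (add_mem (mul_mem_leftKer _ hfm) hl')
      · obtain ⟨a, ha, b, hb, h⟩ := F_mul_quadAlg hn hx
        obtain ⟨a', ha', b', hb', h'⟩ := F_mul_quadAlg hn hy
        have e : F q i * (x + y * F q m + l)
            = b + b' * F q m + (a * F q i + a' * F q m * F q i + F q i * l) := by
          rw [mul_add, mul_add, h, ← mul_assoc, h', add_mul, mul_assoc a', hc, mul_assoc]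
          abel
        rw [e]
        exact mem_N hb hb' (add_mem (add_mem (mul_mem_leftKer _ hfn) (mul_mem_leftKer _ hfn)) hl')
  have hW : ∀ x ∈ quadAlg q, f x = 0 ∧ f (x * F q m) = 0 := by
    intro x hx
    have hx' : x ∈ Submodule.span ℂ (Set.range (wMon q)) := quadAlg_le_span hq hx
    clear hx
    induction hx' using Submodule.span_induction with
    | mem u hu => obtain ⟨γ, rfl⟩ := hu; exact ⟨h0 γ, h1 γ⟩
    | zero => simp
    | add a b _ _ ha hb => simp [add_mul, ha, hb]
    | smul c a _ ha => simp [ha]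
  ext u
  obtain ⟨x, hx, y, hy, l, hl, rfl⟩ := of_mem_N (hN u)
  have hl1 := hl 1
  rw [one_mul] at hl1
  rw [map_add, map_add, (hW x hx).1, (hW y hy).2, hl1]
  simp

/-! ### The dual of a Laurent version of the generalized Verma module -/

/-- Functions on the exponents of `w_1^a w_2^b w_3^c w_4^d F_mu^e`. -/
abbrev DualFn : Type := ℤ → ℤ → ℤ → ℤ → ℤ → ℂ

/-- The `q`-integer `[n]_q` for an integer `n`. -/
noncomputable def qIntZ (q : ℂˣ) (n : ℤ) : ℂ :=
  ((q : ℂ) ^ n - (q : ℂ) ^ (-n)) / ((q : ℂ) - (q : ℂ)⁻¹)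

/-- The transposes of the operators `E_i, F_i, K_i, K_i⁻¹` on the module with basis
`w_1^a w_2^b w_3^c w_4^d F_mu^e v`, where `v` is a highest weight vector on which
`K_mu, K_beta, K_nu` have the eigenvalues `q, t, 1` and which `F_nu` annihilates. -/
noncomputable def dualGen (q t : ℂˣ) : Gen → DualFn → DualFn
  | .F .mu => fun φ a b c d e => qIntZ q a * φ (a - 1) (b + 1) c d e
      + (q : ℂ) ^ (a - b) * qIntZ q c * φ a b (c - 1) (d + 1) e
      + (q : ℂ) ^ (a - b + c - d) * φ a b c d (e + 1)
  | .F .beta => fun φ a b c d e => φ (a + 1) b c d e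
  | .F .nu => fun φ a b c d e => qIntZ q a * φ (a - 1) b (c + 1) d e
      + (q : ℂ) ^ (a - c) * qIntZ q b * φ a (b - 1) c (d + 1) e
  | .E .mu => fun φ a b c d e =>
      (q : ℂ) ^ (-1 - c + d + 2 * e) * qIntZ q b * φ (a + 1) (b - 1) c d e
      + (q : ℂ) ^ (-1 + 2 * e) * qIntZ q d * φ a b (c + 1) (d - 1) e
      + qIntZ q e * qIntZ q (2 - e) * φ a b c d (e - 1)
  | .E .beta => fun φ a b c d e =>
      qIntZ q a * (((t : ℂ) * (q : ℂ) ^ (1 - a - b - c + e)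
        - (t : ℂ)⁻¹ * (q : ℂ) ^ (a + b + c - e - 1)) / ((q : ℂ) - (q : ℂ)⁻¹)) * φ (a - 1) b c d e
      - (t : ℂ) * (q : ℂ) ^ (2 - b - c + e) * qIntZ q b
        * (qIntZ q c * φ a (b - 1) (c - 1) (d + 1) e + (q : ℂ) ^ (c - d) * φ a (b - 1) c d (e + 1))
  | .E .nu => fun φ a b c d e =>
      (q : ℂ) ^ (d - b) * qIntZ q c * φ (a + 1) b (c - 1) d e
      + qIntZ q d * φ a (b + 1) c (d - 1) e
  | .K .mu => fun φ a b c d e => (q : ℂ) ^ (1 + a - b + c - d - 2 * e) * φ a b c d e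
  | .K .beta => fun φ a b c d e => (t : ℂ) * (q : ℂ) ^ (e - 2 * a - b - c) * φ a b c d e
  | .K .nu => fun φ a b c d e => (q : ℂ) ^ (a + b - c - d) * φ a b c d e
  | .Kinv .mu => fun φ a b c d e => (q : ℂ) ^ (-(1 + a - b + c - d - 2 * e)) * φ a b c d e
  | .Kinv .beta => fun φ a b c d e =>
      (t : ℂ)⁻¹ * (q : ℂ) ^ (-(e - 2 * a - b - c)) * φ a b c d e
  | .Kinv .nu => fun φ a b c d e => (q : ℂ) ^ (-(a + b - c - d)) * φ a b c d e

/-- `dualGen` as a linear map. -/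
noncomputable def dualGenₗ (q t : ℂˣ) (g : Gen) : Module.End ℂ DualFn where
  toFun := dualGen q t g
  map_add' φ ψ := by
    funext a b c d e
    rcases g with i | i | i | i <;> cases i <;>
      simp only [dualGen, Pi.add_apply] <;> ring
  map_smul' r φ := by
    funext a b c d e
    rcases g with i | i | i | i <;> cases i <;>
      simp only [dualGen, Pi.smul_apply, smul_eq_mul, RingHom.id_apply] <;> ring

/-- The values of the representation on the generators, in the opposite algebra because the
operators are transposes. -/
noncomputable def dualRepGen (q t : ℂˣ) (g : Gen) : (Module.End ℂ DualFn)ᵐᵒᵖ :=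
  MulOpposite.op (dualGenₗ q t g)

set_option linter.all false in
set_option maxHeartbeats 4000000 in
-- The Serre relation appears with its factors reversed because the operators are transposes.
theorem dualGen_serre_E {q : ℂˣ} (t : ℂˣ) (hq2 : (q : ℂ) ^ 2 ≠ 1) {i j : Node}
    (hij : cartan i j = -1) (φ : DualFn) (a b c d e : ℤ) :
    dualGen q t (.E j) (dualGen q t (.E i) (dualGen q t (.E i) φ)) a b c d e
      - ((q : ℂ) + (q : ℂ)⁻¹)
        * dualGen q t (.E i) (dualGen q t (.E j) (dualGen q t (.E i) φ)) a b c d e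
      + dualGen q t (.E i) (dualGen q t (.E i) (dualGen q t (.E j) φ)) a b c d e = 0 := by
  have h0 := q_ne_zero (q := q)
  have t0 := t.ne_zero
  have h1 : (q : ℂ) ^ 2 - 1 ≠ 0 := sub_ne_zero.2 hq2
  cases i <;> cases j <;> (try exact absurd hij (by decide)) <;>
    simp only [dualGen, qIntZ, add_sub_cancel_right, sub_add_cancel]
  all_goals
    simp only [zpow_add₀ h0, zpow_sub₀ h0, zpow_neg, zpow_one, two_mul, zpow_ofNat]
    have hA := zpow_ne_zero a h0
    have hB := zpow_ne_zero b h0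
    have hC := zpow_ne_zero c h0
    have hD := zpow_ne_zero d h0
    have hX := zpow_ne_zero e h0
    -- The exponents enter the coefficients only through these five nonzero numbers, so the claim
    -- becomes an identity of rational functions, linear in the shifted values of φ.
    generalize (q : ℂ) ^ a = A, (q : ℂ) ^ b = B, (q : ℂ) ^ c = C, (q : ℂ) ^ d = D,
      (q : ℂ) ^ e = X at hA hB hC hD hX ⊢
  · field_simp
    ring
  · field_simp
    ring
  · field_simp
    ring
  · field_simp
    ring

set_option linter.all false in
-- Integer exponents make every relation one identity, valid for all a, b, c, d, e without boundary
-- cases. Nothing is lost at the highest weight vector: there every coefficient of E_i contains a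
-- factor [0]_q.
theorem dualRep_rel {q : ℂˣ} (t : ℂˣ) (hq2 : (q : ℂ) ^ 2 ≠ 1) ⦃a b : FreeAlgebra ℂ Gen⦄
    (h : Rel q a b) :
    FreeAlgebra.lift ℂ (dualRepGen q t) a = FreeAlgebra.lift ℂ (dualRepGen q t) b := by
  have h0 := q_ne_zero (q := q)
  have t0 := t.ne_zero
  have h1 : (q : ℂ) ^ 2 - 1 ≠ 0 := sub_ne_zero.2 hq2
  cases h <;> apply MulOpposite.unop_injective <;>
    simp only [map_mul, map_sub, map_add, map_smul, map_one, map_zero, FreeAlgebra.lift_ι_apply,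
      dualRepGen, MulOpposite.unop_mul, MulOpposite.unop_op, MulOpposite.unop_sub,
      MulOpposite.unop_add, MulOpposite.unop_smul, MulOpposite.unop_one, MulOpposite.unop_zero] <;>
    refine LinearMap.ext fun φ => ?_ <;> funext a b c d e <;>
    simp only [Module.End.mul_apply, LinearMap.sub_apply, LinearMap.add_apply,
      LinearMap.smul_apply, Pi.add_apply, Pi.sub_apply, Pi.smul_apply, smul_eq_mul,
      dualGenₗ, LinearMap.coe_mk, AddHom.coe_mk, Module.End.one_apply, LinearMap.zero_apply,
      Pi.zero_apply]
  case K_Kinv i =>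
    cases i <;> simp only [dualGen, qIntZ, add_sub_cancel_right, sub_add_cancel]
    all_goals
      simp only [zpow_add₀ h0, zpow_sub₀ h0, zpow_neg, zpow_one, two_mul]
      field_simp
  case Kinv_K i =>
    cases i <;> simp only [dualGen, qIntZ, add_sub_cancel_right, sub_add_cancel]
    all_goals
      simp only [zpow_add₀ h0, zpow_sub₀ h0, zpow_neg, zpow_one, two_mul]
      field_simp
  case K_K i j => cases i <;> cases j <;> simp only [dualGen] <;> ring
  case K_E i j =>
    simp only [Units.val_zpow_eq_zpow_val]
    cases i <;> cases j <;>
      simp only [cartan, dualGen, qIntZ, add_sub_cancel_right, sub_add_cancel]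
    all_goals
      simp only [zpow_add₀ h0, zpow_sub₀ h0, zpow_neg, zpow_one, two_mul, zpow_ofNat, zpow_zero]
      field_simp
      try ring
  case K_F i j =>
    simp only [Units.val_zpow_eq_zpow_val]
    cases i <;> cases j <;>
      simp only [cartan, dualGen, qIntZ, add_sub_cancel_right, sub_add_cancel]
    all_goals
      simp only [zpow_add₀ h0, zpow_sub₀ h0, zpow_neg, zpow_one, two_mul, zpow_ofNat, zpow_zero]
      field_simp
      try ring
  case E_F_same i =>
    cases i <;> simp only [dualGen, qIntZ, add_sub_cancel_right, sub_add_cancel]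
    all_goals
      simp only [zpow_add₀ h0, zpow_sub₀ h0, zpow_neg, zpow_one, two_mul, zpow_ofNat]
      field_simp
      try ring
  case E_F_ne i j hij =>
    cases i <;> cases j <;> (try exact absurd rfl hij) <;>
      simp only [dualGen, qIntZ, add_sub_cancel_right, sub_add_cancel]
    all_goals
      simp only [zpow_add₀ h0, zpow_sub₀ h0, zpow_neg, zpow_one, two_mul, zpow_ofNat]
      field_simp
      try ring
  case E_E i j hij =>
    cases i <;> cases j <;> (try exact absurd hij (by decide)) <;>
      simp only [dualGen, qIntZ, add_sub_cancel_right, sub_add_cancel]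
    all_goals
      simp only [zpow_add₀ h0, zpow_sub₀ h0, zpow_neg, zpow_one, two_mul, zpow_ofNat]
      field_simp
      try ring
  case F_F i j hij =>
    cases i <;> cases j <;> (try exact absurd hij (by decide)) <;>
      simp only [dualGen, qIntZ, add_sub_cancel_right, sub_add_cancel]
    all_goals
      simp only [zpow_add₀ h0, zpow_sub₀ h0, zpow_neg, zpow_one, two_mul, zpow_ofNat]
      field_simp
      try ring
  case serre_E i j hij => exact dualGen_serre_E t hq2 hij φ a b c d e
  case serre_F i j hij =>
    cases i <;> cases j <;> (try exact absurd hij (by decide)) <;>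
      simp only [dualGen, qIntZ, add_sub_cancel_right, sub_add_cancel]
    all_goals
      simp only [zpow_add₀ h0, zpow_sub₀ h0, zpow_neg, zpow_one, two_mul, zpow_ofNat]
      field_simp
      try ring

/-! ### Matrix coefficients of the dual representation -/

/-- The (transposed) representation of `U_q` on `DualFn`. -/
noncomputable def dualRep (t : ℂˣ) (hq2 : (q : ℂ) ^ 2 ≠ 1) :
    Uq q →ₐ[ℂ] (Module.End ℂ DualFn)ᵐᵒᵖ :=
  RingQuot.liftAlgHom ℂ ⟨FreeAlgebra.lift ℂ (dualRepGen q t), dualRep_rel t hq2⟩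

/-- The right action of `U_q` on `DualFn`. -/
noncomputable def dualAct (t : ℂˣ) (hq2 : (q : ℂ) ^ 2 ≠ 1) (u : Uq q) : Module.End ℂ DualFn :=
  (dualRep t hq2 u).unop

section

variable (t : ℂˣ) (hq2 : (q : ℂ) ^ 2 ≠ 1)

theorem dualAct_mul (u v : Uq q) (φ : DualFn) :
    dualAct t hq2 (u * v) φ = dualAct t hq2 v (dualAct t hq2 u φ) := by
  simp [dualAct]

theorem dualAct_add (u v : Uq q) (φ : DualFn) :
    dualAct t hq2 (u + v) φ = dualAct t hq2 u φ + dualAct t hq2 v φ := by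
  simp [dualAct]

theorem dualAct_sub (u v : Uq q) (φ : DualFn) :
    dualAct t hq2 (u - v) φ = dualAct t hq2 u φ - dualAct t hq2 v φ := by
  simp [dualAct]

theorem dualAct_smul (r : ℂ) (u : Uq q) (φ : DualFn) :
    dualAct t hq2 (r • u) φ = r • dualAct t hq2 u φ := by
  simp [dualAct]

theorem dualAct_algebraMap (r : ℂ) (φ : DualFn) :
    dualAct t hq2 (algebraMap ℂ (Uq q) r) φ = r • φ := by
  simp [dualAct, MulOpposite.algebraMap_apply, Module.algebraMap_end_apply]

theorem dualAct_one (φ : DualFn) : dualAct t hq2 1 φ = φ := by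
  simp [dualAct]

theorem dualAct_toUq (g : Gen) (φ : DualFn) :
    dualAct t hq2 (toUq q (gen g)) φ = dualGen q t g φ := by
  have h : dualRep t hq2 (toUq q (gen g)) = dualRepGen q t g :=
    (RingQuot.liftAlgHom_mkAlgHom_apply ℂ _ _ _).trans (FreeAlgebra.lift_ι_apply _ _)
  rw [dualAct, h]
  rfl

theorem dualAct_E (i : Node) (φ : DualFn) : dualAct t hq2 (E q i) φ = dualGen q t (.E i) φ :=
  dualAct_toUq t hq2 _ φ

theorem dualAct_F (i : Node) (φ : DualFn) : dualAct t hq2 (F q i) φ = dualGen q t (.F i) φ :=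
  dualAct_toUq t hq2 _ φ

theorem dualAct_K (i : Node) (φ : DualFn) : dualAct t hq2 (K q i) φ = dualGen q t (.K i) φ :=
  dualAct_toUq t hq2 _ φ

theorem dualAct_Kinv (i : Node) (φ : DualFn) :
    dualAct t hq2 (Kinv q i) φ = dualGen q t (.Kinv i) φ :=
  dualAct_toUq t hq2 _ φ

@[simp] theorem qIntZ_zero : qIntZ q 0 = 0 := by simp [qIntZ]

/-- The functional `u ↦ φ(u v)`. -/
noncomputable def matCoef (φ : DualFn) : Functional q where
  toFun u := dualAct t hq2 u φ 0 0 0 0 0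
  map_add' u v := by rw [dualAct_add]; rfl
  map_smul' r u := by rw [dualAct_smul]; rfl

theorem matCoef_apply (φ : DualFn) (u : Uq q) :
    matCoef t hq2 φ u = dualAct t hq2 u φ 0 0 0 0 0 := rfl

theorem action_matCoef (x : Uq q) (φ : DualFn) :
    action q x (matCoef t hq2 φ) = matCoef t hq2 (dualAct t hq2 (S x) φ) := by
  ext u
  rw [action_apply, matCoef_apply, matCoef_apply, dualAct_mul]

theorem isEquivariant_matCoef (φ : DualFn) :
    IsEquivariant (char q⁻¹ t⁻¹ 1) (matCoef t hq2 φ) := by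
  constructor
  · intro u i
    rw [matCoef_apply, matCoef_apply, dualAct_mul, dualAct_K]
    cases i <;> simp [dualGen, char]
  · intro u i
    rw [matCoef_apply, dualAct_mul, dualAct_E]
    cases i <;> simp [dualGen]

/-- With no w_1 in front, multiplication by w_2 just raises its exponent. The case a = 0 is enough
to build ordered monomials from right to left. -/
theorem dualAct_w_one (φ : DualFn) (b c d e : ℤ) :
    dualAct t hq2 (w q 1) φ 0 b c d e = φ 0 (b + 1) c d e := by
  have h0 := q_ne_zero (q := q)
  have h1 : (q : ℂ) ^ 2 - 1 ≠ 0 := sub_ne_zero.2 hq2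
  rw [w_one, dualAct_sub, dualAct_smul, dualAct_mul, dualAct_mul]
  simp only [dualAct_F, dualGen, Pi.sub_apply, Pi.smul_apply, smul_eq_mul, zero_add,
    add_sub_cancel_right, sub_self, qIntZ, zpow_add₀ h0, zpow_sub₀ h0, zpow_neg, zpow_one,
    zpow_zero]
  field_simp
  ring

theorem dualAct_w_two (φ : DualFn) (a b c d e : ℤ) :
    dualAct t hq2 (w q 2) φ a b c d e = (q : ℂ) ^ (-a) * φ a b (c + 1) d e := by
  have h0 := q_ne_zero (q := q)
  have h1 : (q : ℂ) ^ 2 - 1 ≠ 0 := sub_ne_zero.2 hq2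
  rw [w_two, dualAct_sub, dualAct_smul, dualAct_mul, dualAct_mul]
  simp only [dualAct_F, dualGen, Pi.sub_apply, Pi.smul_apply, smul_eq_mul,
    add_sub_cancel_right, sub_add_cancel, qIntZ, zpow_add₀ h0, zpow_sub₀ h0, zpow_neg, zpow_one]
  field_simp
  ring

theorem dualAct_w_three (φ : DualFn) (d e : ℤ) :
    dualAct t hq2 (w q 3) φ 0 0 0 d e = φ 0 0 0 (d + 1) e := by
  have h0 := q_ne_zero (q := q)
  have h1 : (q : ℂ) ^ 2 - 1 ≠ 0 := sub_ne_zero.2 hq2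
  rw [w_three, dualAct_sub, dualAct_smul, dualAct_mul, dualAct_mul]
  simp only [dualAct_F, dualAct_w_two, dualGen, Pi.sub_apply, Pi.smul_apply, smul_eq_mul, zero_add,
    add_sub_cancel_right, sub_self, qIntZ, zpow_add₀ h0, zpow_sub₀ h0, zpow_neg, zpow_one,
    zpow_zero]
  field_simp
  ring

/-- This is the linear independence of the ordered monomials: φ is arbitrary, and evaluating it
along w^γ F_mu^e v returns its value at (γ, e). -/
theorem dualAct_wMon (φ : DualFn) (γ : Fin 4 →₀ ℕ) (e : ℤ) :
    dualAct t hq2 (wMon q γ) φ 0 0 0 0 e = φ (γ 0) (γ 1) (γ 2) (γ 3) e := by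
  have h0 : ∀ (n : ℕ) (φ : DualFn) (b c d : ℤ),
      dualAct t hq2 (w q 0 ^ n) φ 0 b c d e = φ n b c d e := by
    intro n
    induction n with
    | zero => intro φ b c d; rw [pow_zero, dualAct_one]; rfl
    | succ n ih =>
      intro φ b c d
      rw [pow_succ', dualAct_mul, ih, w_zero, dualAct_F]
      simp [dualGen]
  have h1 : ∀ (n : ℕ) (φ : DualFn) (c d : ℤ),
      dualAct t hq2 (w q 1 ^ n) φ 0 0 c d e = φ 0 n c d e := by
    intro n
    induction n with
    | zero => intro φ c d; rw [pow_zero, dualAct_one]; rfl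
    | succ n ih =>
      intro φ c d
      rw [pow_succ', dualAct_mul, ih, dualAct_w_one]
      simp
  have h2 : ∀ (n : ℕ) (φ : DualFn) (d : ℤ),
      dualAct t hq2 (w q 2 ^ n) φ 0 0 0 d e = φ 0 0 n d e := by
    intro n
    induction n with
    | zero => intro φ d; rw [pow_zero, dualAct_one]; rfl
    | succ n ih =>
      intro φ d
      rw [pow_succ', dualAct_mul, ih, dualAct_w_two]
      simp
  have h3 : ∀ (n : ℕ) (φ : DualFn),
      dualAct t hq2 (w q 3 ^ n) φ 0 0 0 0 e = φ 0 0 0 n e := by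
    intro n
    induction n with
    | zero => intro φ; rw [pow_zero, dualAct_one]; rfl
    | succ n ih =>
      intro φ
      rw [pow_succ', dualAct_mul, ih, dualAct_w_three]
      simp
  rw [wMon, dualAct_mul, h3, dualAct_mul, h2, dualAct_mul, h1, h0]

theorem matCoef_wMon (φ : DualFn) (γ : Fin 4 →₀ ℕ) :
    matCoef t hq2 φ (wMon q γ) = φ (γ 0) (γ 1) (γ 2) (γ 3) 0 := dualAct_wMon t hq2 φ γ 0

theorem matCoef_mul_F_mu (φ : DualFn) (u : Uq q) :
    matCoef t hq2 φ (u * F q .mu) = dualAct t hq2 u φ 0 0 0 0 1 := by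
  rw [matCoef_apply, dualAct_mul, dualAct_F]
  simp [dualGen]

theorem matCoef_wMon_mul_F_mu (φ : DualFn) (γ : Fin 4 →₀ ℕ) :
    matCoef t hq2 φ (wMon q γ * F q .mu) = φ (γ 0) (γ 1) (γ 2) (γ 3) 1 := by
  rw [matCoef_mul_F_mu, dualAct_wMon]

theorem matCoef_mul_F_nu (φ : DualFn) (u : Uq q) : matCoef t hq2 φ (u * F q .nu) = 0 := by
  rw [matCoef_apply, dualAct_mul, dualAct_F]
  simp [dualGen]

/-- The functions that vanish on `F_mu²`. -/
def vanishF : Submodule ℂ DualFn where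
  carrier := {φ | ∀ a b c d e, 2 ≤ e → φ a b c d e = 0}
  add_mem' hφ hψ a b c d e he := by simp [hφ a b c d e he, hψ a b c d e he]
  zero_mem' _ _ _ _ _ _ := rfl
  smul_mem' r φ hφ a b c d e he := by simp [hφ a b c d e he]

/-- The functions supported in degrees at most `N` of the `w_i`. -/
def degreeLE (N : ℕ) : Submodule ℂ DualFn where
  carrier := {φ | ∀ a b c d e : ℤ, (N : ℤ) < a + b + c + d → φ a b c d e = 0}
  add_mem' hφ hψ a b c d e he := by simp [hφ a b c d e he, hψ a b c d e he]
  zero_mem' _ _ _ _ _ _ := rfl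
  smul_mem' r φ hφ a b c d e he := by simp [hφ a b c d e he]

/-- Dually, the span of the basis vectors with e ≥ 2 is a submodule. Only E_mu lowers e, and its
coefficient contains [2-e]_q, which is zero at e = 2. -/
theorem dualGen_mem_vanishF (g : Gen) {φ : DualFn} (hφ : φ ∈ vanishF) :
    dualGen q t g φ ∈ vanishF := by
  intro a b c d e he
  have h : ∀ a b c d, φ a b c d e = 0 := fun a b c d => hφ a b c d e he
  have h' : ∀ a b c d, φ a b c d (e + 1) = 0 := fun a b c d => hφ a b c d _ (by omega)
  have h2 : qIntZ q (2 - e) * φ a b c d (e - 1) = 0 := by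
    rcases he.eq_or_lt with rfl | he'
    · simp
    · rw [hφ a b c d _ (by omega), mul_zero]
  rcases g with i | i | i | i <;> cases i <;> simp [dualGen, h, h', mul_assoc, h2]

theorem dualAct_mem_vanishF (u : Uq q) :
    ∀ {φ : DualFn}, φ ∈ vanishF → dualAct t hq2 u φ ∈ vanishF := by
  induction u using Uq_induction with
  | hE i => intro φ hφ; rw [dualAct_E]; exact dualGen_mem_vanishF t _ hφ
  | hF i => intro φ hφ; rw [dualAct_F]; exact dualGen_mem_vanishF t _ hφ
  | hK i => intro φ hφ; rw [dualAct_K]; exact dualGen_mem_vanishF t _ hφ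
  | hKinv i => intro φ hφ; rw [dualAct_Kinv]; exact dualGen_mem_vanishF t _ hφ
  | hc r => intro φ hφ; rw [dualAct_algebraMap]; exact Submodule.smul_mem _ _ hφ
  | hadd a b ha hb => intro φ hφ; rw [dualAct_add]; exact add_mem (ha hφ) (hb hφ)
  | hmul a b ha hb => intro φ hφ; rw [dualAct_mul]; exact hb (ha hφ)

/-- The compact generators exchange one w_i for another or change e, and all of this keeps a + b + c
+ d. -/
theorem dualAct_mem_degreeLE {N : ℕ} {u : Uq q} (hu : u ∈ Uk q) :
    ∀ {φ : DualFn}, φ ∈ degreeLE N → dualAct t hq2 u φ ∈ degreeLE N := by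
  induction hu using Algebra.adjoin_induction with
  | mem u hu =>
    intro φ hφ a b c d e h
    have h1 : φ (a - 1) (b + 1) c d e = 0 := hφ _ _ _ _ _ (by omega)
    have h2 : ∀ e, φ a b (c - 1) (d + 1) e = 0 := fun e => hφ _ _ _ _ _ (by omega)
    have h3 : ∀ e, φ a b c d e = 0 := fun e => hφ _ _ _ _ _ (by omega)
    have h4 : φ (a - 1) b (c + 1) d e = 0 := hφ _ _ _ _ _ (by omega)
    have h5 : φ a (b - 1) c (d + 1) e = 0 := hφ _ _ _ _ _ (by omega)
    have h6 : φ (a + 1) (b - 1) c d e = 0 := hφ _ _ _ _ _ (by omega)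
    have h7 : φ a b (c + 1) (d - 1) e = 0 := hφ _ _ _ _ _ (by omega)
    have h8 : φ (a + 1) b (c - 1) d e = 0 := hφ _ _ _ _ _ (by omega)
    have h9 : φ a (b + 1) c (d - 1) e = 0 := hφ _ _ _ _ _ (by omega)
    rcases hu with (hu | ⟨i, rfl⟩) | ⟨i, rfl⟩
    · rcases hu with rfl | rfl | rfl | rfl
      · rw [dualAct_E]; simp [dualGen, h6, h7, h3]
      · rw [dualAct_F]; simp [dualGen, h1, h2, h3]
      · rw [dualAct_E]; simp [dualGen, h8, h9]
      · rw [dualAct_F]; simp [dualGen, h4, h5]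
    · rw [dualAct_K]; cases i <;> simp [dualGen, h3]
    · rw [dualAct_Kinv]; cases i <;> simp [dualGen, h3]
  | algebraMap r => intro φ hφ; rw [dualAct_algebraMap]; exact Submodule.smul_mem _ _ hφ
  | add a b _ _ ha hb => intro φ hφ; rw [dualAct_add]; exact add_mem (ha hφ) (hb hφ)
  | mul a b _ _ ha hb => intro φ hφ; rw [dualAct_mul]; exact hb (ha hφ)

end

/-! ### Finiteness of matrix coefficients and prescribed coordinates -/

theorem S_mem_Uk {k : Uq q} (hk : k ∈ Uk q) : S k ∈ Uk q := by
  induction hk using Algebra.adjoin_induction with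
  | mem u hu =>
    rcases hu with (hu | ⟨i, rfl⟩) | ⟨i, rfl⟩
    · rcases hu with rfl | rfl | rfl | rfl
      · rw [S_E]; exact neg_mem (mul_mem (Kinv_mem_Uk _) (E_mem_Uk (by decide)))
      · rw [S_F]; exact neg_mem (mul_mem (F_mem_Uk (by decide)) (K_mem_Uk _))
      · rw [S_E]; exact neg_mem (mul_mem (Kinv_mem_Uk _) (E_mem_Uk (by decide)))
      · rw [S_F]; exact neg_mem (mul_mem (F_mem_Uk (by decide)) (K_mem_Uk _))
    · rw [S_K]; exact Kinv_mem_Uk i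
    · rw [S_Kinv]; exact K_mem_Uk i
  | algebraMap r => rw [S_algebraMap]; exact algebraMap_mem _ r
  | add a b _ _ ha hb => rw [S_add]; exact add_mem ha hb
  | mul a b _ _ ha hb => rw [S_mul]; exact mul_mem hb ha

/-- Every functional in the orbit is a matrix coefficient of a function with the same two
properties. By `eq_zero_of_coordinates` it is determined by its coordinates, and those of degree
above N vanish. So the orbit embeds into a finite product of copies of ℂ². -/
theorem FIN_matCoef (hq : ∀ n : ℕ, 0 < n → q ^ n ≠ 1) (t : ℂˣ) {N : ℕ} {φ : DualFn}
    (h1 : φ ∈ vanishF) (h2 : φ ∈ degreeLE N) :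
    FIN (matCoef t (q_pow_ne_one hq two_pos) φ) := by
  set hq2 := q_pow_ne_one hq two_pos
  let T : Set (Fin 4 →₀ ℕ) := {γ | γ 0 + γ 1 + γ 2 + γ 3 ≤ N}
  have hT : T.Finite := by
    refine (Set.finite_Iic (Finsupp.equivFunOnFinite.symm fun _ => N)).subset fun γ hγ => ?_
    intro i
    have : γ i ≤ γ 0 + γ 1 + γ 2 + γ 3 := by fin_cases i <;> simp <;> omega
    simpa using this.trans hγ
  have := hT.to_subtype
  let L : compactOrbit (matCoef t hq2 φ) →ₗ[ℂ] T → ℂ × ℂ :=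
    { toFun := fun g γ => (g.1 (wMon q γ), g.1 (wMon q γ * F q .mu))
      map_add' := fun _ _ => rfl
      map_smul' := fun _ _ => rfl }
  refine FiniteDimensional.of_injective L ?_
  rw [← LinearMap.ker_eq_bot, LinearMap.ker_eq_bot']
  rintro ⟨g, hg⟩ hL
  obtain ⟨k, hk, rfl⟩ := mem_compactOrbit.1 hg
  have h1' := dualAct_mem_vanishF t hq2 (S k) h1
  have h2' := dualAct_mem_degreeLE t hq2 (S_mem_Uk hk) h2
  have hz : ∀ γ ∈ T, action q k (matCoef t hq2 φ) (wMon q γ) = 0 ∧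
      action q k (matCoef t hq2 φ) (wMon q γ * F q .mu) = 0 := fun γ hγ =>
    Prod.ext_iff.1 (congrFun hL ⟨γ, hγ⟩)
  refine Subtype.ext ?_
  change action q k (matCoef t hq2 φ) = 0
  rw [action_matCoef] at hz ⊢
  have hbig : ∀ γ : Fin 4 →₀ ℕ, γ ∉ T → (N : ℤ) < γ 0 + γ 1 + γ 2 + γ 3 := by
    intro γ hγ
    have : ¬ γ 0 + γ 1 + γ 2 + γ 3 ≤ N := hγ
    omega
  refine eq_zero_of_coordinates hq (isEquivariant_matCoef t hq2 _) (m := .mu) (n := .nu)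
    (by decide) (by decide) (fun i => by cases i <;> simp) F_nu_mul_F_mu (fun u => ?_)
    (matCoef_mul_F_nu t hq2 _) (fun γ => ?_) fun γ => ?_
  · rw [← mul_assoc, matCoef_mul_F_mu, dualAct_mul, dualAct_F]
    have := dualAct_mem_vanishF t hq2 u h1' 0 0 0 0 2 le_rfl
    simp [dualGen, this]
  · by_cases hγ : γ ∈ T
    · exact (hz γ hγ).1
    · rw [matCoef_wMon]; exact h2' _ _ _ _ _ (hbig γ hγ)
  · by_cases hγ : γ ∈ T
    · exact (hz γ hγ).2
    · rw [matCoef_wMon_mul_F_mu]; exact h2' _ _ _ _ _ (hbig γ hγ)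

theorem exists_mem_H0_mu (hq : ∀ n : ℕ, 0 < n → q ^ n ≠ 1) (t : ℂˣ) {N : ℕ}
    (c₀ c₁ : (Fin 4 →₀ ℕ) → ℂ)
    (hc : ∀ γ : Fin 4 →₀ ℕ, N < γ 0 + γ 1 + γ 2 + γ 3 → c₀ γ = 0 ∧ c₁ γ = 0) :
    ∃ f ∈ H0 q (char q⁻¹ t 1), ∀ γ, f (wMon q γ) = c₀ γ ∧ f (wMon q γ * F q .mu) = c₁ γ := by
  let ex : ℤ → ℤ → ℤ → ℤ → Fin 4 →₀ ℕ := fun a b c d =>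
    Finsupp.equivFunOnFinite.symm ![a.toNat, b.toNat, c.toNat, d.toNat]
  have hex : ∀ γ : Fin 4 →₀ ℕ, ex (γ 0) (γ 1) (γ 2) (γ 3) = γ := by
    intro γ
    ext i
    fin_cases i <;> simp [ex]
  let φ : DualFn := fun a b c d e =>
    if 0 ≤ a ∧ 0 ≤ b ∧ 0 ≤ c ∧ 0 ≤ d then
      if e = 0 then c₀ (ex a b c d) else if e = 1 then c₁ (ex a b c d) else 0
    else 0
  have h1 : φ ∈ vanishF := by
    intro a b c d e he
    have h0 : e ≠ 0 := by omega
    have h1 : e ≠ 1 := by omega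
    simp [φ, h0, h1]
  have h2 : φ ∈ degreeLE N := by
    intro a b c d e h
    by_cases hpos : 0 ≤ a ∧ 0 ≤ b ∧ 0 ≤ c ∧ 0 ≤ d
    · have := hc (ex a b c d) (by simp [ex]; omega)
      simp [φ, this.1, this.2]
    · simp [φ, hpos]
  -- In the model t is the eigenvalue of K_beta on v, which is the inverse of the value of the
  -- character.
  refine ⟨matCoef t⁻¹ (q_pow_ne_one hq two_pos) φ, mem_H0_iff.2 ⟨?_, FIN_matCoef hq _ h1 h2⟩,
    fun γ => ?_⟩
  · simpa using isEquivariant_matCoef t⁻¹ (q_pow_ne_one hq two_pos) φ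
  · rw [matCoef_wMon, matCoef_wMon_mul_F_mu]
    simp [φ, hex]

/-! ### The diagram automorphism -/

/-- The symmetry of the Dynkin diagram. -/
def Node.flip : Node → Node
  | .mu => .nu
  | .beta => .beta
  | .nu => .mu

theorem Node.flip_flip (i : Node) : i.flip.flip = i := by cases i <;> rfl

theorem cartan_flip (i j : Node) : cartan i.flip j.flip = cartan i j := by
  cases i <;> cases j <;> rfl

/-- The images of the generators under the diagram automorphism. -/
def flipGen : Gen → Gen
  | .E i => .E i.flip
  | .F i => .F i.flip
  | .K i => .K i.flip
  | .Kinv i => .Kinv i.flip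

theorem flip_rel (q : ℂˣ) ⦃a b : FreeAlgebra ℂ Gen⦄ (h : Rel q a b) :
    FreeAlgebra.lift ℂ (fun g => toUq q (gen (flipGen g))) a
      = FreeAlgebra.lift ℂ (fun g => toUq q (gen (flipGen g))) b := by
  cases h <;> simp only [map_mul, map_sub, map_add, map_smul, map_one, map_zero,
    FreeAlgebra.lift_ι_apply, flipGen]
  case K_Kinv i => exact K_mul_Kinv _
  case Kinv_K i => exact Kinv_mul_K _
  case K_K i j => exact K_mul_K _ _
  case K_E i j => rw [← cartan_flip]; exact K_mul_E _ _
  case K_F i j => rw [← cartan_flip]; exact K_mul_F _ _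
  case E_F_same i => exact sub_eq_of_eq_add' (E_mul_F_same _)
  case E_F_ne i j hij =>
    exact E_mul_F_ne fun h => hij (by rw [← i.flip_flip, h, j.flip_flip])
  case E_E i j hij => exact E_mul_E ((cartan_flip i j).trans hij)
  case F_F i j hij => exact F_mul_F ((cartan_flip i j).trans hij)
  case serre_E i j hij => exact serre_E ((cartan_flip i j).trans hij)
  case serre_F i j hij => exact serre_F ((cartan_flip i j).trans hij)

variable (q) in
/-- The diagram automorphism of `U_q`. -/
noncomputable def flipHom : Uq q →ₐ[ℂ] Uq q :=
  RingQuot.liftAlgHom ℂ ⟨FreeAlgebra.lift ℂ fun g => toUq q (gen (flipGen g)), flip_rel q⟩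

theorem flipHom_toUq (g : Gen) : flipHom q (toUq q (gen g)) = toUq q (gen (flipGen g)) :=
  (RingQuot.liftAlgHom_mkAlgHom_apply ℂ _ _ _).trans (FreeAlgebra.lift_ι_apply _ _)

theorem flipHom_E (i : Node) : flipHom q (E q i) = E q i.flip := flipHom_toUq _
theorem flipHom_F (i : Node) : flipHom q (F q i) = F q i.flip := flipHom_toUq _
theorem flipHom_K (i : Node) : flipHom q (K q i) = K q i.flip := flipHom_toUq _
theorem flipHom_Kinv (i : Node) : flipHom q (Kinv q i) = Kinv q i.flip := flipHom_toUq _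

theorem flipHom_S (u : Uq q) : flipHom q (S u) = S (flipHom q u) := by
  induction u using Uq_induction with
  | hE i => rw [flipHom_E, S_E, S_E, map_neg, map_mul, flipHom_E, flipHom_Kinv]
  | hF i => rw [flipHom_F, S_F, S_F, map_neg, map_mul, flipHom_F, flipHom_K]
  | hK i => rw [flipHom_K, S_K, S_K, flipHom_Kinv]
  | hKinv i => rw [flipHom_Kinv, S_Kinv, S_Kinv, flipHom_K]
  | hc c => rw [S_algebraMap, AlgHom.commutes, S_algebraMap]
  | hadd a b ha hb => rw [S_add, map_add, ha, hb, map_add, S_add]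
  | hmul a b ha hb => rw [S_mul, map_mul, ha, hb, map_mul, S_mul]

theorem flipHom_mem_Uk {k : Uq q} (hk : k ∈ Uk q) : flipHom q k ∈ Uk q := by
  induction hk using Algebra.adjoin_induction with
  | mem u hu =>
    rcases hu with (hu | ⟨i, rfl⟩) | ⟨i, rfl⟩
    · rcases hu with rfl | rfl | rfl | rfl
      · rw [flipHom_E]; exact E_mem_Uk (by decide)
      · rw [flipHom_F]; exact F_mem_Uk (by decide)
      · rw [flipHom_E]; exact E_mem_Uk (by decide)
      · rw [flipHom_F]; exact F_mem_Uk (by decide)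
    · rw [flipHom_K]; exact K_mem_Uk _
    · rw [flipHom_Kinv]; exact Kinv_mem_Uk _
  | algebraMap r => rw [AlgHom.commutes]; exact algebraMap_mem _ r
  | add a b _ _ ha hb => rw [map_add]; exact add_mem ha hb
  | mul a b _ _ ha hb => rw [map_mul]; exact mul_mem ha hb

theorem flip_mem_H0 {χ : Node → ℂˣ} {f : Functional q} (hf : f ∈ H0 q χ) :
    f ∘ₗ (flipHom q).toLinearMap ∈ H0 q fun i => χ i.flip := by
  refine mem_H0_iff.2 ⟨⟨fun u i => ?_, fun u i => ?_⟩, ?_⟩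
  · simp [flipHom_K, H0_mul_K hf]
  · simp [flipHom_E, H0_mul_E hf]
  · have h := hf.2.2
    unfold FIN at *
    refine Submodule.finiteDimensional_of_le
      (S₂ := (compactOrbit f).map (LinearMap.lcomp ℂ ℂ (flipHom q).toLinearMap)) ?_
    intro g hg
    obtain ⟨k, hk, rfl⟩ := mem_compactOrbit.1 hg
    refine ⟨_, mem_compactOrbit.2 ⟨_, flipHom_mem_Uk hk, rfl⟩, ?_⟩
    ext u
    simp [action_apply, flipHom_S]

/-- The automorphism exchanges w_2 and w_3 and fixes w_1 and w_4. Since w_2 and w_3 commute, the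
image is again an ordered monomial. -/
theorem flipHom_wMon (hq : ∀ n : ℕ, 0 < n → q ^ n ≠ 1) (γ : Fin 4 →₀ ℕ) :
    flipHom q (wMon q γ)
      = wMon q (Finsupp.equivFunOnFinite.symm ![γ 0, γ 2, γ 1, γ 3]) := by
  have h0 : flipHom q (w q 0) = w q 0 := flipHom_F _
  have h1 : flipHom q (w q 1) = w q 2 := by
    simp [w_one, w_two, flipHom_F, Node.flip]
  have h2 : flipHom q (w q 2) = w q 1 := by
    simp [w_one, w_two, flipHom_F, Node.flip]
  have h3 : flipHom q (w q 3) = w q 3 := by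
    rw [w_three, map_sub, map_smul, map_mul, map_mul, h2, flipHom_F]
    exact w_three_eq.symm
  have hc : w q 2 ^ γ 1 * w q 1 ^ γ 2 = w q 1 ^ γ 2 * w q 2 ^ γ 1 :=
    Commute.pow_pow (w_two_mul_w_one hq) _ _
  simp only [wMon, map_mul, map_pow, h0, h1, h2, h3]
  rw [mul_assoc (w q 0 ^ _), hc]
  simp [mul_assoc]

theorem exists_mem_H0_nu (hq : ∀ n : ℕ, 0 < n → q ^ n ≠ 1) (t : ℂˣ) {N : ℕ}
    (c₀ c₁ : (Fin 4 →₀ ℕ) → ℂ)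
    (hc : ∀ γ : Fin 4 →₀ ℕ, N < γ 0 + γ 1 + γ 2 + γ 3 → c₀ γ = 0 ∧ c₁ γ = 0) :
    ∃ f ∈ H0 q (char 1 t q⁻¹), ∀ γ, f (wMon q γ) = c₀ γ ∧ f (wMon q γ * F q .nu) = c₁ γ := by
  let r : (Fin 4 →₀ ℕ) → Fin 4 →₀ ℕ := fun γ =>
    Finsupp.equivFunOnFinite.symm ![γ 0, γ 2, γ 1, γ 3]
  have hr : ∀ γ, r (r γ) = γ := by
    intro γ
    ext i
    fin_cases i <;> simp [r]
  obtain ⟨f, hf, h⟩ := exists_mem_H0_mu hq t (N := N) (fun γ => c₀ (r γ)) (fun γ => c₁ (r γ))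
    (fun γ hγ => hc (r γ) (by simp [r]; omega))
  refine ⟨f ∘ₗ (flipHom q).toLinearMap, ?_, fun γ => ?_⟩
  · convert flip_mem_H0 hf using 2
    funext i
    cases i <;> rfl
  · have h' := h (r γ)
    simp only [hr] at h'
    simpa [flipHom_wMon hq, flipHom_F, Node.flip, r] using h'

/-! ### The coordinates on `H⁰(χ)` -/

theorem Psi_add (f g : Functional q) : Psi (f + g) = Psi f + Psi g := by
  funext γ; exact add_div _ _ _

theorem Psi_smul (c : ℂ) (f : Functional q) : Psi (c • f) = c • Psi f := by
  funext γ; exact mul_div_assoc _ _ _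

theorem exists_coe_eq_Psi {f : Functional q}
    (hf : {γ : Fin 4 →₀ ℕ | f (wMon q γ) ≠ 0}.Finite) :
    ∃ p : Poly, (p : MvPowerSeries (Fin 4) ℂ) = Psi f := by
  classical
  refine ⟨∑ γ ∈ hf.toFinset, MvPolynomial.monomial γ (MvPowerSeries.coeff γ (Psi f)), ?_⟩
  ext γ
  rw [MvPolynomial.coeff_coe, MvPolynomial.coeff_sum]
  simp only [MvPolynomial.coeff_monomial]
  rw [Finset.sum_eq_single γ (fun δ _ h => if_neg h), if_pos rfl]
  · intro h
    have h' : f (wMon q γ) = 0 := by simpa using h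
    rw [if_pos rfl]
    change f (wMon q γ) / _ = 0
    rw [h', zero_div]

theorem eq_zero_of_Psi_eq_zero (hq : ∀ n : ℕ, 0 < n → q ^ n ≠ 1) {f : Functional q}
    (h : Psi f = 0) (γ : Fin 4 →₀ ℕ) : f (wMon q γ) = 0 := by
  have := (coe_eq_Psi_iff (p := 0) hq).1 (by rw [h, MvPolynomial.coe_zero]) γ
  simpa using this

/-- Pairs (Ψ_f, Ψ_{f_{F_m}}) and pairs of polynomials both embed into pairs of power series. The two
images agree, by finite support in one direction and by `hex` in the other, so the embeddings
compose to an isomorphism. -/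
theorem exists_isCoordinates_of (hq : ∀ n : ℕ, 0 < n → q ^ n ≠ 1) {χ : Node → ℂˣ} {m : Node}
    (hext : ∀ f ∈ H0 q χ, (∀ γ, f (wMon q γ) = 0) → (∀ γ, f (wMon q γ * F q m) = 0) → f = 0)
    (hex : ∀ (N : ℕ) (c₀ c₁ : (Fin 4 →₀ ℕ) → ℂ),
      (∀ γ : Fin 4 →₀ ℕ, N < γ 0 + γ 1 + γ 2 + γ 3 → c₀ γ = 0 ∧ c₁ γ = 0) →
      ∃ f ∈ H0 q χ, ∀ γ, f (wMon q γ) = c₀ γ ∧ f (wMon q γ * F q m) = c₁ γ) :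
    ∃ Φ, IsCoordinates χ (F q m) Φ := by
  let A : H0 q χ →ₗ[ℂ] Fin 2 → MvPowerSeries (Fin 4) ℂ :=
    { toFun := fun f => ![Psi (f : Functional q), Psi (rightTranslate (F q m) f)]
      map_add' := fun f g => by
        funext i
        fin_cases i
        · exact Psi_add _ _
        · exact Psi_add (rightTranslate (F q m) f) (rightTranslate (F q m) g)
      map_smul' := fun c f => by
        funext i
        fin_cases i
        · exact Psi_smul _ _
        · exact Psi_smul c (rightTranslate (F q m) f) }
  let B : (Fin 2 → Poly) →ₗ[ℂ] Fin 2 → MvPowerSeries (Fin 4) ℂ :=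
    { toFun := fun p i => p i
      map_add' := fun p r => by funext i; exact MvPolynomial.coe_add _ _
      map_smul' := fun c p => by funext i; exact MvPolynomial.coe_smul _ _ }
  have hA : Function.Injective A := by
    rw [← LinearMap.ker_eq_bot, LinearMap.ker_eq_bot']
    intro f hf
    exact Subtype.ext (hext f f.2 (eq_zero_of_Psi_eq_zero hq (congrFun hf 0))
      (eq_zero_of_Psi_eq_zero (f := rightTranslate (F q m) f) hq (congrFun hf 1)))
  have hB : Function.Injective B := fun p r h =>
    funext fun i => MvPolynomial.coe_injective _ _ (congrFun h i)
  have hAB : LinearMap.range A = LinearMap.range B := by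
    apply le_antisymm
    · rintro _ ⟨f, rfl⟩
      obtain ⟨p₀, h₀⟩ := exists_coe_eq_Psi (finite_support_H0 hq f.2)
      obtain ⟨p₁, h₁⟩ := exists_coe_eq_Psi (f := rightTranslate (F q m) f)
        (finite_support_H0_mul_F hq f.2 m)
      refine ⟨![p₀, p₁], ?_⟩
      funext i
      fin_cases i
      · exact h₀
      · exact h₁
    · rintro _ ⟨p, rfl⟩
      have hdeg : ∀ (p : Poly) (γ : Fin 4 →₀ ℕ), p.totalDegree < γ 0 + γ 1 + γ 2 + γ 3 →
          MvPolynomial.coeff γ p = 0 := by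
        intro p γ hγ
        apply MvPolynomial.coeff_eq_zero_of_totalDegree_lt
        rwa [← Finsupp.degree_apply, Finsupp.degree_eq_sum, Fin.sum_univ_four]
      obtain ⟨f, hf, h⟩ := hex (max (p 0).totalDegree (p 1).totalDegree)
        (fun γ => MvPolynomial.coeff γ (p 0) * ∏ i : Fin 4, qFact q (γ i))
        (fun γ => MvPolynomial.coeff γ (p 1) * ∏ i : Fin 4, qFact q (γ i))
        (fun γ hγ => ⟨by rw [hdeg _ _ ((le_max_left _ _).trans_lt hγ), zero_mul],
          by rw [hdeg _ _ ((le_max_right _ _).trans_lt hγ), zero_mul]⟩)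
      refine ⟨⟨f, hf⟩, ?_⟩
      funext i
      fin_cases i
      · exact ((coe_eq_Psi_iff hq).2 fun γ => (h γ).1).symm
      · exact ((coe_eq_Psi_iff (f := rightTranslate (F q m) f) hq).2 fun γ => (h γ).2).symm
  let Φ : H0 q χ ≃ₗ[ℂ] (Fin 2 → Poly) := (LinearEquiv.ofInjective A hA).trans
    ((LinearEquiv.ofEq _ _ hAB).trans (LinearEquiv.ofInjective B hB).symm)
  have hΦ : ∀ f, B (Φ f) = A f := by
    intro f
    have h := congrArg Subtype.val ((LinearEquiv.ofInjective B hB).apply_symm_apply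
      (LinearEquiv.ofEq _ _ hAB (LinearEquiv.ofInjective A hA f)))
    exact h
  exact ⟨Φ, fun f => ⟨congrFun (hΦ f) 0, congrFun (hΦ f) 1⟩⟩

theorem H0_mul_F_eq_zero (hq : ∀ n : ℕ, 0 < n → q ^ n ≠ 1) {χ : Node → ℂˣ} {f : Functional q}
    (hf : f ∈ H0 q χ) {i : Node} (hi : i ≠ .beta) (hχ : χ i = 1) (u : Uq q) :
    f (u * F q i) = 0 := by
  simpa using H0_mul_F_pow_eq_zero hq hf hi (N := 0) (by simp [hχ]) u

theorem H0_mul_F_mul_F_eq_zero (hq : ∀ n : ℕ, 0 < n → q ^ n ≠ 1) {χ : Node → ℂˣ}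
    {f : Functional q} (hf : f ∈ H0 q χ) {i : Node} (hi : i ≠ .beta) (hχ : χ i = q⁻¹) (u : Uq q) :
    f (u * (F q i * F q i)) = 0 := by
  simpa [pow_two] using H0_mul_F_pow_eq_zero hq hf hi (N := 1) (by simp [hχ]) u

theorem exists_isCoordinates_mu (hq : ∀ n : ℕ, 0 < n → q ^ n ≠ 1) (t : ℂˣ) :
    ∃ Φ, IsCoordinates (char q⁻¹ t 1) (F q .mu) Φ :=
  exists_isCoordinates_of hq
    (fun _ hf => eq_zero_of_coordinates hq (mem_H0_iff.1 hf).1 (n := .nu) (by decide) (by decide)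
      (fun i => by cases i <;> simp) F_nu_mul_F_mu
      (H0_mul_F_mul_F_eq_zero hq hf (by decide) rfl) (H0_mul_F_eq_zero hq hf (by decide) rfl))
    fun _ => exists_mem_H0_mu hq t

theorem exists_isCoordinates_nu (hq : ∀ n : ℕ, 0 < n → q ^ n ≠ 1) (t : ℂˣ) :
    ∃ Φ, IsCoordinates (char 1 t q⁻¹) (F q .nu) Φ :=
  exists_isCoordinates_of hq
    (fun _ hf => eq_zero_of_coordinates hq (mem_H0_iff.1 hf).1 (n := .mu) (by decide) (by decide)
      (fun i => by cases i <;> simp) F_nu_mul_F_mu.symm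
      (H0_mul_F_mul_F_eq_zero hq hf (by decide) rfl) (H0_mul_F_eq_zero hq hf (by decide) rfl))
    fun _ => exists_mem_H0_nu hq t

/-! ### The intertwining maps in coordinates -/

theorem Dplus_eq : Dplus q = !![wDag q 1, wDag q 3;
    (-(q : ℂ)⁻¹) • wDag q 0, (-(q : ℂ)⁻¹) • wDag q 2] := by
  ext1 i j
  fin_cases i <;> fin_cases j <;> simp [Dplus, wDag, smul_smul]
  module

theorem Dminus_eq : Dminus q = !![wDag q 2, wDag q 3;
    (-(q : ℂ)⁻¹) • wDag q 0, (-(q : ℂ)⁻¹) • wDag q 1] := by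
  ext1 i j
  fin_cases i <;> fin_cases j <;> simp [Dminus, wDag, smul_smul]
  module

/-- The transform of `f ↦ f_{w_i + c w_j a}`. -/
theorem coe_add_smul_wDag (hq : ∀ n : ℕ, 0 < n → q ^ n ≠ 1) {f g : Functional q} {a : Uq q}
    {p₀ p₁ : Poly} (h₀ : (p₀ : MvPowerSeries (Fin 4) ℂ) = Psi f)
    (h₁ : (p₁ : MvPowerSeries (Fin 4) ℂ) = Psi (rightTranslate a f)) (i j : Fin 4) (c : ℂ)
    (hg : ∀ u, g u = f (u * (w q i + c • (w q j * a)))) :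
    ((wDag q i p₀ + (c • wDag q j) p₁ : Poly) : MvPowerSeries (Fin 4) ℂ) = Psi g := by
  have e : g = rightTranslate (w q i) f + c • rightTranslate (w q j) (rightTranslate a f) := by
    ext u
    rw [hg]
    simp [rightTranslate_apply, mul_add, mul_assoc]
  rw [e, Psi_add, Psi_smul, MvPolynomial.coe_add, LinearMap.smul_apply, MvPolynomial.coe_smul,
    isTransform_w hq i f p₀ h₀, isTransform_w hq j _ p₁ h₁]

/-- The second coordinate of the image of f consists of the values f(w^γ F_nu u₀). The last summand
is a left multiple of F_nu and is killed by f because χ(K_nu) = 1; the others give the second column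
of D⁺. -/
theorem F_nu_mul_uPlus : F q .nu * uPlus q = w q 3 + (-(q : ℂ)⁻¹) • (w q 2 * F q .mu)
    + ((q : ℂ) • w q 1 - w q 0 * F q .mu) * F q .nu := by
  have h0 := q_ne_zero (q := q)
  rw [uPlus, mul_sub, F_nu_mul_w_one, mul_smul_comm, ← mul_assoc, F_nu_mul_w_zero]
  simp only [add_mul, sub_mul, smul_mul_assoc, mul_assoc, F_nu_mul_F_mu, smul_add, smul_smul,
    inv_mul_cancel₀ h0]
  module

theorem F_mu_mul_uMinus : F q .mu * uMinus q = w q 3 + (-(q : ℂ)⁻¹) • (w q 1 * F q .nu)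
    + ((q : ℂ) • w q 2 - w q 0 * F q .nu) * F q .mu := by
  have h0 := q_ne_zero (q := q)
  rw [uMinus, mul_sub, F_mu_mul_w_two, mul_smul_comm, ← mul_assoc, F_mu_mul_w_zero]
  simp only [add_mul, sub_mul, smul_mul_assoc, mul_assoc, F_nu_mul_F_mu, smul_add, smul_smul,
    inv_mul_cancel₀ h0]
  module

theorem coordinates_uPlus (hq : ∀ n : ℕ, 0 < n → q ^ n ≠ 1) {t t' : ℂˣ}
    {T : H0 q (char q⁻¹ t 1) →ₗ[ℂ] H0 q (char 1 t' q⁻¹)}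
    (hT : IsIntertwiner (uPlus q) (char q⁻¹ t 1) (char 1 t' q⁻¹) T) :
    ∃ Φ Φ', IsCoordinates _ (F q .mu) Φ ∧ IsCoordinates _ (F q .nu) Φ' ∧
      ∀ f, Φ' (T f) = rowMul (Φ f) (Dplus q) := by
  obtain ⟨Φ, hΦ⟩ := exists_isCoordinates_mu hq t
  obtain ⟨Φ', hΦ'⟩ := exists_isCoordinates_nu hq t'
  refine ⟨Φ, Φ', hΦ, hΦ', fun f => funext fun k => MvPolynomial.coe_injective _ _ ?_⟩
  have hTf := hT.1 f
  rw [rowMul, Fin.sum_univ_two, Dplus_eq]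
  fin_cases k
  · refine ((hΦ' (T f)).1).trans
      (coe_add_smul_wDag hq (hΦ f).1 (hΦ f).2 1 0 (-(q : ℂ)⁻¹) fun u => ?_).symm
    rw [hTf, rightTranslate_apply, uPlus, neg_smul, sub_eq_add_neg]
  · refine ((hΦ' (T f)).2).trans
      (coe_add_smul_wDag hq (hΦ f).1 (hΦ f).2 3 2 (-(q : ℂ)⁻¹) fun u => ?_).symm
    rw [hTf, rightTranslate_apply, rightTranslate_apply, mul_assoc, F_nu_mul_uPlus, mul_add,
      map_add, ← mul_assoc u (_ - _), H0_mul_F_eq_zero hq f.2 (by decide) rfl, add_zero]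

theorem coordinates_uMinus (hq : ∀ n : ℕ, 0 < n → q ^ n ≠ 1) {t t' : ℂˣ}
    {T : H0 q (char 1 t q⁻¹) →ₗ[ℂ] H0 q (char q⁻¹ t' 1)}
    (hT : IsIntertwiner (uMinus q) (char 1 t q⁻¹) (char q⁻¹ t' 1) T) :
    ∃ Φ Φ', IsCoordinates _ (F q .nu) Φ ∧ IsCoordinates _ (F q .mu) Φ' ∧
      ∀ f, Φ' (T f) = rowMul (Φ f) (Dminus q) := by
  obtain ⟨Φ, hΦ⟩ := exists_isCoordinates_nu hq t
  obtain ⟨Φ', hΦ'⟩ := exists_isCoordinates_mu hq t'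
  refine ⟨Φ, Φ', hΦ, hΦ', fun f => funext fun k => MvPolynomial.coe_injective _ _ ?_⟩
  have hTf := hT.1 f
  rw [rowMul, Fin.sum_univ_two, Dminus_eq]
  fin_cases k
  · refine ((hΦ' (T f)).1).trans
      (coe_add_smul_wDag hq (hΦ f).1 (hΦ f).2 2 0 (-(q : ℂ)⁻¹) fun u => ?_).symm
    rw [hTf, rightTranslate_apply, uMinus, neg_smul, sub_eq_add_neg]
  · refine ((hΦ' (T f)).2).trans
      (coe_add_smul_wDag hq (hΦ f).1 (hΦ f).2 3 1 (-(q : ℂ)⁻¹) fun u => ?_).symm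
    rw [hTf, rightTranslate_apply, rightTranslate_apply, mul_assoc, F_mu_mul_uMinus, mul_add,
      map_add, ← mul_assoc u (_ - _), H0_mul_F_eq_zero hq f.2 (by decide) rfl, add_zero]

/-- Turns q^(2x-4) = 1 into t² = q⁴ for t = q^x, the form in which the condition enters the action
of E_beta on u₀. -/
theorem qpow_sq_eq {ħ x : ℂ} (hx : qpow ħ (2 * x - 4) = 1) :
    (qpow ħ x : ℂ) ^ 2 = (qpow ħ 1 : ℂ) ^ 4 := by
  have h : Complex.exp (ħ * (2 * x - 4)) = 1 := congrArg Units.val hx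
  have e : Complex.exp (ħ * x) ^ 2
      = Complex.exp (ħ * (2 * x - 4)) * Complex.exp (ħ * 1) ^ 4 := by
    rw [← Complex.exp_nat_mul, ← Complex.exp_nat_mul, ← Complex.exp_add]
    congr 1
    push_cast
    ring
  rw [h, one_mul] at e
  exact e

theorem qpow_add_one (ħ x : ℂ) : qpow ħ (x + 1) = qpow ħ x * qpow ħ 1 := by
  ext
  simp [qpow, mul_add, Complex.exp_add]

end QDirac

/-! ### The theorem -/

theorem mainTheorem1 (ħ x : ℂ) (q : ℂˣ) (hq : q = QDirac.qpow ħ 1) (hq2 : (q : ℂ) ^ 2 ≠ 1) :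
    -- the identifications with `𝒫 ⊗ ℂ²` of the two kinds of induced representations, for all `x`
    ((∀ n : ℕ, 0 < n → q ^ n ≠ 1) →
      (∃ Φ, QDirac.IsCoordinates (q := q)
        (QDirac.char q⁻¹ (QDirac.qpow ħ x) 1) (QDirac.F q .mu) Φ) ∧
      (∃ Φ, QDirac.IsCoordinates (q := q)
        (QDirac.char 1 (QDirac.qpow ħ x) q⁻¹) (QDirac.F q .nu) Φ)) ∧
    -- the operators `(w_i^R)†` and the quantized wave operator in coordinates
    ((∀ n : ℕ, 0 < n → q ^ n ≠ 1) →
      (∀ i, QDirac.IsTransform (QDirac.w q i) (QDirac.wDag q i)) ∧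
      QDirac.IsTransform
        (QDirac.w q 0 * QDirac.w q 3 - (q : ℂ) • (QDirac.w q 1 * QDirac.w q 2)) (QDirac.box q)) ∧
    -- the operators `D⁺` and `D⁻` are composed of the operators `(w_i^R)†`
    (QDirac.Dplus q =
        !![QDirac.wDag q 1, QDirac.wDag q 3;
           (-(q : ℂ)⁻¹) • QDirac.wDag q 0, (-(q : ℂ)⁻¹) • QDirac.wDag q 2] ∧
      QDirac.Dminus q =
        !![QDirac.wDag q 2, QDirac.wDag q 3;
           (-(q : ℂ)⁻¹) • QDirac.wDag q 0, (-(q : ℂ)⁻¹) • QDirac.wDag q 1]) ∧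
    -- the intertwiners `f ↦ f_{u₀}`, which are `D⁺` and `D⁻` in coordinates
    (QDirac.qpow ħ (2 * x - 4) = 1 →
      (∃ T, QDirac.IsIntertwiner (QDirac.uPlus q)
          (QDirac.char q⁻¹ (QDirac.qpow ħ x) 1)
          (QDirac.char 1 (QDirac.qpow ħ (x + 1)) q⁻¹) T ∧
        ((∀ n : ℕ, 0 < n → q ^ n ≠ 1) →
          ∃ Φ Φ', QDirac.IsCoordinates _ (QDirac.F q .mu) Φ ∧
            QDirac.IsCoordinates _ (QDirac.F q .nu) Φ' ∧
            ∀ f, Φ' (T f) = QDirac.rowMul (Φ f) (QDirac.Dplus q))) ∧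
      (∃ T, QDirac.IsIntertwiner (QDirac.uMinus q)
          (QDirac.char 1 (QDirac.qpow ħ x) q⁻¹)
          (QDirac.char q⁻¹ (QDirac.qpow ħ (x + 1)) 1) T ∧
        ((∀ n : ℕ, 0 < n → q ^ n ≠ 1) →
          ∃ Φ Φ', QDirac.IsCoordinates _ (QDirac.F q .nu) Φ ∧
            QDirac.IsCoordinates _ (QDirac.F q .mu) Φ' ∧
            ∀ f, Φ' (T f) = QDirac.rowMul (Φ f) (QDirac.Dminus q)))) := by
  refine ⟨fun h => ⟨QDirac.exists_isCoordinates_mu h _, QDirac.exists_isCoordinates_nu h _⟩,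
    fun h => ⟨QDirac.isTransform_w h, QDirac.isTransform_box h⟩,
    ⟨QDirac.Dplus_eq, QDirac.Dminus_eq⟩, fun hx => ?_⟩
  have ht : (QDirac.qpow ħ x : ℂ) ^ 2 = (q : ℂ) ^ 4 := hq ▸ QDirac.qpow_sq_eq hx
  have ht' : QDirac.qpow ħ (x + 1) = QDirac.qpow ħ x * q := hq ▸ QDirac.qpow_add_one ħ x
  obtain ⟨T, hT⟩ := QDirac.exists_isIntertwiner fun f hf =>
    QDirac.rightTranslate_uPlus_mem hq2 ht ht' (f := f) hf
  obtain ⟨T', hT'⟩ := QDirac.exists_isIntertwiner fun f hf =>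
    QDirac.rightTranslate_uMinus_mem hq2 ht ht' (f := f) hf
  exact ⟨⟨T, hT, fun h => QDirac.coordinates_uPlus h hT⟩,
    ⟨T', hT', fun h => QDirac.coordinates_uMinus h hT'⟩⟩
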